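/- There is a randomized Monte Carlo algorithm, that is, one fixed program for a random access machine with fair coin flips and logarithmic cost (each instruction is charged by the bit lengths of the numbers and addresses it handles), with the following properties. Its input is a finite simple undirected graph $G$ with vertex set $\{0,\dots,n-1\}$, a natural number $q$ (in binary), and a path decomposition of $G$, i.e. a sequence of bags $B_0,\dots,B_{\ell-1}\subseteq V(G)$ such that every vertex lies in some bag, both ends of every edge lie in a common bag, and for each vertex the bags containing it are consecutive. Let $d$ be the maximum degree of $G$ (with $d=0$ if $n=0$), let $\mathrm{pw}=\max_i |B_i|-1$ be the width of the given decomposition (read as $0$ if there is no nonempty bag), and let $N$ be the number of bits of the input. Then, for constants $C$ and $c$ that depend neither on the input nor on $q$: 1. for all outcomes of the coin flips the algorithm halts with an answer, YES or NO, in time at most $C\cdot(\lfloor d/2\rfloor+1)^{\mathrm{pw}}\cdot N^{c}$, i.e. in $\mathcal{O}^*\big((\lfloor d/2\rfloor+1)^{\mathrm{pw}}\big)$ time; 2. if $G$ has no proper $q$-coloring, the answer is always NO; 3. if $G$ has a proper $q$-coloring, the answer is YES with probability at least $1-1/N$. -/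

import Mathlib

open MeasureTheory

/-! ## Path decompositions -/

/-- A path decomposition of a graph `G`: a sequence of bags along a path with nodes
`0, …, len - 1`, such that every vertex lies in a bag, both ends of every edge lie in a
common bag, and the bags that contain a given vertex are consecutive. -/
structure PathDecomposition {V : Type} (G : SimpleGraph V) where
  /-- number of nodes of the path -/
  len : ℕ
  /-- the bag of a node -/
  bag : Fin len → Finset V
  vertex_mem : ∀ v, ∃ i, v ∈ bag i
  edge_mem : ∀ u v, G.Adj u v → ∃ i, u ∈ bag i ∧ v ∈ bag i
  between : ∀ i j k, i ≤ j → j ≤ k → ∀ v, v ∈ bag i → v ∈ bag k → v ∈ bag j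

/-- The size of the largest bag minus one. (The truncated subtraction matters only for the
graph without vertices.) -/
def PathDecomposition.width {V : Type} {G : SimpleGraph V} (P : PathDecomposition G) : ℕ :=
  (Finset.univ.sup fun i => (P.bag i).card) - 1

/-! ## Randomized random access machines with logarithmic cost

The machine has a read-only, randomly accessible input, a memory of registers `0, 1, 2, …`
each of which holds an integer, and a source of independent fair coin flips. All operations are
charged by the bit lengths of the numbers and of the addresses involved. Programs are written
with structured control flow instead of jumps. -/

/-- Bit length of an integer, including one bit for the sign; it is at least `1`. -/
def bitLen (z : ℤ) : ℕ := z.natAbs.size + 1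

/-- Arithmetical operations of the machine. -/
inductive Op where
  | add
  | sub
  | mul
  | div

/-- The meaning of the operations; division is rounded (and gives `0` for the divisor `0`). -/
def Op.eval : Op → ℤ → ℤ → ℤ
  | .add, a, b => a + b
  | .sub, a, b => a - b
  | .mul, a, b => a * b
  | .div, a, b => a / b

/-- Expressions. A negative address is read as address `0`. -/
inductive Expr where
  /-- an integer constant -/
  | const (z : ℤ)
  /-- the word of the input at the address given by `a` -/
  | inp (a : Expr)
  /-- the content of the register whose address is given by `a` -/
  | reg (a : Expr)
  /-- an arithmetical operation -/
  | op (o : Op) (a b : Expr)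

/-- The value of an expression for input `x` and memory `m`. -/
def Expr.eval (x : ℕ → ℤ) (m : ℕ → ℤ) : Expr → ℤ
  | .const z => z
  | .inp a => x (a.eval x m).toNat
  | .reg a => m (a.eval x m).toNat
  | .op o a b => o.eval (a.eval x m) (b.eval x m)

/-- The cost of the evaluation of an expression: every access is charged with the bit lengths
of the address and of the content, every operation with the bit lengths of its operands. -/
def Expr.cost (x : ℕ → ℤ) (m : ℕ → ℤ) : Expr → ℕ
  | .const z => bitLen z
  | .inp a => a.cost x m + bitLen (a.eval x m) + bitLen ((Expr.inp a).eval x m)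
  | .reg a => a.cost x m + bitLen (a.eval x m) + bitLen ((Expr.reg a).eval x m)
  | .op _ a b => a.cost x m + b.cost x m + bitLen (a.eval x m) + bitLen (b.eval x m)

/-- Programs. -/
inductive Prog where
  /-- do nothing -/
  | skip
  /-- write the value of `e` into the register whose address is given by `a` -/
  | assign (a e : Expr)
  /-- flip a coin, and write `1` or `0` into the register whose address is given by `a` -/
  | flip (a : Expr)
  /-- one program after the other -/
  | seq (p q : Prog)
  /-- run `p` if the value of `e` is positive, and `q` otherwise -/
  | ite (e : Expr) (p q : Prog)
  /-- run `p` again and again as long as the value of `e` is positive -/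
  | loop (e : Expr) (p : Prog)

/-- A state of the machine: the content of the memory, and the number of coins flipped. -/
structure MState where
  /-- content of the memory -/
  mem : ℕ → ℤ
  /-- number of coins flipped so far -/
  used : ℕ

/-- Initially all registers hold `0`. -/
def MState.init : MState := ⟨fun _ => 0, 0⟩

/-- `Exec x ω p s t s'`: on input `x`, when the successive coin flips come out as
`ω 0, ω 1, …`, the program `p` started in state `s` halts in state `s'` and its total cost
is `t`. -/
inductive Exec (x : ℕ → ℤ) (ω : ℕ → Bool) : Prog → MState → ℕ → MState → Prop where
  | skip (s : MState) : Exec x ω .skip s 1 s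
  | assign (a e : Expr) (s : MState) :
      Exec x ω (.assign a e) s
        (a.cost x s.mem + e.cost x s.mem
          + bitLen (a.eval x s.mem) + bitLen (e.eval x s.mem))
        ⟨Function.update s.mem (a.eval x s.mem).toNat (e.eval x s.mem), s.used⟩
  | flip (a : Expr) (s : MState) :
      Exec x ω (.flip a) s
        (a.cost x s.mem + bitLen (a.eval x s.mem) + 1)
        ⟨Function.update s.mem (a.eval x s.mem).toNat (if ω s.used then 1 else 0), s.used + 1⟩
  | seq {p q : Prog} {s s' s'' : MState} {t t' : ℕ}
      (hp : Exec x ω p s t s') (hq : Exec x ω q s' t' s'') :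
      Exec x ω (.seq p q) s (t + t') s''
  | ite_pos {e : Expr} {p q : Prog} {s s' : MState} {t : ℕ}
      (he : 0 < e.eval x s.mem) (hp : Exec x ω p s t s') :
      Exec x ω (.ite e p q) s (e.cost x s.mem + bitLen (e.eval x s.mem) + t) s'
  | ite_neg {e : Expr} {p q : Prog} {s s' : MState} {t : ℕ}
      (he : ¬ 0 < e.eval x s.mem) (hq : Exec x ω q s t s') :
      Exec x ω (.ite e p q) s (e.cost x s.mem + bitLen (e.eval x s.mem) + t) s'
  | loop_done {e : Expr} {p : Prog} {s : MState} (he : ¬ 0 < e.eval x s.mem) :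
      Exec x ω (.loop e p) s (e.cost x s.mem + bitLen (e.eval x s.mem)) s
  | loop_step {e : Expr} {p : Prog} {s s' s'' : MState} {t t' : ℕ}
      (he : 0 < e.eval x s.mem) (hp : Exec x ω p s t s')
      (hl : Exec x ω (.loop e p) s' t' s'') :
      Exec x ω (.loop e p) s (e.cost x s.mem + bitLen (e.eval x s.mem) + t + t') s''

/-- For given coin flips, the machine is deterministic: cost and final state are unique. -/
theorem Exec.unique {x : ℕ → ℤ} {ω : ℕ → Bool} {p : Prog} {s s₁ s₂ : MState} {t₁ t₂ : ℕ}
    (h₁ : Exec x ω p s t₁ s₁) (h₂ : Exec x ω p s t₂ s₂) : t₁ = t₂ ∧ s₁ = s₂ := by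
  induction h₁ generalizing t₂ s₂ with
  | skip s => cases h₂; exact ⟨rfl, rfl⟩
  | assign a e s => cases h₂; exact ⟨rfl, rfl⟩
  | flip a s => cases h₂; exact ⟨rfl, rfl⟩
  | seq _ _ ihp ihq =>
    cases h₂ with
    | seq hp hq =>
      obtain ⟨rfl, rfl⟩ := ihp hp
      obtain ⟨rfl, rfl⟩ := ihq hq
      exact ⟨rfl, rfl⟩
  | ite_pos he _ ih =>
    cases h₂ with
    | ite_pos _ hp => obtain ⟨rfl, rfl⟩ := ih hp; exact ⟨rfl, rfl⟩
    | ite_neg he' _ => exact absurd he he'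
  | ite_neg he _ ih =>
    cases h₂ with
    | ite_pos he' _ => exact absurd he' he
    | ite_neg _ hq => obtain ⟨rfl, rfl⟩ := ih hq; exact ⟨rfl, rfl⟩
  | loop_done he =>
    cases h₂ with
    | loop_done _ => exact ⟨rfl, rfl⟩
    | loop_step he' _ _ => exact absurd he' he
  | loop_step he _ _ ihp ihl =>
    cases h₂ with
    | loop_done he' => exact absurd he he'
    | loop_step _ hp hl =>
      obtain ⟨rfl, rfl⟩ := ihp hp
      obtain ⟨rfl, rfl⟩ := ihl hl
      exact ⟨rfl, rfl⟩

/-- `Outputs p w ω t b`: on the input consisting of the words `w` (followed by zeros) and with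
coin flips `ω`, the program `p` halts after time `t`, and register `0` holds its answer `b`
(`1` for yes, `0` for no). -/
def Outputs (p : Prog) (w : List ℕ) (ω : ℕ → Bool) (t : ℕ) (b : Bool) : Prop :=
  ∃ s, Exec (fun i => (w.getD i 0 : ℤ)) ω p MState.init t s ∧ s.mem 0 = if b then 1 else 0

/-- The law of an infinite sequence of independent fair coin flips. -/
noncomputable def coinMeasure : Measure (ℕ → Bool) :=
  Measure.infinitePi fun _ => (PMF.uniformOfFintype Bool).toMeasure

/-! ## Encoding of the instances -/

/-- The words of an instance: the number of vertices, the number of colors, the number of bags,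
the adjacency matrix row by row, and the characteristic vectors of the bags. -/
def encodeInstance {n : ℕ} (G : SimpleGraph (Fin n)) [DecidableRel G.Adj]
    (P : PathDecomposition G) (q : ℕ) : List ℕ :=
  [n, q, P.len]
    ++ (List.ofFn fun k : Fin (n * n) => if G.Adj k.divNat k.modNat then 1 else 0)
    ++ (List.ofFn fun k : Fin (P.len * n) => if k.modNat ∈ P.bag k.divNat then 1 else 0)

/-- The size of an input: the total number of bits of its words, plus one for each word. -/
def inputSize (w : List ℕ) : ℕ := (w.map fun a => a.size + 1).sum

/-! A graph is `q`-colorable if and only if the polynomial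
`∑ x, (∏ uv ∈ E, (x u - x v)) * ∏ w, r w ^ x w` in the variables `r w`, where `x` runs through all
maps from the vertices to `{0, …, q - 1}`, is not zero: different `x` give different monomials, and the
coefficient of a monomial vanishes unless `x` is a proper coloring. By the Schwartz-Zippel lemma over
the integers, random numbers `r w` with sufficiently many bits detect this with high probability
(`coinMeasure_sum_eq_zero_le`), and a nonzero value is always a proof of colorability. No modulus is
needed, since all integers that occur have polynomially many bits. If `q ≥ n`, the answer is yes at
once; so `q` may be assumed to be small.

It remains to evaluate the polynomial. Expand the product over the edges. Then a vertex `w` that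
receives the exponent `k` contributes the moment `∑ c < q, r w ^ c * c ^ k`. The edges are processed
in the order of their first bags. As long as less than half of the edges at `w` are processed, the
dynamic program remembers the exponent that `w` has got so far. Later it remembers instead the
exponent that `w` is going to get from the remaining edges; at the change from one to the other the
moments come in. In both cases there are at most `d / 2 + 1` values, and there is only one value when
none or all of the edges at `w` are processed. Hence only the vertices of the current bag contribute
to the number of states (`numStates_le`). The recurrence is `Schedule.val_succ_of_live`, and the
final value is `Schedule.val_final`. In the proofs, the expanded product is represented by a linear
functional `Schedule.Φ` on functions of the exponents.

The machine program is obtained from a small language of terms with bounded sums and products. All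
quantities of the dynamic program, except for the table of the values of the states, are given by
such terms, which are evaluated afresh whenever they are needed. `Term.compile_spec` says once and
for all that the compiled programs are correct and run in time polynomial in the bound `R` for the
numbers of rounds and in the bit lengths of the words that are read. -/

/-! ### Bit lengths and polynomial bounds -/

theorem bitLen_pos (z : ℤ) : 1 ≤ bitLen z := Nat.le_add_left _ _

theorem bitLen_le_iff {z : ℤ} {k : ℕ} : bitLen z ≤ k + 1 ↔ z.natAbs < 2 ^ k := by
  simp [bitLen, Nat.size_le]

theorem bitLen_mono {a b : ℤ} (h : a.natAbs ≤ b.natAbs) : bitLen a ≤ bitLen b :=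
  Nat.add_le_add_right (Nat.size_le_size h) 1

theorem natAbs_lt_bitLen (z : ℤ) : z.natAbs < 2 ^ (bitLen z - 1) := Nat.lt_size_self _

theorem bitLen_natCast_le (k : ℕ) : bitLen (k : ℤ) ≤ k + 1 := by
  rw [bitLen_le_iff]; simpa using Nat.lt_two_pow_self

theorem bitLen_add_le (a b : ℤ) : bitLen (a + b) ≤ bitLen a + bitLen b := by
  have ha := natAbs_lt_bitLen a
  have hb := natAbs_lt_bitLen b
  have h1 := bitLen_pos a
  have h2 := bitLen_pos b
  obtain ⟨i, hi⟩ := Nat.exists_eq_add_of_le' h1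
  obtain ⟨j, hj⟩ := Nat.exists_eq_add_of_le' h2
  rw [hi, Nat.add_sub_cancel] at ha
  rw [hj, Nat.add_sub_cancel] at hb
  rw [hi, hj, show i + 1 + (j + 1) = (i + j + 1) + 1 by ring, bitLen_le_iff]
  have h3 : 2 ^ i ≤ 2 ^ (i + j) := Nat.pow_le_pow_right (by norm_num) (by omega)
  have h4 : 2 ^ j ≤ 2 ^ (i + j) := Nat.pow_le_pow_right (by norm_num) (by omega)
  have h5 := Int.natAbs_add_le a b
  rw [pow_succ]; omega

theorem bitLen_neg (a : ℤ) : bitLen (-a) = bitLen a := by simp [bitLen]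

theorem bitLen_sub_le (a b : ℤ) : bitLen (a - b) ≤ bitLen a + bitLen b := by
  rw [sub_eq_add_neg, ← bitLen_neg b]; exact bitLen_add_le _ _

theorem bitLen_mul_le (a b : ℤ) : bitLen (a * b) ≤ bitLen a + bitLen b := by
  have ha := natAbs_lt_bitLen a
  have hb := natAbs_lt_bitLen b
  have h1 := bitLen_pos a
  have h2 := bitLen_pos b
  have : bitLen (a * b) ≤ (bitLen a - 1 + (bitLen b - 1)) + 1 := by
    rw [bitLen_le_iff, Int.natAbs_mul, pow_add]
    exact Nat.mul_lt_mul'' ha hb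
  omega

theorem bitLen_div_le (a b : ℤ) : bitLen (a / b) ≤ bitLen a + bitLen b :=
  (bitLen_mono (Int.natAbs_ediv_le_natAbs a b)).trans (Nat.le_add_right _ _)

/-- Every operation of the machine returns a number that is not longer than its operands
together. -/
theorem bitLen_op_le (o : Op) (a b : ℤ) : bitLen (o.eval a b) ≤ bitLen a + bitLen b := by
  cases o
  · exact bitLen_add_le a b
  · exact bitLen_sub_le a b
  · exact bitLen_mul_le a b
  · exact bitLen_div_le a b

theorem add_le_pow {Q a b i j : ℕ} (hQ : 2 ≤ Q) (ha : a ≤ Q ^ i) (hb : b ≤ Q ^ j) :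
    a + b ≤ Q ^ (i + j + 1) := by
  have h1 : Q ^ i ≤ Q ^ (i + j) := Nat.pow_le_pow_right (by omega) (by omega)
  have h2 : Q ^ j ≤ Q ^ (i + j) := Nat.pow_le_pow_right (by omega) (by omega)
  rw [pow_succ]
  nlinarith

theorem mul_le_pow {Q a b i j : ℕ} (ha : a ≤ Q ^ i) (hb : b ≤ Q ^ j) :
    a * b ≤ Q ^ (i + j) := by
  rw [pow_add]; exact Nat.mul_le_mul ha hb

theorem le_pow_comp {Q a i j : ℕ} (h : a ≤ (Q ^ i) ^ j) : a ≤ Q ^ (i * j) := by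
  rwa [pow_mul]

theorem self_le_pow {Q : ℕ} : Q ≤ Q ^ 1 := (pow_one Q).ge

theorem const_le_pow {Q : ℕ} (hQ : 2 ≤ Q) (k : ℕ) : k ≤ Q ^ k :=
  Nat.lt_two_pow_self.le.trans (Nat.pow_le_pow_left hQ k)

theorem pow_le_pow_of_le {Q i j : ℕ} (hQ : 2 ≤ Q) (h : i ≤ j) : Q ^ i ≤ Q ^ j :=
  Nat.pow_le_pow_right (by omega) h

theorem le_self_pow_of_pos {Q i : ℕ} (hQ : 2 ≤ Q) (h : 1 ≤ i) : Q ≤ Q ^ i :=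
  self_le_pow.trans (pow_le_pow_of_le hQ h)

/-! ### Cost of expressions and of loops -/

/-- All words that the evaluation of the expression reads from the input or from the memory have
at most `Q` bits. -/
def Expr.Safe (x m : ℕ → ℤ) (Q : ℕ) : Expr → Prop
  | .const _ => True
  | .inp a => a.Safe x m Q ∧ bitLen (x (a.eval x m).toNat) ≤ Q
  | .reg a => a.Safe x m Q ∧ bitLen (m (a.eval x m).toNat) ≤ Q
  | .op _ a b => a.Safe x m Q ∧ b.Safe x m Q

/-- A fixed expression costs polynomially much in the number of bits of the words it reads. -/
theorem Expr.exists_cost_le (e : Expr) : ∃ c, ∀ (x m : ℕ → ℤ) (Q : ℕ), 2 ≤ Q → e.Safe x m Q →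
    e.cost x m + bitLen (e.eval x m) ≤ Q ^ c := by
  induction e with
  | const z =>
    refine ⟨_, fun x m Q hQ _ => add_le_pow hQ (const_le_pow hQ (bitLen z))
      (const_le_pow hQ (bitLen z))⟩
  | inp a ih =>
    obtain ⟨c, hc⟩ := ih
    refine ⟨(c + 1 + 1) + 1 + 1, fun x m Q hQ h => ?_⟩
    have := hc x m Q hQ h.1
    have h' := h.2.trans (self_le_pow (Q := Q))
    have h'' := add_le_pow hQ (add_le_pow hQ this h') h'
    exact h''
  | reg a ih =>
    obtain ⟨c, hc⟩ := ih
    refine ⟨(c + 1 + 1) + 1 + 1, fun x m Q hQ h => ?_⟩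
    have := hc x m Q hQ h.1
    have h' := h.2.trans (self_le_pow (Q := Q))
    have h'' := add_le_pow hQ (add_le_pow hQ this h') h'
    exact h''
  | op o a b iha ihb =>
    obtain ⟨c, hc⟩ := iha
    obtain ⟨d, hd⟩ := ihb
    refine ⟨c + d + 1 + (c + d + 1) + 1, fun x m Q hQ h => ?_⟩
    have h1 := hc x m Q hQ h.1
    have h2 := hd x m Q hQ h.2
    refine le_trans ?_ (add_le_pow hQ (add_le_pow hQ h1 h2) (add_le_pow hQ h1 h2))
    have := bitLen_op_le o (a.eval x m) (b.eval x m)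
    simp only [Expr.cost, Expr.eval]
    omega

theorem exists_assign_cost_le (a e : Expr) : ∃ c, ∀ (x : ℕ → ℤ) (ω : ℕ → Bool) (s : MState)
    (Q : ℕ), 2 ≤ Q → a.Safe x s.mem Q → e.Safe x s.mem Q →
    ∃ t, Exec x ω (.assign a e) s t
      ⟨Function.update s.mem (a.eval x s.mem).toNat (e.eval x s.mem), s.used⟩ ∧
      t + bitLen (e.eval x s.mem) ≤ Q ^ c := by
  obtain ⟨c, hc⟩ := a.exists_cost_le
  obtain ⟨d, hd⟩ := e.exists_cost_le
  refine ⟨c + d + 1 + (c + d + 1) + 1, fun x ω s Q hQ ha he => ⟨_, .assign a e s, ?_⟩⟩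
  have h1 := hc x s.mem Q hQ ha
  have h2 := hd x s.mem Q hQ he
  refine le_trans ?_ (add_le_pow hQ (add_le_pow hQ h1 h2) (add_le_pow hQ h1 h2))
  omega

/-- A loop that runs `N` times, by means of an invariant indexed by the number of rounds. -/
theorem exec_loop {x : ℕ → ℤ} {ω : ℕ → Bool} {e : Expr} {p : Prog} (I : ℕ → MState → Prop)
    (N b c : ℕ)
    (hcost : ∀ k ≤ N, ∀ s, I k s → e.cost x s.mem + bitLen (e.eval x s.mem) ≤ c)
    (hcond : ∀ k ≤ N, ∀ s, I k s → (0 < e.eval x s.mem ↔ k < N))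
    (hbody : ∀ k < N, ∀ s, I k s → ∃ t s', Exec x ω p s t s' ∧ t ≤ b ∧ I (k + 1) s')
    {s : MState} (hs : I 0 s) :
    ∃ t s', Exec x ω (.loop e p) s t s' ∧ t ≤ N * (b + c) + c ∧ I N s' := by
  have key : ∀ j k, k + j = N → ∀ s, I k s →
      ∃ t s', Exec x ω (.loop e p) s t s' ∧ t ≤ j * (b + c) + c ∧ I N s' := by
    intro j
    induction j with
    | zero =>
      intro k hk s hs
      obtain rfl : k = N := by omega
      refine ⟨_, s, .loop_done (by rw [hcond k le_rfl s hs]; omega), ?_, hs⟩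
      have := hcost k le_rfl s hs
      omega
    | succ j ih =>
      intro k hk s hs
      obtain ⟨t, s', h1, h2, h3⟩ := hbody k (by omega) s hs
      obtain ⟨t', s'', h4, h5, h6⟩ := ih (k + 1) (by omega) s' h3
      refine ⟨_, s'', .loop_step ((hcond k (by omega) s hs).2 (by omega)) h1 h4, ?_, h6⟩
      have := hcost k (by omega) s hs
      rw [Nat.succ_mul]
      omega
  exact key N 0 (by omega) s hs

/-! ### A language of terms -/

/-- Terms over the input, a table of integers and local variables (de Bruijn indices). Besides
the operations of the machine there are local definitions, and the accumulation of an operation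
over the values of a term for `0, 1, …, R - 1`, where `R` is a parameter of the evaluation. -/
inductive Term where
  /-- an integer constant -/
  | const (z : ℤ)
  /-- a local variable -/
  | var (i : ℕ)
  /-- an input word -/
  | inp (a : Term)
  /-- an entry of the table -/
  | tab (a : Term)
  /-- an arithmetical operation -/
  | op (o : Op) (a b : Term)
  /-- the value of `a` if that of `c` is positive, and the value of `b` otherwise -/
  | ite (c a b : Term)
  /-- the value of `b` when variable `0` stands for the value of `a` -/
  | bind (a b : Term)
  /-- the operation `o` accumulated, from `z` on, over the values of `b` for `0, …, R - 1` as
  variable `0` -/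
  | fold (o : Op) (z : ℤ) (b : Term)

/-- Accumulation of an operation, from `z` on, over the first values of `f`. -/
def Op.accum (o : Op) (z : ℤ) (f : ℕ → ℤ) : ℕ → ℤ
  | 0 => z
  | k + 1 => o.eval (o.accum z f k) (f k)

/-- The value of a term for input `x`, table `T`, parameter `R` and local variables `env`. -/
def Term.eval (x : ℕ → ℤ) (T : ℤ → ℤ) (R : ℕ) : Term → List ℤ → ℤ
  | .const z, _ => z
  | .var i, env => env.getD i 0
  | .inp a, env => x (a.eval x T R env).toNat
  | .tab a, env => T (a.eval x T R env)
  | .op o a b, env => o.eval (a.eval x T R env) (b.eval x T R env)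
  | .ite c a b, env => if 0 < c.eval x T R env then a.eval x T R env else b.eval x T R env
  | .bind a b, env => b.eval x T R (a.eval x T R env :: env)
  | .fold o z b, env => o.accum z (fun i => b.eval x T R (i :: env)) R

/-! ### Compilation of terms -/

/-- The content of the scratch register `j`. Scratch registers have even addresses. -/
def scratch (j : ℕ) : Expr := .reg (.const (2 * j : ℕ))

/-- Assignment to the scratch register `j`. -/
def setScratch (j : ℕ) (e : Expr) : Prog := .assign (.const (2 * j : ℕ)) e

/-- The register of an entry of the table. Table entries have odd addresses. -/
def tabAddr (e : Expr) : Expr := .op .add (.op .mul (.const 2) e) (.const 1)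

/-- The table held by a memory. (Entries with negative index are read from register `0`, which is a
scratch register that the compiled terms do not touch.) -/
def tabOf (m : ℕ → ℤ) (z : ℤ) : ℤ := m (2 * z + 1).toNat

/-- The program that evaluates a term into the scratch register `sp`. It uses the scratch
registers from `sp` on; `ρ` lists the scratch registers of the local variables, and the
scratch register `1` holds the parameter `R`. -/
def Term.compile : Term → List ℕ → ℕ → Prog
  | .const z, _, sp => setScratch sp (.const z)
  | .var i, ρ, sp => setScratch sp (match ρ[i]? with
      | some r => scratch r
      | none => .const 0)
  | .inp a, ρ, sp => .seq (a.compile ρ sp) (setScratch sp (.inp (scratch sp)))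
  | .tab a, ρ, sp => .seq (a.compile ρ sp) (setScratch sp (.reg (tabAddr (scratch sp))))
  | .op o a b, ρ, sp => .seq (a.compile ρ sp) (.seq (b.compile ρ (sp + 1))
      (setScratch sp (.op o (scratch sp) (scratch (sp + 1)))))
  | .ite c a b, ρ, sp => .seq (c.compile ρ sp)
      (.ite (scratch sp) (a.compile ρ sp) (b.compile ρ sp))
  | .bind a b, ρ, sp => .seq (a.compile ρ sp) (.seq (b.compile (sp :: ρ) (sp + 1))
      (setScratch sp (scratch (sp + 1))))
  | .fold o z b, ρ, sp => .seq (setScratch sp (.const z)) (.seq (setScratch (sp + 1) (.const 0))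
      (.loop (.op .sub (scratch 1) (scratch (sp + 1)))
        (.seq (b.compile ((sp + 1) :: ρ) (sp + 2))
          (.seq (setScratch sp (.op o (scratch sp) (scratch (sp + 2))))
            (setScratch (sp + 1) (.op .add (scratch (sp + 1)) (.const 1)))))))

/-- The states agree except for the scratch registers from `sp` on. -/
def Frame (sp : ℕ) (s s' : MState) : Prop :=
  s'.used = s.used ∧ ∀ a, (∀ j, sp ≤ j → a ≠ 2 * j) → s'.mem a = s.mem a

theorem Frame.trans {sp : ℕ} {s₁ s₂ s₃ : MState} (h : Frame sp s₁ s₂) (h' : Frame sp s₂ s₃) :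
    Frame sp s₁ s₃ :=
  ⟨h'.1.trans h.1, fun a ha => (h'.2 a ha).trans (h.2 a ha)⟩

theorem Frame.mono {sp sp' : ℕ} {s s' : MState} (h : Frame sp' s s') (hs : sp ≤ sp') :
    Frame sp s s' :=
  ⟨h.1, fun a ha => h.2 a fun j hj => ha j (hs.trans hj)⟩

theorem Frame.scratch_eq {sp j : ℕ} {s s' : MState} (h : Frame sp s s') (hj : j < sp) :
    s'.mem (2 * j) = s.mem (2 * j) :=
  h.2 _ fun i hi => by omega

theorem Frame.tabOf_eq {sp : ℕ} {s s' : MState} (h : Frame sp s s') (hsp : 1 ≤ sp) :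
    tabOf s'.mem = tabOf s.mem :=
  funext fun z => h.2 _ fun j hj => by omega

/-- What is needed to evaluate terms at the cost given by `Q`: the parameter `R` is in its place,
and the words that can be read have at most `Q` bits. -/
structure Ready (x : ℕ → ℤ) (R Q : ℕ) (ρ : List ℕ) (s : MState) : Prop where
  two_le : 2 ≤ Q
  le : R ≤ Q
  param : s.mem 2 = R
  var : ∀ r ∈ ρ, bitLen (s.mem (2 * r)) ≤ Q
  inp : ∀ i, bitLen (x i) ≤ Q
  tab : ∀ z, bitLen (tabOf s.mem z) ≤ Q

theorem Ready.frame {x : ℕ → ℤ} {R Q sp : ℕ} {ρ : List ℕ} {s s' : MState} (h : Ready x R Q ρ s)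
    (hf : Frame sp s s') (hsp : 2 ≤ sp) (hρ : ∀ r ∈ ρ, r < sp) : Ready x R Q ρ s' where
  two_le := h.two_le
  le := h.le
  param := by rw [← h.param]; exact hf.scratch_eq (j := 1) (by omega)
  var r hr := by rw [hf.scratch_eq (hρ r hr)]; exact h.var r hr
  inp := h.inp
  tab := by rw [hf.tabOf_eq (by omega)]; exact h.tab

theorem Ready.mono {x : ℕ → ℤ} {R Q Q' : ℕ} {ρ : List ℕ} {s : MState} (h : Ready x R Q ρ s)
    (hQ : Q ≤ Q') : Ready x R Q' ρ s where
  two_le := h.two_le.trans hQ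
  le := h.le.trans hQ
  param := h.param
  var r hr := (h.var r hr).trans hQ
  inp i := (h.inp i).trans hQ
  tab z := (h.tab z).trans hQ

theorem Ready.cons {x : ℕ → ℤ} {R Q r : ℕ} {ρ : List ℕ} {s : MState} (h : Ready x R Q ρ s)
    (hr : bitLen (s.mem (2 * r)) ≤ Q) : Ready x R Q (r :: ρ) s where
  two_le := h.two_le
  le := h.le
  param := h.param
  var := by simpa using ⟨hr, h.var⟩
  inp := h.inp
  tab := h.tab

@[simp] theorem scratch_eval (x m : ℕ → ℤ) (j : ℕ) : (scratch j).eval x m = m (2 * j) := by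
  simp only [scratch, Expr.eval, Int.toNat_natCast]

theorem scratch_safe {x m : ℕ → ℤ} {j Q : ℕ} : (scratch j).Safe x m Q ↔ bitLen (m (2 * j)) ≤ Q := by
  simp only [scratch, Expr.Safe, Expr.eval, Int.toNat_natCast, true_and]

theorem exists_setScratch_cost_le (j : ℕ) (e : Expr) : ∃ c, ∀ (x : ℕ → ℤ) (ω : ℕ → Bool)
    (s : MState) (Q : ℕ), 2 ≤ Q → e.Safe x s.mem Q →
    ∃ t s', Exec x ω (setScratch j e) s t s' ∧ t + bitLen (s'.mem (2 * j)) ≤ Q ^ c ∧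
      s'.mem (2 * j) = e.eval x s.mem ∧ s'.used = s.used ∧
      ∀ a, a ≠ 2 * j → s'.mem a = s.mem a := by
  obtain ⟨c, hc⟩ := exists_assign_cost_le (.const (2 * j : ℕ)) e
  refine ⟨c, fun x ω s Q hQ he => ?_⟩
  obtain ⟨t, h1, h2⟩ := hc x ω s Q hQ trivial he
  simp only [Expr.eval, Int.toNat_natCast] at h1
  exact ⟨t, _, h1, by simpa using h2, by simp, rfl, fun a ha => by simp [ha]⟩

theorem Frame.of_set {j : ℕ} {s s' : MState} (h : s'.used = s.used)
    (h' : ∀ a, a ≠ 2 * j → s'.mem a = s.mem a) : Frame j s s' :=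
  ⟨h, fun a ha => h' a (ha j le_rfl)⟩

theorem env_eq_of_frame {sp : ℕ} {s s' : MState} {ρ : List ℕ} (hf : Frame sp s s')
    (hρ : ∀ r ∈ ρ, r < sp) :
    (ρ.map fun r => s'.mem (2 * r)) = ρ.map fun r => s.mem (2 * r) :=
  List.map_congr_left fun r hr => hf.scratch_eq (hρ r hr)

/-- The compiled program evaluates the term, in time polynomial in `Q`. Since the numbers of
rounds of the loops are given by `R ≤ Q`, all intermediate values have polynomially many bits. -/
theorem Term.compile_spec (e : Term) : ∀ (ρ : List ℕ) (sp : ℕ), 2 ≤ sp → (∀ r ∈ ρ, r < sp) →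
    ∃ c, ∀ (x : ℕ → ℤ) (ω : ℕ → Bool) (R Q : ℕ) (s : MState), Ready x R Q ρ s →
    ∃ t s', Exec x ω (e.compile ρ sp) s t s' ∧ t + bitLen (s'.mem (2 * sp)) ≤ Q ^ c ∧
      s'.mem (2 * sp) = e.eval x (tabOf s.mem) R (ρ.map fun r => s.mem (2 * r)) ∧
      Frame sp s s' := by
  induction e with
  | const z =>
    intro ρ sp hsp hρ
    obtain ⟨c, hc⟩ := exists_setScratch_cost_le sp (.const z)
    refine ⟨c, fun x ω R Q s hs => ?_⟩
    obtain ⟨t, s', h1, h2, h3, h4, h5⟩ := hc x ω s Q hs.two_le trivial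
    exact ⟨t, s', h1, h2, h3, .of_set h4 h5⟩
  | var i =>
    intro ρ sp hsp hρ
    obtain ⟨c, hc⟩ := exists_setScratch_cost_le sp (match ρ[i]? with
      | some r => scratch r
      | none => .const 0)
    refine ⟨c, fun x ω R Q s hs => ?_⟩
    obtain ⟨t, s', h1, h2, h3, h4, h5⟩ := hc x ω s Q hs.two_le (by
      cases h : ρ[i]? with
      | none => trivial
      | some r => exact scratch_safe.2 (hs.var r (List.mem_of_getElem? h)))
    refine ⟨t, s', h1, h2, h3.trans ?_, .of_set h4 h5⟩
    simp only [Term.eval, List.getD, List.getElem?_map]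
    cases h : ρ[i]? with
    | none => simp [Expr.eval]
    | some r => simp
  | inp a ih =>
    intro ρ sp hsp hρ
    obtain ⟨c, hc⟩ := ih ρ sp hsp hρ
    obtain ⟨d, hd⟩ := exists_setScratch_cost_le sp (.inp (scratch sp))
    refine ⟨c + (c + 1) * d + 1, fun x ω R Q s hs => ?_⟩
    obtain ⟨t, s', h1, h2, h3, h4⟩ := hc x ω R Q s hs
    have hQ := hs.two_le
    have hQ1 : Q ^ c ≤ Q ^ (c + 1) := pow_le_pow_of_le hQ (by omega)
    have hQ2 : Q ≤ Q ^ (c + 1) := le_self_pow_of_pos hQ (by omega)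
    obtain ⟨t', s'', h1', h2', h3', h4', h5'⟩ := hd x ω s' (Q ^ (c + 1)) (hQ.trans hQ2)
      ⟨scratch_safe.2 (by omega), (hs.inp _).trans hQ2⟩
    refine ⟨t + t', s'', .seq h1 h1', ?_, ?_, h4.trans (.of_set h4' h5')⟩
    · have := add_le_pow hQ (le_trans (by omega : t ≤ Q ^ c) le_rfl) (le_pow_comp h2')
      omega
    · rw [h3']; simp only [Expr.eval, Term.eval, scratch_eval, h3]
  | tab a ih =>
    intro ρ sp hsp hρ
    obtain ⟨c, hc⟩ := ih ρ sp hsp hρ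
    obtain ⟨d, hd⟩ := exists_setScratch_cost_le sp (.reg (tabAddr (scratch sp)))
    refine ⟨c + (c + 1) * d + 1, fun x ω R Q s hs => ?_⟩
    obtain ⟨t, s', h1, h2, h3, h4⟩ := hc x ω R Q s hs
    have hQ := hs.two_le
    have hQ1 : Q ^ c ≤ Q ^ (c + 1) := pow_le_pow_of_le hQ (by omega)
    have hQ2 : Q ≤ Q ^ (c + 1) := le_self_pow_of_pos hQ (by omega)
    have hT : tabOf s'.mem = tabOf s.mem := h4.tabOf_eq (by omega)
    have hv : (Expr.reg (tabAddr (scratch sp))).eval x s'.mem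
        = tabOf s.mem (s'.mem (2 * sp)) := by
      rw [← hT]; simp [Expr.eval, tabAddr, Op.eval, tabOf]
    obtain ⟨t', s'', h1', h2', h3', h4', h5'⟩ := hd x ω s' (Q ^ (c + 1)) (hQ.trans hQ2)
      ⟨⟨⟨trivial, scratch_safe.2 (by omega)⟩, trivial⟩, by
        have := hs.tab (s'.mem (2 * sp))
        rw [← hv] at this
        exact this.trans hQ2⟩
    refine ⟨t + t', s'', .seq h1 h1', ?_, ?_, h4.trans (.of_set h4' h5')⟩
    · have := add_le_pow hQ (le_trans (by omega : t ≤ Q ^ c) le_rfl) (le_pow_comp h2')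
      omega
    · rw [h3', hv, h3]; rfl
  | op o a b iha ihb =>
    intro ρ sp hsp hρ
    obtain ⟨c, hc⟩ := iha ρ sp hsp hρ
    obtain ⟨d, hd⟩ := ihb ρ (sp + 1) (by omega) fun r hr => (hρ r hr).trans (by omega)
    obtain ⟨f, hf⟩ := exists_setScratch_cost_le sp (.op o (scratch sp) (scratch (sp + 1)))
    refine ⟨c + d + 1 + (c + d + 1) * f + 1, fun x ω R Q s hs => ?_⟩
    have hQ := hs.two_le
    obtain ⟨t, s', h1, h2, h3, h4⟩ := hc x ω R Q s hs
    obtain ⟨t', s'', h1', h2', h3', h4'⟩ := hd x ω R Q s' (hs.frame h4 hsp hρ)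
    have hk : s''.mem (2 * sp) = s'.mem (2 * sp) := h4'.scratch_eq (by omega)
    have hle := add_le_pow hQ h2 h2'
    obtain ⟨t₃, s₃, g1, g2, g3, g4, g5⟩ := hf x ω s'' (Q ^ (c + d + 1))
      (hQ.trans (le_self_pow_of_pos hQ (by omega)))
      ⟨scratch_safe.2 (by rw [hk]; omega), scratch_safe.2 (by omega)⟩
    refine ⟨t + (t' + t₃), s₃, .seq h1 (.seq h1' g1), ?_, ?_,
      (h4.trans (h4'.mono (by omega))).trans (.of_set g4 g5)⟩
    · have := add_le_pow hQ (le_trans (by omega : t + t' ≤ Q ^ (c + d + 1)) le_rfl)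
        (le_pow_comp g2)
      omega
    · rw [g3]
      simp only [Expr.eval, Term.eval, scratch_eval, hk, h3, h3', h4.tabOf_eq (by omega : 1 ≤ sp),
        env_eq_of_frame h4 hρ]
  | ite e a b ihe iha ihb =>
    intro ρ sp hsp hρ
    obtain ⟨c, hc⟩ := ihe ρ sp hsp hρ
    obtain ⟨d, hd⟩ := iha ρ sp hsp hρ
    obtain ⟨f, hf⟩ := ihb ρ sp hsp hρ
    obtain ⟨g, hg⟩ := (scratch sp).exists_cost_le
    refine ⟨c + (c + 1) * g + 1 + (d + f + 1) + 1, fun x ω R Q s hs => ?_⟩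
    have hQ := hs.two_le
    obtain ⟨t, s', h1, h2, h3, h4⟩ := hc x ω R Q s hs
    have hQ1 : Q ^ c ≤ Q ^ (c + 1) := pow_le_pow_of_le hQ (by omega)
    have hcost := hg x s'.mem (Q ^ (c + 1)) (hQ.trans (le_self_pow_of_pos hQ (by omega)))
      (scratch_safe.2 (by omega))
    have hle := add_le_pow hQ (le_trans (by omega : t ≤ Q ^ c) le_rfl) (le_pow_comp hcost)
    obtain ⟨t', s'', h1', h2', h3', h4'⟩ := hd x ω R Q s' (hs.frame h4 hsp hρ)
    obtain ⟨t₃, s₃, g1, g2, g3, g4⟩ := hf x ω R Q s' (hs.frame h4 hsp hρ)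
    have hT := h4.tabOf_eq (by omega : 1 ≤ sp)
    have hE := env_eq_of_frame h4 hρ
    by_cases hpos : 0 < s'.mem (2 * sp)
    · refine ⟨_, s'', .seq h1 (.ite_pos (by simpa using hpos) h1'), ?_, ?_, h4.trans h4'⟩
      · have := add_le_pow hQ hle (h2'.trans (pow_le_pow_of_le hQ (by omega : d ≤ d + f + 1)))
        omega
      · rw [h3', hT, hE, Term.eval, if_pos (h3 ▸ hpos)]
    · refine ⟨_, s₃, .seq h1 (.ite_neg (by simpa using hpos) g1), ?_, ?_, h4.trans g4⟩
      · have := add_le_pow hQ hle (g2.trans (pow_le_pow_of_le hQ (by omega : f ≤ d + f + 1)))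
        omega
      · rw [g3, hT, hE, Term.eval, if_neg (h3 ▸ hpos)]
  | bind a b iha ihb =>
    intro ρ sp hsp hρ
    obtain ⟨c, hc⟩ := iha ρ sp hsp hρ
    obtain ⟨d, hd⟩ := ihb (sp :: ρ) (sp + 1) (by omega) (by
      simp only [List.mem_cons, forall_eq_or_imp]
      exact ⟨by omega, fun r hr => (hρ r hr).trans (by omega)⟩)
    obtain ⟨f, hf⟩ := exists_setScratch_cost_le sp (scratch (sp + 1))
    refine ⟨c + (c + 1) * d + 1 + ((c + 1) * (d + 1)) * f + 1, fun x ω R Q s hs => ?_⟩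
    have hQ := hs.two_le
    obtain ⟨t, s', h1, h2, h3, h4⟩ := hc x ω R Q s hs
    have hQ1 : Q ^ c ≤ Q ^ (c + 1) := pow_le_pow_of_le hQ (by omega)
    have hQ2 : Q ≤ Q ^ (c + 1) := le_self_pow_of_pos hQ (by omega)
    obtain ⟨t', s'', h1', h2', h3', h4'⟩ := hd x ω R (Q ^ (c + 1)) s'
      (((hs.frame h4 hsp hρ).mono hQ2).cons (by omega))
    have hQ3 : (Q ^ (c + 1)) ^ d ≤ Q ^ ((c + 1) * (d + 1)) := by
      rw [← pow_mul]; exact pow_le_pow_of_le hQ (Nat.mul_le_mul_left _ (by omega))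
    obtain ⟨t₃, s₃, g1, g2, g3, g4, g5⟩ := hf x ω s'' (Q ^ ((c + 1) * (d + 1)))
      (hQ.trans (le_self_pow_of_pos hQ (Nat.mul_pos (by omega) (by omega))))
      (scratch_safe.2 (by omega))
    refine ⟨t + (t' + t₃), s₃, .seq h1 (.seq h1' g1), ?_, ?_,
      (h4.trans (h4'.mono (by omega))).trans (.of_set g4 g5)⟩
    · have := add_le_pow hQ (add_le_pow hQ (le_trans (by omega : t ≤ Q ^ c) le_rfl)
        (le_pow_comp (le_trans (by omega : t' ≤ (Q ^ (c + 1)) ^ d) le_rfl))) (le_pow_comp g2)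
      omega
    · rw [g3, scratch_eval, h3', h4.tabOf_eq (by omega : 1 ≤ sp), List.map_cons,
        env_eq_of_frame h4 hρ, h3]
      rfl
  | fold o z b ih =>
    intro ρ sp hsp hρ
    have hρ2 : ∀ r ∈ (sp + 1) :: ρ, r < sp + 2 := by
      simp only [List.mem_cons, forall_eq_or_imp]
      exact ⟨by omega, fun r hr => (hρ r hr).trans (by omega)⟩
    obtain ⟨c, hc⟩ := ih ((sp + 1) :: ρ) (sp + 2) (by omega) hρ2
    obtain ⟨c₀, h₀⟩ := exists_setScratch_cost_le sp (.const z)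
    obtain ⟨c₁, h₁⟩ := exists_setScratch_cost_le (sp + 1) (.const 0)
    obtain ⟨c₂, h₂⟩ := exists_setScratch_cost_le sp (.op o (scratch sp) (scratch (sp + 2)))
    obtain ⟨c₃, h₃⟩ := exists_setScratch_cost_le (sp + 1)
      (.op .add (scratch (sp + 1)) (.const 1))
    obtain ⟨c₄, h₄⟩ := (Expr.op .sub (scratch 1) (scratch (sp + 1))).exists_cost_le
    -- all values in the loop have at most `Q ^ g` bits
    obtain ⟨g, hg⟩ : ∃ g, g = bitLen z + (1 + c) + 1 := ⟨_, rfl⟩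
    refine ⟨c₀ + c₁ + 1 + (1 + (c + g * c₂ + 1 + g * c₃ + 1 + g * c₄ + 1) + g * c₄ + 1) + 1
      + g + 1, fun x ω R Q s hs => ?_⟩
    have hQ := hs.two_le
    have hgQ : Q ≤ Q ^ g := le_self_pow_of_pos hQ (by omega)
    have hg2 := hQ.trans hgQ
    set env := ρ.map fun r => s.mem (2 * r) with henv
    set T := tabOf s.mem with hT
    set A := o.accum z (fun i => b.eval x T R (i :: env)) with hA
    have hAg : ∀ k ≤ R, bitLen z + k * Q ^ c ≤ Q ^ g := fun k hk => by
      rw [hg]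
      exact add_le_pow hQ (const_le_pow hQ _) (mul_le_pow ((hk.trans hs.le).trans self_le_pow)
        le_rfl)
    obtain ⟨t₀, s₀, a1, a2, a3, a4, a5⟩ := h₀ x ω s Q hQ trivial
    obtain ⟨t₁, s₁, b1, b2, b3, b4, b5⟩ := h₁ x ω s₀ Q hQ trivial
    have hcnt : ∀ k ≤ R, bitLen (k : ℤ) ≤ Q ^ g := fun k hk => by
      have h1 := bitLen_natCast_le k
      have h2 := hAg k hk
      have h3 : k * 1 ≤ k * Q ^ c := Nat.mul_le_mul_left _ (Nat.one_le_pow _ _ (by omega))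
      have h4 := bitLen_pos z
      omega
    let I : ℕ → MState → Prop := fun k s' => Frame sp s s' ∧ s'.mem (2 * (sp + 1)) = k ∧
      s'.mem (2 * sp) = A k ∧ bitLen (A k) ≤ bitLen z + k * Q ^ c
    obtain ⟨t, s', d1, d2, d3⟩ := exec_loop (x := x) (ω := ω)
      (e := .op .sub (scratch 1) (scratch (sp + 1)))
      (p := .seq (b.compile ((sp + 1) :: ρ) (sp + 2))
          (.seq (setScratch sp (.op o (scratch sp) (scratch (sp + 2))))
            (setScratch (sp + 1) (.op .add (scratch (sp + 1)) (.const 1)))))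
      I R (Q ^ (c + g * c₂ + 1 + g * c₃ + 1)) (Q ^ (g * c₄))
      (fun k hk s' ⟨i1, i2, i3, i4⟩ => le_pow_comp <| h₄ x s'.mem (Q ^ g) hg2
        ⟨scratch_safe.2 (by
          rw [i1.scratch_eq (by omega), show 2 * 1 = 2 from rfl, hs.param]
          exact hcnt R le_rfl), scratch_safe.2 (by rw [i2]; exact hcnt k hk)⟩)
      (fun k hk s' ⟨i1, i2, i3, i4⟩ => by
        simp only [Expr.eval, Op.eval, scratch_eval, i2, i1.scratch_eq (by omega : 1 < sp),
          show 2 * 1 = 2 from rfl, hs.param]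
        omega)
      (fun k hk s' ⟨i1, i2, i3, i4⟩ => by
        have hr : Ready x R Q ((sp + 1) :: ρ) s' := (hs.frame i1 hsp hρ).cons (by
          rw [i2]
          have := bitLen_natCast_le k
          have := hs.le
          omega)
        obtain ⟨u, v, e1, e2, e3, e4⟩ := hc x ω R Q s' hr
        have hv1 : v.mem (2 * sp) = A k := by rw [e4.scratch_eq (by omega), i3]
        have hv2 : v.mem (2 * (sp + 1)) = k := by rw [e4.scratch_eq (by omega), i2]
        have hv3 : v.mem (2 * (sp + 2)) = b.eval x T R (k :: env) := by
          rw [e3, i1.tabOf_eq (by omega), List.map_cons, i2, env_eq_of_frame i1 hρ]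
        have hcg : Q ^ c ≤ Q ^ g := pow_le_pow_of_le hQ (by omega)
        have hk1 := hAg k hk.le
        obtain ⟨u', v', f1, f2, f3, f4, f5⟩ := h₂ x ω v (Q ^ g) hg2
          ⟨scratch_safe.2 (by rw [hv1]; omega), scratch_safe.2 (by omega)⟩
        have hw2 : v'.mem (2 * (sp + 1)) = k := by rw [f5 _ (by omega), hv2]
        obtain ⟨u'', v'', k1, k2, k3, k4, k5⟩ := h₃ x ω v' (Q ^ g) hg2
          ⟨scratch_safe.2 (by rw [hw2]; exact hcnt k hk.le), trivial⟩
        refine ⟨_, v'', .seq e1 (.seq f1 k1), ?_, ?_, ?_, ?_, ?_⟩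
        · have := add_le_pow hQ (add_le_pow hQ (le_trans (by omega : u ≤ Q ^ c) le_rfl)
            (le_pow_comp (le_trans (by omega : u' ≤ (Q ^ g) ^ c₂) le_rfl)))
            (le_pow_comp (le_trans (by omega : u'' ≤ (Q ^ g) ^ c₃) le_rfl))
          omega
        · exact ((i1.trans (e4.mono (by omega))).trans (.of_set f4 f5)).trans
            ((Frame.of_set k4 k5).mono (by omega))
        · rw [k3]; simp [Expr.eval, Op.eval, hw2]
        · rw [k5 _ (by omega), f3]
          simp only [Expr.eval, scratch_eval, hv1, hv3]
          rfl
        · have h5 : bitLen (A (k + 1)) ≤ bitLen (A k) + bitLen (b.eval x T R (k :: env)) :=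
            bitLen_op_le _ _ _
          rw [← hv3] at h5
          rw [Nat.succ_mul]
          omega)
      (s := s₁) ⟨(Frame.of_set a4 a5).trans ((Frame.of_set b4 b5).mono (by omega)),
        by rw [b3]; simp [Expr.eval], by rw [b5 _ (by omega), a3]; rfl, by
          show bitLen z ≤ _
          omega⟩
    obtain ⟨i1, i2, i3, i4⟩ := d3
    refine ⟨_, s', .seq a1 (.seq b1 d1), ?_, i3, i1⟩
    have hb : bitLen (s'.mem (2 * sp)) ≤ Q ^ g := by
      rw [i3]; exact i4.trans (hAg R le_rfl)
    have h1 := add_le_pow hQ (mul_le_pow (hs.le.trans self_le_pow)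
      (add_le_pow hQ (le_refl (Q ^ (c + g * c₂ + 1 + g * c₃ + 1))) (le_refl (Q ^ (g * c₄)))))
      (le_refl (Q ^ (g * c₄)))
    have h2 := add_le_pow hQ (add_le_pow hQ (add_le_pow hQ
      (le_trans (by omega : t₀ ≤ Q ^ c₀) le_rfl) (le_trans (by omega : t₁ ≤ Q ^ c₁) le_rfl))
      (d2.trans h1)) hb
    omega

/-! ### Mixed radix representations -/

/-- The place value of digit `w` for the radices `B`. -/
def placeValue (B : ℕ → ℕ) (w : ℕ) : ℕ := ∏ i ∈ Finset.range w, B i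

/-- Digit `w` of `s` for the radices `B`. -/
def mixedDigit (B : ℕ → ℕ) (w s : ℕ) : ℕ := s / placeValue B w % B w

/-- The number with the digits `κ w`, `w < n`, for the radices `B`. -/
def ofMixedDigits (B κ : ℕ → ℕ) (n : ℕ) : ℕ := ∑ w ∈ Finset.range n, κ w * placeValue B w

theorem ofMixedDigits_lt {B κ : ℕ → ℕ} {n : ℕ} (h : ∀ w < n, κ w < B w) :
    ofMixedDigits B κ n < placeValue B n := by
  induction n with
  | zero => simp [ofMixedDigits, placeValue]
  | succ n ih =>
    have h1 := ih fun w hw => h w (by omega)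
    have h2 := h n (by omega)
    simp only [ofMixedDigits, placeValue, Finset.sum_range_succ, Finset.prod_range_succ] at h1 ⊢
    calc _ < (1 + κ n) * ∏ i ∈ Finset.range n, B i := by rw [add_mul, one_mul]; omega
      _ ≤ B n * ∏ i ∈ Finset.range n, B i := Nat.mul_le_mul_right _ (by omega)
      _ = _ := Nat.mul_comm _ _

theorem mixedDigit_ofMixedDigits {B κ : ℕ → ℕ} {n w : ℕ} (h : ∀ w < n, κ w < B w) (hw : w < n) :
    mixedDigit B w (ofMixedDigits B κ n) = κ w := by
  induction n with
  | zero => omega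
  | succ n ih =>
    have hlt := ofMixedDigits_lt fun w hw => h w (Nat.lt_succ_of_lt hw)
    have hsucc : ofMixedDigits B κ (n + 1) = ofMixedDigits B κ n + κ n * placeValue B n :=
      Finset.sum_range_succ _ _
    rcases Nat.lt_succ_iff_lt_or_eq.1 hw with hw' | rfl
    · rw [← ih (fun w hw => h w (by omega)) hw', hsucc]
      obtain ⟨c, hc⟩ : B w * placeValue B w ∣ placeValue B n := by
        have : B w * placeValue B w = placeValue B (w + 1) := by
          simp [placeValue, Finset.prod_range_succ, mul_comm]
        rw [this]
        exact Finset.prod_dvd_prod_of_subset _ _ _ (Finset.range_mono hw')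
      have hpos : 0 < placeValue B w :=
        Finset.prod_pos fun i hi => lt_of_le_of_lt (Nat.zero_le _)
          (h i (by rw [Finset.mem_range] at hi; omega))
      unfold mixedDigit
      rw [hc, show κ n * (B w * placeValue B w * c) = κ n * c * B w * placeValue B w by ring,
        Nat.add_mul_div_right _ _ hpos, Nat.add_mul_mod_self_right]
    · have hpos : 0 < placeValue B w := by omega
      rw [hsucc, mixedDigit, Nat.add_mul_div_right _ _ hpos, Nat.div_eq_of_lt hlt, zero_add,
        Nat.mod_eq_of_lt (h w hw)]

/-! ### The graph polynomial, one edge at a time -/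

/-- A schedule of edges on the vertices `0, …, n - 1`: at each of the times `τ < H` either nothing
happens, or the edge between `a τ` and `b τ` is processed. -/
structure Schedule where
  /-- number of vertices -/
  n : ℕ
  /-- number of time steps -/
  H : ℕ
  /-- whether an edge is processed -/
  live : ℕ → Bool
  /-- first end of the edge -/
  a : ℕ → ℕ
  /-- second end of the edge -/
  b : ℕ → ℕ
  a_lt : ∀ τ, live τ → a τ < n
  b_lt : ∀ τ, live τ → b τ < n
  ne : ∀ τ, live τ → a τ ≠ b τ

namespace Schedule

variable (S : Schedule)

/-- The number of edges at the vertex `w` that are processed before time `τ`. -/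
def cnt (w τ : ℕ) : ℕ := ∑ i ∈ Finset.range τ,
  if S.live i then (if S.a i = w then 1 else 0) + (if S.b i = w then 1 else 0) else 0

/-- The number of edges at the vertex `w`. -/
def deg (w : ℕ) : ℕ := S.cnt w S.H

/-- The largest value of the component of a state that belongs to the vertex `w` at time `τ`. -/
def cap (τ w : ℕ) : ℕ := if 2 * S.cnt w τ < S.deg w then S.cnt w τ else S.deg w - S.cnt w τ

/-- Let `F τ` be the product of the factors `X (a i) - X (b i)` for the edges processed at the times
`i < τ`. The functional `Φ τ h` is the sum of the coefficients of `F τ`, each weighted with the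
value of `h` at the exponents of the monomial. -/
def Φ : ℕ → ((ℕ → ℕ) → ℤ) → ℤ
  | 0, h => h 0
  | τ + 1, h =>
    if S.live τ then
      Φ τ (fun α => h (Function.update α (S.a τ) (α (S.a τ) + 1))) -
        Φ τ (fun α => h (Function.update α (S.b τ) (α (S.b τ) + 1)))
    else Φ τ h

variable {S}

theorem cnt_succ (w τ : ℕ) : S.cnt w (τ + 1) = S.cnt w τ +
    if S.live τ then (if S.a τ = w then 1 else 0) + (if S.b τ = w then 1 else 0) else 0 :=
  Finset.sum_range_succ _ _

theorem cnt_mono (w : ℕ) {τ τ' : ℕ} (h : τ ≤ τ') : S.cnt w τ ≤ S.cnt w τ' :=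
  Finset.sum_le_sum_of_subset (Finset.range_mono h)

theorem cnt_succ_of_not_live {τ : ℕ} (h : ¬ S.live τ) (w : ℕ) : S.cnt w (τ + 1) = S.cnt w τ := by
  rw [cnt_succ, if_neg h, add_zero]

theorem cnt_succ_a {τ : ℕ} (h : S.live τ) : S.cnt (S.a τ) (τ + 1) = S.cnt (S.a τ) τ + 1 := by
  rw [cnt_succ, if_pos h, if_pos rfl, if_neg (S.ne τ h).symm]

theorem cnt_succ_b {τ : ℕ} (h : S.live τ) : S.cnt (S.b τ) (τ + 1) = S.cnt (S.b τ) τ + 1 := by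
  rw [cnt_succ, if_pos h, if_pos rfl, if_neg (S.ne τ h)]

theorem cnt_succ_of_ne {τ w : ℕ} (ha : w ≠ S.a τ) (hb : w ≠ S.b τ) :
    S.cnt w (τ + 1) = S.cnt w τ := by
  rw [cnt_succ, if_neg ha.symm, if_neg hb.symm]; simp

theorem cap_le_half (τ w : ℕ) : S.cap τ w ≤ S.deg w / 2 := by
  unfold cap; split <;> omega

theorem cap_add_cnt_le {τ w : ℕ} (h : τ ≤ S.H) : S.cnt w τ + S.cap τ w ≤ S.deg w := by
  have : S.cnt w τ ≤ S.deg w := cnt_mono w h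
  unfold cap; split <;> omega

/-- Only exponents up to the number of processed edges matter. -/
theorem Φ_congr {τ : ℕ} {h h' : (ℕ → ℕ) → ℤ}
    (hh : ∀ α : ℕ → ℕ, (∀ w, α w ≤ S.cnt w τ) → h α = h' α) : S.Φ τ h = S.Φ τ h' := by
  induction τ generalizing h h' with
  | zero => exact hh 0 fun w => Nat.zero_le _
  | succ τ ih =>
    have key : ∀ u, S.live τ → (u = S.a τ ∨ u = S.b τ) →
        S.Φ τ (fun α => h (Function.update α u (α u + 1)))
          = S.Φ τ (fun α => h' (Function.update α u (α u + 1))) := by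
      refine fun u hl hu => ih fun α hα => hh _ fun w => ?_
      by_cases hw : w = u
      · subst hw
        have : S.cnt w (τ + 1) = S.cnt w τ + 1 := by
          rcases hu with rfl | rfl
          · exact cnt_succ_a hl
          · exact cnt_succ_b hl
        simpa [this] using hα w
      · simpa [hw] using (hα w).trans (cnt_mono w (Nat.le_succ τ))
    by_cases hl : S.live τ
    · simp only [Φ, if_pos hl]
      rw [key _ hl (.inl rfl), key _ hl (.inr rfl)]
    · simp only [Φ, if_neg hl]
      exact ih fun α hα => hh α fun w => (hα w).trans (cnt_mono w (Nat.le_succ τ))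

theorem Φ_sum {ι : Type*} (s : Finset ι) (τ : ℕ) (h : ι → (ℕ → ℕ) → ℤ) :
    S.Φ τ (fun α => ∑ j ∈ s, h j α) = ∑ j ∈ s, S.Φ τ (h j) := by
  induction τ generalizing h with
  | zero => rfl
  | succ τ ih =>
    by_cases hl : S.live τ
    · simp only [Φ, if_pos hl, Finset.sum_sub_distrib, ih]
    · simp only [Φ, if_neg hl, ih]

theorem Φ_mul_left (τ : ℕ) (z : ℤ) (h : (ℕ → ℕ) → ℤ) :
    S.Φ τ (fun α => z * h α) = z * S.Φ τ h := by
  induction τ generalizing h with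
  | zero => rfl
  | succ τ ih =>
    by_cases hl : S.live τ
    · simp only [Φ, if_pos hl, mul_sub]
      rw [ih, ih]
    · simp only [Φ, if_neg hl, ih]

theorem prod_update_succ {n u : ℕ} (hu : u < n) (f : ℕ → ℕ → ℤ) (α : ℕ → ℕ) (x : ℤ)
    (hf : f u (α u + 1) = x * f u (α u)) :
    ∏ w ∈ Finset.range n, f w (Function.update α u (α u + 1) w)
      = x * ∏ w ∈ Finset.range n, f w (α w) := by
  rw [← Finset.mul_prod_erase _ _ (Finset.mem_range.2 hu),
    ← Finset.mul_prod_erase _ (fun w => f w (α w)) (Finset.mem_range.2 hu), Function.update_self,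
    hf, mul_assoc]
  congr 2
  exact Finset.prod_congr rfl fun w hw => by
    rw [Function.update_of_ne (Finset.ne_of_mem_erase hw)]

/-- On evaluation functionals, `Φ` is the evaluation of the graph polynomial. -/
theorem Φ_prod_pow (τ : ℕ) (x : ℕ → ℤ) :
    S.Φ τ (fun α => ∏ w ∈ Finset.range S.n, x w ^ α w)
      = ∏ i ∈ Finset.range τ, if S.live i then x (S.a i) - x (S.b i) else 1 := by
  induction τ with
  | zero => simp [Φ]
  | succ τ ih =>
    rw [Finset.prod_range_succ, ← ih]
    by_cases hl : S.live τ
    · simp only [Φ, if_pos hl]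
      have key : ∀ u < S.n, S.Φ τ (fun α => ∏ w ∈ Finset.range S.n,
          x w ^ (Function.update α u (α u + 1) w))
          = x u * S.Φ τ (fun α => ∏ w ∈ Finset.range S.n, x w ^ α w) := by
        intro u hu
        rw [← Φ_mul_left]
        refine Φ_congr fun α _ => ?_
        exact prod_update_succ hu (fun w k => x w ^ k) α (x u) (pow_succ' _ _)
      rw [key _ (S.a_lt τ hl), key _ (S.b_lt τ hl)]
      ring
    · simp only [Φ, if_neg hl, mul_one]

theorem abs_Φ_le {τ : ℕ} {h : (ℕ → ℕ) → ℤ} {B : ℤ}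
    (hh : ∀ α : ℕ → ℕ, (∀ w, α w ≤ S.cnt w τ) → |h α| ≤ B) : |S.Φ τ h| ≤ 2 ^ τ * B := by
  induction τ generalizing h with
  | zero => simpa [Φ] using hh 0 fun w => Nat.zero_le _
  | succ τ ih =>
    have hB : 0 ≤ B := (abs_nonneg _).trans (hh 0 fun w => Nat.zero_le _)
    have key : ∀ u, S.live τ → (u = S.a τ ∨ u = S.b τ) →
        |S.Φ τ (fun α => h (Function.update α u (α u + 1)))| ≤ 2 ^ τ * B := by
      refine fun u hl hu => ih fun α hα => hh _ fun w => ?_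
      by_cases hw : w = u
      · subst hw
        have : S.cnt w (τ + 1) = S.cnt w τ + 1 := by
          rcases hu with rfl | rfl
          · exact cnt_succ_a hl
          · exact cnt_succ_b hl
        simpa [this] using hα w
      · simpa [hw] using (hα w).trans (cnt_mono w (Nat.le_succ τ))
    by_cases hl : S.live τ
    · simp only [Φ, if_pos hl]
      have h1 := key _ hl (.inl rfl)
      have h2 := key _ hl (.inr rfl)
      have h3 := abs_sub (S.Φ τ (fun α => h (Function.update α (S.a τ) (α (S.a τ) + 1))))
        (S.Φ τ (fun α => h (Function.update α (S.b τ) (α (S.b τ) + 1))))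
      rw [pow_succ]
      linarith
    · simp only [Φ, if_neg hl]
      have := ih (h := h) fun α hα => hh α fun w => (hα w).trans (cnt_mono w (Nat.le_succ τ))
      have h2 : (0 : ℤ) ≤ 2 ^ τ * B := by positivity
      rw [pow_succ]
      linarith

/-! ### The states of the dynamic program -/

variable (S)

/-- The factor of the vertex `w` in the weight of a monomial in which `w` has exponent `k`, for a
state with component `y` at `w`. As long as less than half of the edges at `w` are processed, `y`
is the exponent. Later `y` is the exponent that `w` receives from the edges to come, and the
weight is the moment `μ w (k + y)`. -/
def weight (μ : ℕ → ℕ → ℤ) (τ w k y : ℕ) : ℤ :=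
  if 2 * S.cnt w τ < S.deg w then (if k = y then 1 else 0) else μ w (k + y)

/-- The value of the state `κ` at time `τ`. -/
def val (μ : ℕ → ℕ → ℤ) (τ : ℕ) (κ : ℕ → ℕ) : ℤ :=
  S.Φ τ fun α => ∏ w ∈ Finset.range S.n, S.weight μ τ w (α w) (κ w)

/-- The coefficient of the transition at the vertex `w` from the component `x` at time `τ` to the
component `y` at time `τ + 1`, when an edge at `w` is processed and adds `δ` to the exponent. -/
def trans (μ : ℕ → ℕ → ℤ) (τ w x δ y : ℕ) : ℤ :=
  if 2 * (S.cnt w τ + 1) < S.deg w then (if x + δ = y then 1 else 0)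
  else if 2 * S.cnt w τ < S.deg w then μ w (x + δ + y)
  else if x = y + δ then 1 else 0

variable {S}

theorem sum_weight_mul_trans (μ : ℕ → ℕ → ℤ) {τ w k δ y : ℕ}
    (hc : S.cnt w (τ + 1) = S.cnt w τ + 1) (hd : S.cnt w (τ + 1) ≤ S.deg w) (hk : k ≤ S.cnt w τ)
    (hδ : δ ≤ 1) (hy : y ≤ S.cap (τ + 1) w) :
    S.weight μ (τ + 1) w (k + δ) y
      = ∑ x ∈ Finset.range (S.cap τ w + 1), S.trans μ τ w x δ y * S.weight μ τ w k x := by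
  unfold weight trans
  unfold cap at hy ⊢
  rw [hc] at hy hd ⊢
  by_cases h1 : 2 * (S.cnt w τ + 1) < S.deg w
  · have h2 : 2 * S.cnt w τ < S.deg w := by omega
    simp only [if_pos h1, if_pos h2]
    rw [Finset.sum_eq_single k (fun x _ hx => by rw [if_neg hx.symm, mul_zero])
      (fun h => absurd (Finset.mem_range.2 (by omega)) h)]
    simp
  · by_cases h2 : 2 * S.cnt w τ < S.deg w
    · simp only [if_neg h1, if_pos h2]
      rw [Finset.sum_eq_single k (fun x _ hx => by rw [if_neg hx.symm, mul_zero])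
        (fun h => absurd (Finset.mem_range.2 (by omega)) h)]
      simp
    · simp only [if_neg h1, if_neg h2] at hy ⊢
      rw [Finset.sum_eq_single (y + δ) (fun x _ hx => by rw [if_neg hx, zero_mul])
        (fun h => absurd (Finset.mem_range.2 (by omega)) h)]
      rw [if_pos rfl, one_mul]
      congr 1
      ring

theorem weight_succ_of_ne (μ : ℕ → ℕ → ℤ) {τ w : ℕ} (h : S.cnt w (τ + 1) = S.cnt w τ) (k y : ℕ) :
    S.weight μ (τ + 1) w k y = S.weight μ τ w k y := by
  unfold weight; rw [h]

theorem val_succ_of_not_live (μ : ℕ → ℕ → ℤ) {τ : ℕ} (h : ¬ S.live τ) (κ : ℕ → ℕ) :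
    S.val μ (τ + 1) κ = S.val μ τ κ := by
  unfold val
  simp only [Φ, if_neg h, weight_succ_of_ne μ (cnt_succ_of_not_live h _)]

theorem prod_range_split {n u v : ℕ} (hu : u < n) (hv : v < n) (huv : u ≠ v) (f : ℕ → ℤ) :
    ∏ w ∈ Finset.range n, f w
      = f u * f v * ∏ w ∈ ((Finset.range n).erase u).erase v, f w := by
  rw [← Finset.mul_prod_erase _ _ (Finset.mem_range.2 hu),
    ← Finset.mul_prod_erase _ _ (Finset.mem_erase.2 ⟨huv.symm, Finset.mem_range.2 hv⟩), mul_assoc]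

/-- The recurrence of the dynamic program. -/
theorem val_succ_of_live (μ : ℕ → ℕ → ℤ) {τ : ℕ} (hl : S.live τ) (hτ : τ < S.H) {κ : ℕ → ℕ}
    (hκ : ∀ w < S.n, κ w ≤ S.cap (τ + 1) w) :
    S.val μ (τ + 1) κ = ∑ x ∈ Finset.range (S.cap τ (S.a τ) + 1),
      ∑ y ∈ Finset.range (S.cap τ (S.b τ) + 1),
        (S.trans μ τ (S.a τ) x 1 (κ (S.a τ)) * S.trans μ τ (S.b τ) y 0 (κ (S.b τ))
          - S.trans μ τ (S.a τ) x 0 (κ (S.a τ)) * S.trans μ τ (S.b τ) y 1 (κ (S.b τ)))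
        * S.val μ τ (Function.update (Function.update κ (S.a τ) x) (S.b τ) y) := by
  have hu := S.a_lt τ hl
  have hv := S.b_lt τ hl
  have huv := S.ne τ hl
  have hcu := cnt_succ_a hl
  have hcv := cnt_succ_b hl
  have hne : ∀ w, w ≠ S.a τ → w ≠ S.b τ → S.cnt w (τ + 1) = S.cnt w τ := fun w =>
    cnt_succ_of_ne
  have hd : ∀ w, S.cnt w (τ + 1) ≤ S.deg w := fun w => cnt_mono w hτ
  unfold val
  simp only [Φ, if_pos hl]
  generalize S.a τ = u at *
  generalize S.b τ = v at *
  have key : ∀ (α α' : ℕ → ℕ) (δ ε : ℕ), (∀ w, α w ≤ S.cnt w τ) → δ ≤ 1 → ε ≤ 1 →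
      α' u = α u + δ → α' v = α v + ε → (∀ w, w ≠ u → w ≠ v → α' w = α w) →
      ∏ w ∈ Finset.range S.n, S.weight μ (τ + 1) w (α' w) (κ w)
        = ∑ x ∈ Finset.range (S.cap τ u + 1), ∑ y ∈ Finset.range (S.cap τ v + 1),
          S.trans μ τ u x δ (κ u) * S.trans μ τ v y ε (κ v) * ∏ w ∈ Finset.range S.n,
            S.weight μ τ w (α w) (Function.update (Function.update κ u x) v y w) := by
    intro α α' δ ε hα hδ hε h1 h2 h3
    rw [prod_range_split hu hv huv, h1, h2, sum_weight_mul_trans μ hcu (hd u) (hα u) hδ (hκ u hu),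
      sum_weight_mul_trans μ hcv (hd v) (hα v) hε (hκ v hv), Finset.sum_mul_sum, Finset.sum_mul]
    refine Finset.sum_congr rfl fun x _ => ?_
    rw [Finset.sum_mul]
    refine Finset.sum_congr rfl fun y _ => ?_
    rw [prod_range_split hu hv huv]
    have : ∏ w ∈ ((Finset.range S.n).erase u).erase v, S.weight μ (τ + 1) w (α' w) (κ w)
        = ∏ w ∈ ((Finset.range S.n).erase u).erase v,
          S.weight μ τ w (α w) (Function.update (Function.update κ u x) v y w) := by
      refine Finset.prod_congr rfl fun w hw => ?_
      simp only [Finset.mem_erase] at hw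
      rw [Function.update_of_ne hw.1, Function.update_of_ne hw.2.1, h3 w hw.2.1 hw.1,
        weight_succ_of_ne μ (hne w hw.2.1 hw.1)]
    rw [this]
    simp only [Function.update_self, Function.update_of_ne huv]
    ring
  rw [Φ_congr (fun α hα => key α (Function.update α u (α u + 1)) 1 0 hα le_rfl zero_le_one
      (by simp) (by simp [huv.symm]) (fun w h _ => by simp [h])),
    Φ_congr (fun α hα => key α (Function.update α v (α v + 1)) 0 1 hα zero_le_one le_rfl
      (by simp [huv]) (by simp) (fun w _ h => by simp [h]))]
  simp only [Φ_sum, Φ_mul_left, ← Finset.sum_sub_distrib, sub_mul]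

theorem val_congr (μ : ℕ → ℕ → ℤ) (τ : ℕ) {κ κ' : ℕ → ℕ} (h : ∀ w < S.n, κ w = κ' w) :
    S.val μ τ κ = S.val μ τ κ' := by
  unfold val
  congr 1
  funext α
  exact Finset.prod_congr rfl fun w hw => by rw [h w (Finset.mem_range.1 hw)]

theorem val_zero (μ : ℕ → ℕ → ℤ) {κ : ℕ → ℕ} (h : ∀ w < S.n, κ w = 0) :
    S.val μ 0 κ = ∏ w ∈ Finset.range S.n, if 0 < S.deg w then 1 else μ w 0 := by
  simp only [val, Φ, weight]
  refine Finset.prod_congr rfl fun w hw => ?_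
  rw [h w (Finset.mem_range.1 hw)]
  simp [cnt]

theorem abs_val_le {μ : ℕ → ℕ → ℤ} {τ : ℕ} (hτ : τ ≤ S.H) {κ : ℕ → ℕ}
    (hκ : ∀ w < S.n, κ w ≤ S.cap τ w) {X : ℤ} (hX : 1 ≤ X)
    (hμ : ∀ w < S.n, ∀ k ≤ S.deg w, |μ w k| ≤ X) : |S.val μ τ κ| ≤ 2 ^ τ * X ^ S.n := by
  refine abs_Φ_le fun α hα => ?_
  rw [Finset.abs_prod]
  refine (Finset.prod_le_prod (fun _ _ => abs_nonneg _) (g := fun _ => X) fun w hw => ?_).trans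
    (by simp)
  rw [Finset.mem_range] at hw
  unfold weight
  split
  · split <;> simp <;> linarith
  · refine hμ w hw _ ?_
    have := hκ w hw
    have := hα w
    have := cap_add_cnt_le (S := S) (w := w) hτ
    omega

/-- The power moments of the weights `1, z, …, z ^ (q - 1)` of the colors `0, 1, …, q - 1`. -/
def _root_.moment (q : ℕ) (z : ℤ) (k : ℕ) : ℤ := ∑ c ∈ Finset.range q, z ^ c * (c : ℤ) ^ k

/-- A coloring of the vertices `0, …, n - 1`, as a function on all natural numbers. -/
def _root_.extendColoring {n : ℕ} (x : Fin n → ℕ) (w : ℕ) : ℤ := if h : w < n then x ⟨w, h⟩ else 0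

/-- The final value is the sum of the values of the graph polynomial over all assignments of
colors, weighted with monomials in the variables `r`. -/
theorem val_final (q : ℕ) (r : ℕ → ℤ) :
    S.val (fun w => moment q (r w)) S.H 0
      = ∑ x ∈ Fintype.piFinset fun _ : Fin S.n => Finset.range q,
        (∏ i ∈ Finset.range S.H, if S.live i then
          extendColoring x (S.a i) - extendColoring x (S.b i) else 1)
        * ∏ w : Fin S.n, r w ^ x w := by
  unfold val
  have : ∀ α : ℕ → ℕ, ∏ w ∈ Finset.range S.n,
      S.weight (fun w => moment q (r w)) S.H w (α w) ((0 : ℕ → ℕ) w)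
      = ∑ x ∈ Fintype.piFinset fun _ : Fin S.n => Finset.range q,
        (∏ w : Fin S.n, r w ^ x w) * ∏ w ∈ Finset.range S.n, extendColoring x w ^ α w := by
    intro α
    rw [Finset.prod_range]
    have hw : ∀ w, S.weight (fun w => moment q (r w)) S.H w (α w) ((0 : ℕ → ℕ) w)
        = moment q (r w) (α w) := by
      intro w
      rw [weight, if_neg (by unfold deg; omega)]
      rfl
    simp only [hw, moment]
    rw [Finset.prod_univ_sum]
    refine Finset.sum_congr rfl fun x _ => ?_
    rw [Finset.prod_range, ← Finset.prod_mul_distrib]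
    refine Finset.prod_congr rfl fun w _ => ?_
    simp [extendColoring]
  simp only [this, Φ_sum, Φ_mul_left, Φ_prod_pow]
  exact Finset.sum_congr rfl fun x _ => mul_comm _ _

end Schedule

/-! ### Random numbers from coin flips -/

/-- The number with the `K` binary digits `ω (w * K), …, ω (w * K + K - 1)`. -/
def randomNumber (K : ℕ) (ω : ℕ → Bool) (w : ℕ) : ℤ :=
  ∑ b ∈ Finset.range K, (if ω (w * K + b) then 1 else 0) * 2 ^ b

theorem randomNumber_bounds (K : ℕ) (ω : ℕ → Bool) (w : ℕ) :
    0 ≤ randomNumber K ω w ∧ randomNumber K ω w < 2 ^ K := by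
  unfold randomNumber
  generalize hf : (fun b => ω (w * K + b)) = f
  have : ∀ b, ω (w * K + b) = f b := fun b => congrFun hf b
  simp only [this]
  clear hf this
  induction K with
  | zero => simp
  | succ K ih =>
    rw [Finset.sum_range_succ, pow_succ]
    have h : (0 : ℤ) < 2 ^ K := by positivity
    obtain ⟨h1, h2⟩ := ih
    split <;> constructor <;> omega

/-- A number determines its binary digits. -/
theorem binary_digits_injective {K : ℕ} {f g : ℕ → Bool}
    (h : ∑ b ∈ Finset.range K, (if f b then (1 : ℤ) else 0) * 2 ^ b
      = ∑ b ∈ Finset.range K, (if g b then 1 else 0) * 2 ^ b) : ∀ b < K, f b = g b := by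
  induction K generalizing f g with
  | zero => simp
  | succ K ih =>
    rw [Finset.sum_range_succ', Finset.sum_range_succ'] at h
    simp only [pow_succ, ← mul_assoc, ← Finset.sum_mul] at h
    have h0 : f 0 = g 0 := by
      cases hf : f 0 <;> cases hg : g 0 <;> simp [hf, hg] at h ⊢ <;> omega
    have h1 := ih (f := fun b => f (b + 1)) (g := fun b => g (b + 1)) (by
      rw [h0] at h
      linarith)
    intro b hb
    cases b with
    | zero => exact h0
    | succ b => exact h1 b (by omega)

/-- The probability of a set of outcomes of the first `m` coin flips. -/
theorem coinMeasure_le_card {m : ℕ} (A : Set (ℕ → Bool)) (B : Finset (Fin m → Bool))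
    (h : ∀ ω ∈ A, (fun i : Fin m => ω i) ∈ B) :
    coinMeasure A ≤ (B.card : ENNReal) * (2⁻¹) ^ m := by
  have h1 : A ⊆ ⋃ g ∈ B, Set.pi (Finset.range m : Set ℕ)
      (fun i => {c : Bool | ∀ h : i < m, c = g ⟨i, h⟩}) := by
    intro ω hω
    simp only [Set.mem_iUnion]
    exact ⟨_, h ω hω, fun i _ _ => rfl⟩
  refine (measure_mono h1).trans ((measure_biUnion_finset_le _ _).trans ?_)
  rw [← nsmul_eq_mul]
  refine Finset.sum_le_card_nsmul _ _ _ fun g _ => ?_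
  unfold coinMeasure
  rw [Measure.infinitePi_pi _ (fun i _ => MeasurableSet.of_discrete)]
  refine le_of_eq ?_
  rw [Finset.prod_eq_pow_card (b := 2⁻¹), Finset.card_range]
  intro i hi
  have : {c : Bool | ∀ h : i < m, c = g ⟨i, h⟩} = {g ⟨i, Finset.mem_range.1 hi⟩} := by
    ext c; simp [Finset.mem_range.1 hi]
  rw [this, PMF.toMeasure_apply_singleton _ _ (MeasurableSet.of_discrete)]
  simp

/-- A sum of different monomials, in `n` random numbers of `K` bits, of degree less than `q` in each
variable, vanishes with probability at most `n * q / 2 ^ K`, unless all coefficients vanish. -/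
theorem coinMeasure_sum_eq_zero_le {n q K : ℕ} (F : (Fin n → ℕ) → ℤ)
    (hF : ∃ x ∈ Fintype.piFinset fun _ : Fin n => Finset.range q, F x ≠ 0) :
    coinMeasure {ω | ∑ x ∈ Fintype.piFinset fun _ : Fin n => Finset.range q,
        F x * ∏ w : Fin n, randomNumber K ω w ^ x w = 0}
      ≤ ((n * q : ℕ) : ENNReal) * (2⁻¹) ^ K := by
  classical
  let P : MvPolynomial (Fin n) ℤ := ∑ x ∈ Fintype.piFinset fun _ : Fin n => Finset.range q,
    MvPolynomial.monomial (Finsupp.equivFunOnFinite.symm x) (F x)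
  have hP : P ≠ 0 := by
    obtain ⟨x, hx, hx'⟩ := hF
    intro h
    apply hx'
    have : MvPolynomial.coeff (Finsupp.equivFunOnFinite.symm x) P = F x := by
      simp only [P, MvPolynomial.coeff_sum, MvPolynomial.coeff_monomial]
      rw [Finset.sum_eq_single x]
      · simp
      · intro y _ hy
        rw [if_neg]
        simpa using hy
      · exact fun h => absurd hx h
    rw [← this, h, MvPolynomial.coeff_zero]
  have hdeg : P.totalDegree ≤ n * q := by
    refine (MvPolynomial.totalDegree_finsetSum _ _).trans (Finset.sup_le fun x hx => ?_)
    refine (MvPolynomial.totalDegree_monomial_le _ _).trans ?_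
    rw [Finsupp.sum_fintype _ _ (fun _ => rfl)]
    refine (Finset.sum_le_card_nsmul _ _ q fun i _ => ?_).trans (by simp)
    have := Finset.mem_range.1 (Fintype.mem_piFinset.1 hx i)
    exact this.le
  have heval : ∀ r : Fin n → ℤ, MvPolynomial.eval r P
      = ∑ x ∈ Fintype.piFinset fun _ : Fin n => Finset.range q, F x * ∏ w, r w ^ x w := by
    intro r
    simp only [P, map_sum, MvPolynomial.eval_monomial]
    refine Finset.sum_congr rfl fun x _ => ?_
    rw [Finsupp.prod_fintype _ _ (fun _ => pow_zero _)]
    rfl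
  let N : Finset ℤ := (Finset.range (2 ^ K)).map Nat.castEmbedding
  have hN : N.card = 2 ^ K := by simp [N]
  let ext : (Fin (n * K) → Bool) → ℕ → Bool := fun g i => if h : i < n * K then g ⟨i, h⟩ else false
  have hlt : ∀ w : Fin n, ∀ b < K, (w : ℕ) * K + b < n * K := fun w b hb =>
    calc (w : ℕ) * K + b < (w + 1) * K := by rw [add_mul, one_mul]; omega
      _ ≤ n * K := Nat.mul_le_mul_right _ w.2
  let num : (Fin (n * K) → Bool) → Fin n → ℤ := fun g w => randomNumber K (ext g) w
  have hnum : ∀ ω : ℕ → Bool, ∀ w : Fin n,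
      num (fun i => ω i) w = randomNumber K ω w := by
    intro ω w
    refine Finset.sum_congr rfl fun b hb => ?_
    simp [ext, hlt w b (Finset.mem_range.1 hb)]
  let B : Finset (Fin (n * K) → Bool) := Finset.univ.filter fun g => MvPolynomial.eval (num g) P = 0
  have hinj : Function.Injective num := by
    intro g g' h
    funext i
    have hK : 0 < K := Nat.pos_of_ne_zero fun h => by have := i.2; simp [h] at this
    have hw : (i : ℕ) / K < n := Nat.div_lt_of_lt_mul (i.2.trans_eq (mul_comm n K))
    have h1 := binary_digits_injective (congrFun h ⟨(i : ℕ) / K, hw⟩) ((i : ℕ) % K)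
      (Nat.mod_lt _ hK)
    simp only [Nat.div_add_mod'] at h1
    simpa [ext] using h1
  have hB : B.card ≤ (Finset.filter (fun f => MvPolynomial.eval f P = 0)
      (Fintype.piFinset fun _ : Fin n => N)).card := by
    refine Finset.card_le_card_of_injOn num (fun g hg => ?_) hinj.injOn
    simp only [B, Finset.coe_filter, Finset.mem_univ, true_and, Set.mem_ofPred_eq] at hg
    simp only [Finset.coe_filter, Set.mem_ofPred_eq, hg, and_true, Fintype.mem_piFinset, N,
      Finset.mem_map, Finset.mem_range, Nat.castEmbedding_apply]
    intro w
    obtain ⟨h1, h2⟩ := randomNumber_bounds K (ext g) w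
    refine ⟨(num g w).toNat, ?_, Int.toNat_of_nonneg h1⟩
    have : ((num g w).toNat : ℤ) < (2 ^ K : ℕ) := by
      rw [Int.toNat_of_nonneg h1]; push_cast; exact h2
    exact_mod_cast this
  have hcard : B.card * 2 ^ K ≤ n * q * 2 ^ (n * K) := by
    have hSZ := MvPolynomial.schwartz_zippel_totalDegree hP N
    rw [hN, div_le_div_iff₀ (by positivity) (by positivity), ← Nat.cast_pow, ← Nat.cast_mul,
      ← Nat.cast_mul, Nat.cast_le, ← pow_mul, mul_comm K n] at hSZ
    exact (Nat.mul_le_mul_right _ hB).trans (hSZ.trans (Nat.mul_le_mul_right _ hdeg))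
  refine (coinMeasure_le_card (m := n * K) _ B fun ω hω => ?_).trans ?_
  · simp only [B, Finset.mem_filter, Finset.mem_univ, true_and]
    rw [funext (hnum ω), heval]
    exact hω
  · rw [← ENNReal.inv_pow, ← ENNReal.inv_pow, ← div_eq_mul_inv, ← div_eq_mul_inv]
    refine ENNReal.div_le_of_le_mul ?_
    rw [ENNReal.mul_comm_div, ← mul_div_assoc, ENNReal.le_div_iff_mul_le (by simp) (by simp)]
    exact_mod_cast hcard

/-! ### Terms for the quantities of the dynamic program -/

/-- The data of an instance: numbers of vertices, bags and colors, adjacency, and membership of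
vertices in bags. -/
structure ColoringInput where
  /-- number of vertices -/
  n : ℕ
  /-- number of bags -/
  len : ℕ
  /-- number of colors -/
  q : ℕ
  /-- adjacency of vertices -/
  adj : ℕ → ℕ → Bool
  /-- `bag β v` says that the vertex `v` lies in the bag `β` -/
  bag : ℕ → ℕ → Bool

namespace ColoringInput

variable (I : ColoringInput)

/-- Whether both vertices lie in the bag `β`. -/
def both (β u v : ℕ) : Bool := I.bag β u && I.bag β v

/-- The edges are processed in the order of the first bags that contain both ends. The time
`τ = β * n ^ 2 + u * n + v` is reserved for the edge between `u < v`, if its first bag is `β`. -/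
def sched : Schedule where
  n := I.n
  H := I.len * (I.n * I.n)
  live τ := decide (τ < I.len * (I.n * I.n)) && (decide (τ / I.n % I.n < τ % I.n) &&
    (I.adj (τ / I.n % I.n) (τ % I.n) &&
    (I.both (τ / (I.n * I.n)) (τ / I.n % I.n) (τ % I.n) &&
    decide (∀ β < τ / (I.n * I.n), ¬ I.both β (τ / I.n % I.n) (τ % I.n)))))
  a τ := τ / I.n % I.n
  b τ := τ % I.n
  a_lt τ h := Nat.mod_lt _ (Nat.pos_of_ne_zero fun h0 => by simp [h0] at h)
  b_lt τ h := Nat.mod_lt _ (Nat.pos_of_ne_zero fun h0 => by simp [h0] at h)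
  ne τ h := by
    simp only [Bool.and_eq_true, decide_eq_true_eq] at h
    exact h.2.1.ne

/-- A number that bounds all numbers of rounds of the loops in terms, and serves as the number of
random bits for each vertex. -/
def R : ℕ := (I.n + I.len + 7) * (I.n + I.len + 7) * (I.n + I.len + 7)

/-- The words `x` describe the instance. -/
structure IsInput (x : ℕ → ℤ) : Prop where
  n_eq : x 0 = I.n
  q_eq : x 1 = I.q
  len_eq : x 2 = I.len
  adj_eq : ∀ u < I.n, ∀ v < I.n, x (3 + u * I.n + v) = if I.adj u v then 1 else 0
  bag_eq : ∀ β < I.len, ∀ v < I.n,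
    x (3 + I.n * I.n + β * I.n + v) = if I.bag β v then 1 else 0

theorem two_mul_H_add_two_le : 2 * I.sched.H + 2 ≤ I.R := by
  show 2 * (I.len * (I.n * I.n)) + 2 ≤ (I.n + I.len + 7) * (I.n + I.len + 7) * (I.n + I.len + 7)
  generalize I.n = n
  generalize I.len = l
  have h : (n + l + 7) * (n + l + 7) * (n + l + 7) = 3 * (l * (n * n)) + 343 + (n ^ 3 + l ^ 3
    + 3 * n * l ^ 2 + 21 * n ^ 2 + 21 * l ^ 2 + 42 * n * l + 147 * n + 147 * l) := by ring
  rw [h]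
  omega

theorem n_add_len_le : I.n + I.len + 7 ≤ I.R :=
  Nat.le_mul_of_pos_left _ (by positivity)

/-- The components of the state with index `s` at time `τ`. -/
def state (τ s w : ℕ) : ℕ := mixedDigit (fun w => I.sched.cap τ w + 1) w s

/-- The number of states at time `τ`. -/
def numStates (τ : ℕ) : ℕ := placeValue (fun w => I.sched.cap τ w + 1) I.n

theorem state_le (τ s w : ℕ) : I.state τ s w ≤ I.sched.cap τ w :=
  Nat.lt_succ_iff.1 (Nat.mod_lt _ (Nat.succ_pos _))

end ColoringInput

namespace Term

instance : Add Term := ⟨.op .add⟩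
instance : Sub Term := ⟨.op .sub⟩
instance : Mul Term := ⟨.op .mul⟩
instance : Div Term := ⟨.op .div⟩
instance (k : ℕ) : OfNat Term k := ⟨.const k⟩

/-- The remainder. -/
def mod (a b : Term) : Term := a - a / b * b

/-- Case distinction by `a < b`. -/
def ifLt (a b c d : Term) : Term := .ite (b - a) c d

/-- Case distinction by `a = b`. -/
def ifEq (a b c d : Term) : Term := ifLt a b d (ifLt b a d c)

/-- The sum of the values of `e` for the values of variable `0` below that of `b`. The term `b`
is evaluated with variable `0` bound, too. The range is cut off at the parameter `R`. -/
def sumTo (b e : Term) : Term := .fold .add 0 (ifLt (.var 0) b e 0)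

/-- The product of the values of `e` for the values of variable `0` below that of `b`. The term `b`
is evaluated with variable `0` bound, too. The range is cut off at the parameter `R`. -/
def prodTo (b e : Term) : Term := .fold .mul 1 (ifLt (.var 0) b e 1)

section Eval

variable {x : ℕ → ℤ} {T : ℤ → ℤ} {R : ℕ} {env : List ℤ}

@[simp] theorem eval_add (a b : Term) :
    (a + b).eval x T R env = a.eval x T R env + b.eval x T R env := rfl
@[simp] theorem eval_sub (a b : Term) :
    (a - b).eval x T R env = a.eval x T R env - b.eval x T R env := rfl
@[simp] theorem eval_mul (a b : Term) :
    (a * b).eval x T R env = a.eval x T R env * b.eval x T R env := rfl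
@[simp] theorem eval_div (a b : Term) :
    (a / b).eval x T R env = a.eval x T R env / b.eval x T R env := rfl
@[simp] theorem eval_zero : (0 : Term).eval x T R env = 0 := rfl
@[simp] theorem eval_one : (1 : Term).eval x T R env = 1 := rfl
@[simp] theorem eval_ofNat (k : ℕ) [k.AtLeastTwo] :
    (ofNat(k) : Term).eval x T R env = (ofNat(k) : ℤ) := rfl
@[simp] theorem eval_var_zero (z : ℤ) : (Term.var 0).eval x T R (z :: env) = z := rfl
@[simp] theorem eval_var_succ (i : ℕ) (z : ℤ) :
    (Term.var (i + 1)).eval x T R (z :: env) = (Term.var i).eval x T R env := by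
  simp [Term.eval]
@[simp] theorem eval_bind (a b : Term) :
    (Term.bind a b).eval x T R env = b.eval x T R (a.eval x T R env :: env) := rfl
@[simp] theorem eval_inp (a : Term) :
    (Term.inp a).eval x T R env = x (a.eval x T R env).toNat := rfl
@[simp] theorem eval_tab (a : Term) :
    (Term.tab a).eval x T R env = T (a.eval x T R env) := rfl

@[simp] theorem eval_ifLt (a b c d : Term) : (ifLt a b c d).eval x T R env =
    if a.eval x T R env < b.eval x T R env then c.eval x T R env else d.eval x T R env := by
  simp [ifLt, Term.eval]

@[simp] theorem eval_ifEq (a b c d : Term) : (ifEq a b c d).eval x T R env =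
    if a.eval x T R env = b.eval x T R env then c.eval x T R env else d.eval x T R env := by
  simp only [ifEq, eval_ifLt]
  rcases lt_trichotomy (a.eval x T R env) (b.eval x T R env) with h | h | h
  · rw [if_pos h, if_neg h.ne]
  · rw [if_neg h.not_lt, if_neg h.not_gt, if_pos h]
  · rw [if_neg h.not_gt, if_pos h, if_neg h.ne']

theorem eval_mod {a b : Term} {i j : ℕ} (ha : a.eval x T R env = i) (hb : b.eval x T R env = j) :
    (mod a b).eval x T R env = (i % j : ℕ) := by
  simp only [mod, eval_sub, eval_mul, eval_div, ha, hb]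
  push_cast
  rw [Int.emod_def, mul_comm]

theorem accum_add (f : ℕ → ℤ) (k : ℕ) : Op.add.accum 0 f k = ∑ i ∈ Finset.range k, f i := by
  induction k with
  | zero => rfl
  | succ k ih => rw [Finset.sum_range_succ, ← ih]; rfl

theorem accum_mul (f : ℕ → ℤ) (k : ℕ) : Op.mul.accum 1 f k = ∏ i ∈ Finset.range k, f i := by
  induction k with
  | zero => rfl
  | succ k ih => rw [Finset.prod_range_succ, ← ih]; rfl

theorem eval_sumTo {b e : Term} {N : ℕ} {f : ℕ → ℤ} (hN : N ≤ R)
    (hb : ∀ i < R, b.eval x T R ((i : ℤ) :: env) = N)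
    (he : ∀ i < N, e.eval x T R ((i : ℤ) :: env) = f i) :
    (sumTo b e).eval x T R env = ∑ i ∈ Finset.range N, f i := by
  simp only [sumTo, Term.eval, accum_add]
  rw [← Finset.sum_subset (Finset.range_mono hN)]
  · refine Finset.sum_congr rfl fun i hi => ?_
    rw [Finset.mem_range] at hi
    rw [eval_ifLt, hb i (by omega), eval_var_zero, if_pos (by exact_mod_cast hi), he i hi]
  · intro i hi hi'
    rw [Finset.mem_range] at hi hi'
    rw [eval_ifLt, hb i hi, eval_var_zero, if_neg (by exact_mod_cast hi'), eval_zero]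

theorem eval_prodTo {b e : Term} {N : ℕ} {f : ℕ → ℤ} (hN : N ≤ R)
    (hb : ∀ i < R, b.eval x T R ((i : ℤ) :: env) = N)
    (he : ∀ i < N, e.eval x T R ((i : ℤ) :: env) = f i) :
    (prodTo b e).eval x T R env = ∏ i ∈ Finset.range N, f i := by
  simp only [prodTo, Term.eval, accum_mul]
  rw [← Finset.prod_subset (Finset.range_mono hN)]
  · refine Finset.prod_congr rfl fun i hi => ?_
    rw [Finset.mem_range] at hi
    rw [eval_ifLt, hb i (by omega), eval_var_zero, if_pos (by exact_mod_cast hi), he i hi]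
  · intro i hi hi'
    rw [Finset.mem_range] at hi hi'
    rw [eval_ifLt, hb i hi, eval_var_zero, if_neg (by exact_mod_cast hi'), eval_one]

end Eval

/-! In the comments below, the variables that a term takes as arguments are listed from variable `0`
on. -/

/-- The number of vertices. -/
def numV : Term := .inp 0

/-- The number of colors. -/
def numQ : Term := .inp 1

/-- The number of bags. -/
def numL : Term := .inp 2

/-- The bound for all loops. -/
def bound : Term := (numV + numL + 7) * (numV + numL + 7) * (numV + numL + 7)

/-- The number of time steps. -/
def horizon : Term := numL * (numV * numV)

/-- The bag to which the time `t` belongs. -/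
def bagOf (t : Term) : Term := t / (numV * numV)

/-- The first vertex to which the time `t` belongs. -/
def fstOf (t : Term) : Term := mod (t / numV) numV

/-- The second vertex to which the time `t` belongs. -/
def sndOf (t : Term) : Term := mod t numV

/-- Whether both vertices lie in a bag. -/
def bothIn (β u v : Term) : Term :=
  .inp (3 + numV * numV + β * numV + u) * .inp (3 + numV * numV + β * numV + v)

/-- Whether an edge is processed at time `τ`; argument `τ`. -/
def live : Term :=
  ifLt (fstOf (.var 0)) (sndOf (.var 0))
    (.inp (3 + fstOf (.var 0) * numV + sndOf (.var 0)) *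
      bothIn (bagOf (.var 0)) (fstOf (.var 0)) (sndOf (.var 0)) *
      ifLt 0 (sumTo (bagOf (.var 1)) (bothIn (.var 0) (fstOf (.var 1)) (sndOf (.var 1)))) 0 1)
    0

/-- The number of processed edges at a vertex; arguments `τ, w`. -/
def cnt : Term :=
  sumTo (.var 1) (live * (ifEq (fstOf (.var 0)) (.var 2) 1 0 + ifEq (sndOf (.var 0)) (.var 2) 1 0))

/-- The degree of a vertex; argument `w`. -/
def deg : Term := .bind horizon cnt

/-- The bound for the component of a state; arguments `τ, w`. -/
def cap : Term := ifLt (2 * cnt) (.bind (.var 1) deg) cnt (.bind (.var 1) deg - cnt)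

/-- The random number of a vertex; argument `w`. -/
def rand : Term :=
  sumTo bound (.tab (2 * (.var 1 * bound + .var 0)) * prodTo (.var 1) 2)

/-- Powers; arguments `base, exponent`. -/
def pow : Term := prodTo (.var 2) (.var 1)

/-- Moments of the weights of the colors; arguments `w, k`. -/
def moment : Term :=
  sumTo numQ (.bind (.var 0) (.bind (.bind (.var 2) rand) pow) *
    .bind (.var 2) (.bind (.var 1) pow))

/-- Place values for the indices of the states; arguments `τ, w`. -/
def place : Term := prodTo (.var 2) (.bind (.var 0) (.bind (.var 2) cap) + 1)

/-- The number of states; argument `τ`. -/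
def numStates : Term := .bind numV (.bind (.var 1) place)

/-- The component of a state; arguments `τ, w, s`. -/
def digit : Term := mod (.var 2 / place) (cap + 1)

/-- Coefficients of the transitions; arguments `τ, w, x, y`. -/
def trans (δ : Term) : Term :=
  ifLt (2 * (cnt + 1)) (.bind (.var 1) deg) (ifEq (.var 2 + δ) (.var 3) 1 0)
    (ifLt (2 * cnt) (.bind (.var 1) deg) (.bind (.var 2 + δ + .var 3) (.bind (.var 2) moment))
      (ifEq (.var 2) (.var 3 + δ) 1 0))

/-- The index, at time `τ`, of the state that arises from the state with index `s` at time `τ + 1`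
when the components of the ends of the processed edge are replaced by `x` and `y`; arguments
`τ, s, x, y`. -/
def index : Term :=
  sumTo numV (ifEq (.var 0) (sndOf (.var 1)) (.var 4) (ifEq (.var 0) (fstOf (.var 1)) (.var 3)
      (.bind (.var 2) (.bind (.var 1) (.bind (.var 3 + 1) digit)))) *
    .bind (.var 0) (.bind (.var 2) place))

/-- The place in the table for the value of the state with index `s` at time `t`. -/
def slot (s t : Term) : Term := 2 * (s * bound + t) + 1

/-- The value of the state with index `s` at time `τ + 1`; arguments `s, τ`. -/
def step : Term :=
  .ite (.bind (.var 1) live)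
    (sumTo (.bind (fstOf (.var 2)) (.bind (.var 3) cap) + 1)
      (sumTo (.bind (sndOf (.var 3)) (.bind (.var 4) cap) + 1)
        ((trF 1 * trS 0 - trF 0 * trS 1) * .tab (slot
          (.bind (.var 0) (.bind (.var 2) (.bind (.var 4) (.bind (.var 6) index)))) (.var 3)))))
    (.tab (slot (.var 0) (.var 1)))
where
  /-- The coefficient at the first end of the edge; arguments `y, x, s, τ`. -/
  trF (δ : Term) : Term := .bind (.bind (.var 2) (.bind (fstOf (.var 4)) (.bind (.var 5 + 1) digit)))
    (.bind (.var 2) (.bind (fstOf (.var 5)) (.bind (.var 6) (trans δ))))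
  /-- The coefficient at the second end of the edge; arguments `y, x, s, τ`. -/
  trS (δ : Term) : Term := .bind (.bind (.var 2) (.bind (sndOf (.var 4)) (.bind (.var 5 + 1) digit)))
    (.bind (.var 1) (.bind (sndOf (.var 5)) (.bind (.var 6) (trans δ))))

/-- The value of the only state at time `0`. -/
def start : Term := prodTo numV (ifLt 0 deg 1 (.bind 0 (.bind (.var 1) moment)))

/-- The answer, from the value of the only state in the end. -/
def answer : Term := ifLt 0 (.tab (slot 0 horizon) * .tab (slot 0 horizon)) 1 0

section Correct

variable {I : ColoringInput} {x : ℕ → ℤ} {T : ℤ → ℤ} {env : List ℤ}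

theorem eval_numV {R : ℕ} (h : I.IsInput x) : numV.eval x T R env = I.n := h.n_eq
theorem eval_numQ {R : ℕ} (h : I.IsInput x) : numQ.eval x T R env = I.q := h.q_eq
theorem eval_numL {R : ℕ} (h : I.IsInput x) : numL.eval x T R env = I.len := h.len_eq

theorem eval_bound {R : ℕ} (h : I.IsInput x) : bound.eval x T R env = I.R := by
  simp [bound, eval_numV h, eval_numL h, ColoringInput.R]

theorem eval_horizon {R : ℕ} (h : I.IsInput x) : horizon.eval x T R env = I.sched.H := by
  simp [horizon, eval_numV h, eval_numL h, ColoringInput.sched]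

theorem eval_bagOf {R : ℕ} (h : I.IsInput x) {t : Term} {τ : ℕ} (ht : t.eval x T R env = τ) :
    (bagOf t).eval x T R env = (τ / (I.n * I.n) : ℕ) := by
  simp [bagOf, eval_numV h, ht]

theorem eval_fstOf {R : ℕ} (h : I.IsInput x) {t : Term} {τ : ℕ} (ht : t.eval x T R env = τ) :
    (fstOf t).eval x T R env = I.sched.a τ :=
  eval_mod (by simp [eval_numV h, ht]) (eval_numV h)

theorem eval_sndOf {R : ℕ} (h : I.IsInput x) {t : Term} {τ : ℕ} (ht : t.eval x T R env = τ) :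
    (sndOf t).eval x T R env = I.sched.b τ :=
  eval_mod ht (eval_numV h)

theorem eval_bothIn {R : ℕ} (h : I.IsInput x) {b t t' : Term} {β u v : ℕ}
    (hb : b.eval x T R env = β) (ht : t.eval x T R env = u) (ht' : t'.eval x T R env = v)
    (hβ : β < I.len) (hu : u < I.n) (hv : v < I.n) :
    (bothIn b t t').eval x T R env = if I.both β u v then 1 else 0 := by
  have e1 : (3 + (I.n : ℤ) * I.n + β * I.n + u).toNat = 3 + I.n * I.n + β * I.n + u := by
    exact_mod_cast Int.toNat_natCast _
  have e2 : (3 + (I.n : ℤ) * I.n + β * I.n + v).toNat = 3 + I.n * I.n + β * I.n + v := by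
    exact_mod_cast Int.toNat_natCast _
  simp only [bothIn, eval_mul, eval_inp, eval_add, eval_ofNat, eval_numV h, hb, ht, ht', e1, e2,
    h.bag_eq β hβ u hu, h.bag_eq β hβ v hv, ColoringInput.both]
  by_cases h1 : I.bag β u <;> by_cases h2 : I.bag β v <;> simp [h1, h2]

theorem eval_live (h : I.IsInput x) {τ : ℕ} (hτ : τ < I.sched.H) :
    live.eval x T I.R ((τ : ℤ) :: env) = if I.sched.live τ then 1 else 0 := by
  have hτ' : τ < I.len * (I.n * I.n) := hτ
  have hn : 0 < I.n := Nat.pos_of_ne_zero fun h0 => by simp [h0] at hτ'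
  have hA : I.sched.a τ < I.n := Nat.mod_lt _ hn
  have hB : I.sched.b τ < I.n := Nat.mod_lt _ hn
  have hβ : τ / (I.n * I.n) < I.len := Nat.div_lt_of_lt_mul (by rwa [mul_comm])
  have hR := I.n_add_len_le
  have hadj : (3 + (I.sched.a τ : ℤ) * I.n + I.sched.b τ).toNat
      = 3 + I.sched.a τ * I.n + I.sched.b τ := by exact_mod_cast Int.toNat_natCast _
  have h1 := eval_sumTo (x := x) (T := T) (R := I.R) (env := (τ : ℤ) :: env)
    (b := bagOf (.var 1)) (e := bothIn (.var 0) (fstOf (.var 1)) (sndOf (.var 1)))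
    (f := fun β => if I.both β (I.sched.a τ) (I.sched.b τ) then 1 else 0)
    (N := τ / (I.n * I.n)) (by omega)
    (fun i _ => eval_bagOf h rfl) (fun i hi => eval_bothIn h rfl (eval_fstOf h rfl)
      (eval_sndOf h rfl) (hi.trans hβ) hA hB)
  obtain ⟨F, hF⟩ : ∃ F : Bool,
      F = decide (∀ β < τ / (I.n * I.n), ¬ I.both β (I.sched.a τ) (I.sched.b τ)) := ⟨_, rfl⟩
  have h2 : (0 : ℤ) < ∑ β ∈ Finset.range (τ / (I.n * I.n)),
      (if I.both β (I.sched.a τ) (I.sched.b τ) then 1 else 0) ↔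
      ¬ F := by
    rw [hF, decide_eq_true_eq, Finset.sum_pos_iff_of_nonneg (fun i _ => by split <;> simp)]
    push Not
    refine exists_congr fun β => ?_
    rw [Finset.mem_range]
    refine and_congr_right fun _ => ?_
    split <;> simp_all
  have hl : I.sched.live τ = (decide (τ < I.len * (I.n * I.n)) &&
      (decide (I.sched.a τ < I.sched.b τ) && (I.adj (I.sched.a τ) (I.sched.b τ) &&
      (I.both (τ / (I.n * I.n)) (I.sched.a τ) (I.sched.b τ) &&
      F)))) := by rw [hF]; rfl
  rw [hl]
  simp only [live, eval_ifLt, eval_mul, eval_zero, eval_one, eval_inp, eval_add, eval_ofNat, h1,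
    eval_numV h, eval_fstOf h (eval_var_zero (τ : ℤ)), eval_sndOf h (eval_var_zero (τ : ℤ)),
    eval_bothIn h (eval_bagOf h (eval_var_zero (τ : ℤ))) (eval_fstOf h (eval_var_zero (τ : ℤ)))
      (eval_sndOf h (eval_var_zero (τ : ℤ))) hβ hA hB, hadj, h.adj_eq _ hA _ hB, h2, Nat.cast_lt,
    decide_eq_true hτ', Bool.true_and]
  by_cases c1 : I.sched.a τ < I.sched.b τ <;>
  by_cases c2 : I.adj (I.sched.a τ) (I.sched.b τ) <;>
  by_cases c3 : I.both (τ / (I.n * I.n)) (I.sched.a τ) (I.sched.b τ) <;>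
  cases F <;> simp [c1, c2, c3]

theorem H_le_R : I.sched.H ≤ I.R := by have := I.two_mul_H_add_two_le; omega

theorem eval_cnt (h : I.IsInput x) {τ w : ℕ} (hτ : τ ≤ I.sched.H) :
    cnt.eval x T I.R ((τ : ℤ) :: (w : ℤ) :: env) = I.sched.cnt w τ := by
  unfold cnt
  rw [eval_sumTo (N := τ) (f := fun i => ((if I.sched.live i then
    (if I.sched.a i = w then 1 else 0) + (if I.sched.b i = w then 1 else 0) else 0 : ℕ) : ℤ))
    (hτ.trans H_le_R) (fun i _ => rfl) (fun i hi => ?_)]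
  · simp [Schedule.cnt]
  · simp only [eval_mul, eval_live h (hi.trans_le hτ), eval_add, eval_ifEq, eval_one, eval_zero,
      eval_fstOf h (eval_var_zero (i : ℤ)), eval_sndOf h (eval_var_zero (i : ℤ)), eval_var_succ,
      eval_var_zero, Nat.cast_inj]
    split <;> simp

theorem eval_deg (h : I.IsInput x) {w : ℕ} :
    deg.eval x T I.R ((w : ℤ) :: env) = I.sched.deg w := by
  rw [deg, eval_bind, eval_horizon h, eval_cnt h le_rfl]
  rfl

theorem eval_cap (h : I.IsInput x) {τ w : ℕ} (hτ : τ ≤ I.sched.H) :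
    cap.eval x T I.R ((τ : ℤ) :: (w : ℤ) :: env) = I.sched.cap τ w := by
  have hle : I.sched.cnt w τ ≤ I.sched.deg w := Schedule.cnt_mono w hτ
  simp only [cap, eval_ifLt, eval_mul, eval_ofNat, eval_cnt h hτ, eval_bind, eval_sub,
    eval_var_succ, eval_var_zero, eval_deg h, Schedule.cap]
  split <;> split <;> omega

/-- The random number of the vertex `w`, made from the bits `c`. -/
def _root_.numberOfBits (K : ℕ) (c : ℕ → ℤ) (w : ℕ) : ℤ :=
  ∑ b ∈ Finset.range K, c (w * K + b) * 2 ^ b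

theorem eval_rand (h : I.IsInput x) {c : ℕ → ℤ} (hc : ∀ j : ℕ, T (2 * j) = c j) {w : ℕ} :
    rand.eval x T I.R ((w : ℤ) :: env) = numberOfBits I.R c w := by
  refine eval_sumTo le_rfl (fun i _ => eval_bound h) (fun i hi => ?_)
  rw [eval_mul, eval_prodTo (N := i) (f := fun _ => 2) hi.le (fun _ _ => rfl) (fun _ _ => rfl)]
  simp only [eval_tab, eval_mul, eval_ofNat, eval_add, eval_var_succ, eval_var_zero, eval_bound h,
    Finset.prod_const, Finset.card_range, ← hc]
  push_cast
  rfl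

theorem eval_pow {R k : ℕ} (hk : k ≤ R) (z : ℤ) :
    pow.eval x T R (z :: (k : ℤ) :: env) = z ^ k := by
  rw [pow, eval_prodTo (N := k) (f := fun _ => z) hk (fun _ _ => rfl) (fun _ _ => rfl)]
  simp

theorem eval_moment (h : I.IsInput x) (hq : I.q ≤ I.n) {c : ℕ → ℤ} (hc : ∀ j : ℕ, T (2 * j) = c j)
    {w k : ℕ} (hk : k ≤ I.R) : moment.eval x T I.R ((w : ℤ) :: (k : ℤ) :: env)
      = _root_.moment I.q (numberOfBits I.R c w) k := by
  have hR := I.n_add_len_le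
  refine eval_sumTo (by omega) (fun i _ => eval_numQ h) (fun i hi => ?_)
  simp only [eval_mul, eval_bind, eval_var_succ, eval_var_zero, eval_rand h hc]
  rw [eval_pow (by omega), eval_pow hk]

theorem cap_lt_R (I : ColoringInput) (τ w : ℕ) : 2 * I.sched.cap τ w + 2 ≤ I.R := by
  have h1 := I.two_mul_H_add_two_le
  have h2 := I.sched.cap_le_half τ w
  have h3 : I.sched.deg w ≤ 2 * I.sched.H := by
    have : I.sched.deg w ≤ (Finset.range I.sched.H).card • 2 := by
      unfold Schedule.deg Schedule.cnt
      exact Finset.sum_le_card_nsmul _ _ 2 fun i _ => by split_ifs <;> simp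
    rw [Finset.card_range, smul_eq_mul] at this
    omega
  omega

theorem eval_place (h : I.IsInput x) {τ w : ℕ} (hτ : τ ≤ I.sched.H) (hw : w ≤ I.n) :
    place.eval x T I.R ((τ : ℤ) :: (w : ℤ) :: env)
      = placeValue (fun w => I.sched.cap τ w + 1) w := by
  have hR := I.n_add_len_le
  rw [place, eval_prodTo (N := w) (f := fun i => ((I.sched.cap τ i + 1 : ℕ) : ℤ)) (by omega)
    (fun _ _ => rfl) (fun i hi => ?_)]
  · simp [placeValue]
  · simp only [eval_add, eval_bind, eval_var_succ, eval_var_zero, eval_cap h hτ, eval_one]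
    push_cast
    rfl

theorem eval_numStates (h : I.IsInput x) {τ : ℕ} (hτ : τ ≤ I.sched.H) :
    numStates.eval x T I.R ((τ : ℤ) :: env) = I.numStates τ := by
  simp only [numStates, eval_bind, eval_var_succ, eval_var_zero, eval_numV h,
    eval_place h hτ le_rfl]
  rfl

theorem eval_digit (h : I.IsInput x) {τ w s : ℕ} (hτ : τ ≤ I.sched.H) (hw : w ≤ I.n) :
    digit.eval x T I.R ((τ : ℤ) :: (w : ℤ) :: (s : ℤ) :: env) = I.state τ s w := by
  refine eval_mod (i := s / placeValue (fun w => I.sched.cap τ w + 1) w)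
    (j := I.sched.cap τ w + 1) ?_ ?_
  · simp only [eval_div, eval_var_succ, eval_var_zero, eval_place h hτ hw]
    push_cast
    rfl
  · simp only [eval_add, eval_cap h hτ, eval_one]
    push_cast
    rfl

theorem eval_trans (h : I.IsInput x) (hq : I.q ≤ I.n) {c : ℕ → ℤ}
    (hc : ∀ j : ℕ, T (2 * j) = c j) {τ w y z δ : ℕ} (hτ : τ ≤ I.sched.H) {d : Term}
    (hd : ∀ env, d.eval x T I.R env = δ) (hk : y + δ + z ≤ I.R) :
    (trans d).eval x T I.R ((τ : ℤ) :: (w : ℤ) :: (y : ℤ) :: (z : ℤ) :: env)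
      = I.sched.trans (fun w => _root_.moment I.q (numberOfBits I.R c w)) τ w y δ z := by
  have e : ((y : ℤ) + δ + z) = ((y + δ + z : ℕ) : ℤ) := by push_cast; rfl
  simp only [trans, eval_ifLt, eval_ifEq, eval_mul, eval_ofNat, eval_add, eval_one, eval_zero,
    eval_cnt h hτ, eval_bind, eval_var_succ, eval_var_zero, eval_deg h, hd, e,
    eval_moment h hq hc hk, Schedule.trans]
  norm_cast

theorem eval_index (h : I.IsInput x) {τ s y z : ℕ} (hτ : τ < I.sched.H) :
    index.eval x T I.R ((τ : ℤ) :: (s : ℤ) :: (y : ℤ) :: (z : ℤ) :: env)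
      = ofMixedDigits (fun w => I.sched.cap τ w + 1)
        (Function.update (Function.update (I.state (τ + 1) s) (I.sched.a τ) y) (I.sched.b τ) z)
        I.n := by
  have hR := I.n_add_len_le
  have e : ((τ : ℤ) + 1) = ((τ + 1 : ℕ) : ℤ) := by push_cast; rfl
  rw [index, eval_sumTo (N := I.n) (f := fun w => ((Function.update (Function.update
    (I.state (τ + 1) s) (I.sched.a τ) y) (I.sched.b τ) z w *
    placeValue (fun w => I.sched.cap τ w + 1) w : ℕ) : ℤ)) (by omega) (fun _ _ => eval_numV h)
    (fun w hw => ?_)]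
  · simp [ofMixedDigits]
  · simp only [eval_mul, eval_ifEq, eval_bind, eval_add, eval_one, eval_var_succ, eval_var_zero,
      eval_fstOf h (show (Term.var 1).eval x T I.R (_ :: (τ : ℤ) :: _) = τ from rfl),
      eval_sndOf h (show (Term.var 1).eval x T I.R (_ :: (τ : ℤ) :: _) = τ from rfl), e,
      eval_digit h (Nat.succ_le_of_lt hτ) hw.le, eval_place h hτ.le hw.le, Function.update_apply]
    norm_cast

theorem eval_slot (h : I.IsInput x) {R : ℕ} {a b : Term} {s τ : ℕ} (ha : a.eval x T R env = s)
    (hb : b.eval x T R env = τ) :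
    (slot a b).eval x T R env = 2 * ((s * I.R + τ : ℕ) : ℤ) + 1 := by
  simp [slot, ha, hb, eval_bound h]

theorem eval_step (h : I.IsInput x) (hq : I.q ≤ I.n) {c : ℕ → ℤ}
    (hc : ∀ j : ℕ, T (2 * j) = c j) {τ s : ℕ} (hτ : τ < I.sched.H)
    (hT : ∀ k < I.numStates τ, T (2 * ((k * I.R + τ : ℕ) : ℤ) + 1)
      = I.sched.val (fun w => _root_.moment I.q (numberOfBits I.R c w)) τ (I.state τ k))
    (hs : s < I.numStates (τ + 1)) :
    step.eval x T I.R ((s : ℤ) :: (τ : ℤ) :: env)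
      = I.sched.val (fun w => _root_.moment I.q (numberOfBits I.R c w)) (τ + 1)
        (I.state (τ + 1) s) := by
  have hlive : (Term.bind (.var 1) live).eval x T I.R ((s : ℤ) :: (τ : ℤ) :: env)
      = if I.sched.live τ then 1 else 0 := eval_live h hτ
  rw [step, Term.eval, hlive]
  by_cases hl : I.sched.live τ
  · rw [if_pos hl, if_pos one_pos, Schedule.val_succ_of_live _ hl hτ fun w _ => I.state_le _ _ _]
    have ha : I.sched.a τ < I.n := I.sched.a_lt τ hl
    have hb : I.sched.b τ < I.n := I.sched.b_lt τ hl
    have hab := I.sched.ne τ hl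
    have e : ((τ : ℤ) + 1) = ((τ + 1 : ℕ) : ℤ) := by push_cast; rfl
    refine eval_sumTo (by have := cap_lt_R I τ (I.sched.a τ); omega) (fun i _ => ?_)
      (fun y hy => eval_sumTo (by have := cap_lt_R I τ (I.sched.b τ); omega)
        (fun i _ => ?_) (fun z hz => ?_))
    · simp only [eval_add, eval_bind, eval_one, eval_var_succ, eval_var_zero,
        eval_fstOf h (show (Term.var 2).eval x T I.R (_ :: _ :: (τ : ℤ) :: _) = τ from rfl),
        eval_cap h hτ.le]
      push_cast
      rfl
    · simp only [eval_add, eval_bind, eval_one, eval_var_succ, eval_var_zero,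
        eval_sndOf h (show (Term.var 3).eval x T I.R (_ :: _ :: _ :: (τ : ℤ) :: _) = τ from rfl),
        eval_cap h hτ.le]
      push_cast
      rfl
    · have hsum : ∀ w k δ, k < I.sched.cap τ w + 1 → δ ≤ 1 →
          k + δ + I.state (τ + 1) s w ≤ I.R := fun w k δ hk hδ => by
        have h1 := I.state_le (τ + 1) s w
        have h2 := cap_lt_R I τ w
        have h3 := cap_lt_R I (τ + 1) w
        omega
      have hF : ∀ (d : Term) (δ : ℕ), (∀ env, d.eval x T I.R env = δ) → δ ≤ 1 →
          (step.trF d).eval x T I.R ((z : ℤ) :: (y : ℤ) :: (s : ℤ) :: (τ : ℤ) :: env)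
          = I.sched.trans (fun w => _root_.moment I.q (numberOfBits I.R c w)) τ (I.sched.a τ) y δ
            (I.state (τ + 1) s (I.sched.a τ)) := by
        intro d δ hd hδ
        simp only [step.trF, eval_bind, eval_add, eval_one, eval_var_succ, eval_var_zero,
          eval_fstOf h (show (Term.var 4).eval x T I.R (_ :: _ :: _ :: _ :: (τ : ℤ) :: _) = τ
            from rfl),
          eval_fstOf h (show (Term.var 5).eval x T I.R (_ :: _ :: _ :: _ :: _ :: (τ : ℤ) :: _) = τ
            from rfl), e, eval_digit h (Nat.succ_le_of_lt hτ) ha.le]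
        exact eval_trans h hq hc hτ.le hd (hsum _ _ _ hy hδ)
      have hS : ∀ (d : Term) (δ : ℕ), (∀ env, d.eval x T I.R env = δ) → δ ≤ 1 →
          (step.trS d).eval x T I.R ((z : ℤ) :: (y : ℤ) :: (s : ℤ) :: (τ : ℤ) :: env)
          = I.sched.trans (fun w => _root_.moment I.q (numberOfBits I.R c w)) τ (I.sched.b τ) z δ
            (I.state (τ + 1) s (I.sched.b τ)) := by
        intro d δ hd hδ
        simp only [step.trS, eval_bind, eval_add, eval_one, eval_var_succ, eval_var_zero,
          eval_sndOf h (show (Term.var 4).eval x T I.R (_ :: _ :: _ :: _ :: (τ : ℤ) :: _) = τ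
            from rfl),
          eval_sndOf h (show (Term.var 5).eval x T I.R (_ :: _ :: _ :: _ :: _ :: (τ : ℤ) :: _) = τ
            from rfl), e, eval_digit h (Nat.succ_le_of_lt hτ) hb.le]
        exact eval_trans h hq hc hτ.le hd (hsum _ _ _ hz hδ)
      have h0 : ∀ env, (0 : Term).eval x T I.R env = (0 : ℕ) := fun _ => rfl
      have h1 : ∀ env, (1 : Term).eval x T I.R env = (1 : ℕ) := fun _ => rfl
      set κ := Function.update (Function.update (I.state (τ + 1) s) (I.sched.a τ) y)
        (I.sched.b τ) z with hκ
      have hκle : ∀ w < I.n, κ w < I.sched.cap τ w + 1 := by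
        intro w _
        by_cases hwb : w = I.sched.b τ
        · rw [hκ, hwb, Function.update_self]
          exact hz
        · by_cases hwa : w = I.sched.a τ
          · rw [hκ, Function.update_of_ne hwb, hwa, Function.update_self]
            exact hy
          · rw [hκ, Function.update_of_ne hwb, Function.update_of_ne hwa]
            have h1 := I.state_le (τ + 1) s w
            have h2 : I.sched.cap (τ + 1) w = I.sched.cap τ w := by
              unfold Schedule.cap
              rw [Schedule.cnt_succ_of_ne hwa hwb]
            omega
      rw [eval_mul, eval_sub, eval_mul, eval_mul, hF 1 1 h1 le_rfl, hF 0 0 h0 zero_le_one,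
        hS 1 1 h1 le_rfl, hS 0 0 h0 zero_le_one, eval_tab,
        eval_slot h (s := ofMixedDigits (fun w => I.sched.cap τ w + 1) κ I.n) (τ := τ)
          (by simp only [eval_bind, eval_var_succ, eval_var_zero]; exact eval_index h hτ) rfl,
        hT _ (ofMixedDigits_lt hκle)]
      congr 1
      exact Schedule.val_congr _ _ fun w hw => mixedDigit_ofMixedDigits hκle hw
  · rw [if_neg hl, if_neg (lt_irrefl _), eval_tab, eval_slot h rfl rfl,
      Schedule.val_succ_of_not_live _ hl]
    have hcap : I.sched.cap (τ + 1) = I.sched.cap τ := by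
      funext w
      unfold Schedule.cap
      rw [Schedule.cnt_succ_of_not_live hl]
    have h1 : I.numStates (τ + 1) = I.numStates τ := by simp only [ColoringInput.numStates, hcap]
    have h2 : I.state (τ + 1) s = I.state τ s := by
      funext w; simp only [ColoringInput.state, hcap]
    rw [h2]
    exact hT s (h1 ▸ hs)

theorem eval_start (h : I.IsInput x) (hq : I.q ≤ I.n) {c : ℕ → ℤ}
    (hc : ∀ j : ℕ, T (2 * j) = c j) : start.eval x T I.R env
      = I.sched.val (fun w => _root_.moment I.q (numberOfBits I.R c w)) 0 (I.state 0 0) := by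
  have hR := I.n_add_len_le
  rw [Schedule.val_zero _ fun w _ => by simp [ColoringInput.state, mixedDigit]]
  refine eval_prodTo (show I.n ≤ _ by omega) (fun _ _ => eval_numV h) (fun w hw => ?_)
  have := eval_moment (T := T) (env := (w : ℤ) :: env) h hq hc (w := w) (Nat.zero_le I.R)
  rw [Nat.cast_zero] at this
  simp only [eval_ifLt, eval_zero, eval_deg h, eval_one, eval_bind, eval_var_succ, eval_var_zero,
    this, Nat.cast_pos]

theorem eval_answer (h : I.IsInput x) : answer.eval x T I.R env
    = if T (2 * ((0 * I.R + I.sched.H : ℕ) : ℤ) + 1) ≠ 0 then 1 else 0 := by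
  simp only [answer, eval_ifLt, eval_mul, eval_tab, eval_zero, eval_one,
    eval_slot h (a := 0) (s := 0) (τ := I.sched.H) Nat.cast_zero.symm (eval_horizon h), mul_self_pos]

end Correct

end Term

/-! ### The instance of a graph with a path decomposition -/

section Graph

variable {n : ℕ} (G : SimpleGraph (Fin n)) [DecidableRel G.Adj] (P : PathDecomposition G) (q : ℕ)

/-- The instance given by a graph, a path decomposition and a number of colors. -/
def ColoringInput.ofGraph : ColoringInput where
  n := n
  len := P.len
  q := q
  adj u v := if h : u < n ∧ v < n then decide (G.Adj ⟨u, h.1⟩ ⟨v, h.2⟩) else false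
  bag β v := if h : β < P.len ∧ v < n then decide (⟨v, h.2⟩ ∈ P.bag ⟨β, h.1⟩) else false

open ColoringInput

theorem adj_ofGraph (u v : Fin n) : (ofGraph G P q).adj u v = decide (G.Adj u v) := by
  simp [ofGraph]

theorem bag_ofGraph {β v : ℕ} : (ofGraph G P q).bag β v = true ↔
    ∃ (h : β < P.len) (h' : v < n), (⟨v, h'⟩ : Fin n) ∈ P.bag ⟨β, h⟩ := by
  simp only [ofGraph]
  split
  · next h => simp [h.1, h.2]
  · next h =>
    simp only [Bool.false_eq_true, false_iff]
    rintro ⟨h1, h2, -⟩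
    exact h ⟨h1, h2⟩

theorem live_iff {I : ColoringInput} {τ : ℕ} : I.sched.live τ = true ↔ τ < I.sched.H ∧
    I.sched.a τ < I.sched.b τ ∧ I.adj (I.sched.a τ) (I.sched.b τ) = true ∧
    I.both (τ / (I.n * I.n)) (I.sched.a τ) (I.sched.b τ) = true ∧
    ∀ β < τ / (I.n * I.n), ¬ I.both β (I.sched.a τ) (I.sched.b τ) = true := by
  simp only [ColoringInput.sched, Bool.and_eq_true, decide_eq_true_eq]

theorem time_eq (I : ColoringInput) (τ : ℕ) :
    τ = τ / (I.n * I.n) * (I.n * I.n) + I.sched.a τ * I.n + I.sched.b τ := by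
  have h1 : I.sched.a τ = τ / I.n % I.n := rfl
  have h2 : I.sched.b τ = τ % I.n := rfl
  rw [h1, h2, ← Nat.div_div_eq_div_mul, ← mul_assoc, ← add_mul, Nat.div_add_mod', Nat.div_add_mod']

/-- Every edge has only one time. -/
theorem live_injective {I : ColoringInput} {i j : ℕ} (hi : I.sched.live i) (hj : I.sched.live j)
    (ha : I.sched.a i = I.sched.a j) (hb : I.sched.b i = I.sched.b j) : i = j := by
  rw [live_iff] at hi hj
  have key : i / (I.n * I.n) = j / (I.n * I.n) := by
    rcases lt_trichotomy (i / (I.n * I.n)) (j / (I.n * I.n)) with h | h | h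
    · exact absurd (ha ▸ hb ▸ hi.2.2.2.1) (hj.2.2.2.2 _ h)
    · exact h
    · exact absurd (ha ▸ hb ▸ hj.2.2.2.1) (hi.2.2.2.2 _ h)
  rw [time_eq I i, time_eq I j, key, ha, hb]

theorem adj_of_live {i : ℕ} (hi : (ofGraph G P q).sched.live i) :
    G.Adj ⟨(ofGraph G P q).sched.a i, Schedule.a_lt _ i hi⟩
      ⟨(ofGraph G P q).sched.b i, Schedule.b_lt _ i hi⟩ := by
  have := (live_iff.1 hi).2.2.1
  have h := adj_ofGraph G P q ⟨(ofGraph G P q).sched.a i, Schedule.a_lt _ i hi⟩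
      ⟨(ofGraph G P q).sched.b i, Schedule.b_lt _ i hi⟩
  rw [h] at this
  simpa using this

/-- Every edge is processed at some time. -/
theorem exists_live {u v : Fin n} (h : G.Adj u v) (huv : u < v) :
    ∃ i < (ofGraph G P q).sched.H, (ofGraph G P q).sched.live i ∧
      (ofGraph G P q).sched.a i = u ∧ (ofGraph G P q).sched.b i = v := by
  set I := ofGraph G P q with hI
  have hn : 0 < n := u.pos
  have hex : ∃ β, I.both β u v = true := by
    obtain ⟨i, hu, hv⟩ := P.edge_mem u v h
    refine ⟨i, ?_⟩
    simp only [both, Bool.and_eq_true, hI, bag_ofGraph]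
    exact ⟨⟨i.2, u.2, hu⟩, ⟨i.2, v.2, hv⟩⟩
  classical
  obtain ⟨β, hβ, hmin⟩ : ∃ β, I.both β u v = true ∧ ∀ β' < β, ¬ I.both β' u v = true :=
    ⟨Nat.find hex, Nat.find_spec hex, fun β' h => Nat.find_min hex h⟩
  have hlt : β < P.len := by
    simp only [both, Bool.and_eq_true, hI, bag_ofGraph] at hβ
    exact hβ.1.1
  have e1 : (β * (n * n) + u * n + v) / (n * n) = β := by
    have : (u : ℕ) * n + v < n * n := calc
      (u : ℕ) * n + v < (u + 1) * n := by rw [add_mul, one_mul]; omega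
      _ ≤ n * n := Nat.mul_le_mul_right _ u.2
    rw [add_assoc, mul_comm, Nat.mul_add_div (by positivity), Nat.div_eq_of_lt this, add_zero]
  have e2 : (β * (n * n) + u * n + v) / n % n = u := by
    rw [show β * (n * n) + u * n + v = n * (β * n + u) + v by ring, Nat.mul_add_div hn,
      Nat.div_eq_of_lt v.2, add_zero, mul_comm β n, Nat.mul_add_mod,
      Nat.mod_eq_of_lt u.2]
  have e3 : (β * (n * n) + u * n + v) % n = v := by
    rw [show β * (n * n) + u * n + v = n * (β * n + u) + v by ring, Nat.mul_add_mod,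
      Nat.mod_eq_of_lt v.2]
  have hH : β * (n * n) + u * n + v < P.len * (n * n) := by
    rw [← Nat.div_lt_iff_lt_mul (by positivity), e1]
    exact hlt
  have ha : I.sched.a (β * (n * n) + u * n + v) = u := e2
  have hb : I.sched.b (β * (n * n) + u * n + v) = v := e3
  have hc : (β * (n * n) + u * n + v) / (I.n * I.n) = β := e1
  refine ⟨β * (n * n) + u * n + v, hH, live_iff.2 ⟨hH, ?_⟩, ha, hb⟩
  rw [ha, hb, hc, hI, adj_ofGraph]
  exact ⟨huv, by simpa using h, hβ, hmin⟩

/-- The graph polynomial does not vanish exactly at the proper colorings. -/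
theorem graphPolynomial_ne_zero_iff (x : Fin n → ℕ) :
    (∏ i ∈ Finset.range (ofGraph G P q).sched.H, if (ofGraph G P q).sched.live i then
      extendColoring x ((ofGraph G P q).sched.a i) - extendColoring x ((ofGraph G P q).sched.b i)
      else 1) ≠ 0 ↔ ∀ u v, G.Adj u v → x u ≠ x v := by
  have hext : ∀ u : Fin n, extendColoring x u = x u := fun u => by simp [extendColoring]
  rw [Finset.prod_ne_zero_iff]
  constructor
  · intro h
    have key : ∀ u v : Fin n, u < v → G.Adj u v → x u ≠ x v := by
      intro u v huv hadj hx
      obtain ⟨i, hi, hl, ha, hb⟩ := exists_live G P q hadj huv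
      have := h i (Finset.mem_range.2 hi)
      rw [if_pos hl, ha, hb, hext, hext, hx] at this
      exact this (sub_self _)
    intro u v hadj
    rcases lt_trichotomy u v with h' | h' | h'
    · exact key u v h' hadj
    · exact absurd h' hadj.ne
    · exact (key v u h' hadj.symm).symm
  · intro h i _
    split
    · next hl =>
      have h1 := h _ _ (adj_of_live G P q hl)
      rw [sub_ne_zero]
      have e1 := hext ⟨(ofGraph G P q).sched.a i, Schedule.a_lt _ i hl⟩
      have e2 := hext ⟨(ofGraph G P q).sched.b i, Schedule.b_lt _ i hl⟩
      simp only at e1 e2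
      rw [e1, e2]
      exact_mod_cast h1
    · exact one_ne_zero

theorem deg_le_maxDegree (w : Fin n) : (ofGraph G P q).sched.deg w ≤ G.maxDegree := by
  set S := (ofGraph G P q).sched with hS
  have h1 : S.deg w = ((Finset.range S.H).filter fun i =>
      S.live i ∧ (S.a i = w ∨ S.b i = w)).card := by
    rw [Finset.card_filter]
    unfold Schedule.deg Schedule.cnt
    refine Finset.sum_congr rfl fun i _ => ?_
    by_cases hl : S.live i
    · have hne := S.ne i hl
      by_cases ha : S.a i = w
      · have hb : S.b i ≠ w := fun h => hne (ha.trans h.symm)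
        simp [hl, ha, hb]
      · simp [hl, ha]
    · simp [hl]
  rw [h1]
  refine le_trans ?_ (G.degree_le_maxDegree w)
  rw [← G.card_neighborFinset_eq_degree]
  let f : ℕ → Fin n := fun i => if h : S.live i then
    (if S.a i = w then ⟨S.b i, S.b_lt i h⟩ else ⟨S.a i, S.a_lt i h⟩) else w
  refine Finset.card_le_card_of_injOn f ?_ ?_
  · intro i hi
    obtain ⟨-, hl, hw⟩ := Finset.mem_filter.1 hi
    have hadj := adj_of_live G P q hl
    simp only [Finset.mem_coe, SimpleGraph.mem_neighborFinset, f, dif_pos hl]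
    split
    · next ha =>
      have : w = ⟨S.a i, S.a_lt i hl⟩ := Fin.ext ha.symm
      rw [this]
      exact hadj
    · next ha =>
      have : w = ⟨S.b i, S.b_lt i hl⟩ := Fin.ext (hw.resolve_left ha).symm
      rw [this]
      exact hadj.symm
  · intro i hi j hj hij
    obtain ⟨-, hl, hw⟩ := Finset.mem_filter.1 hi
    obtain ⟨-, hl', hw'⟩ := Finset.mem_filter.1 hj
    simp only [f, dif_pos hl, dif_pos hl'] at hij
    have hlt : S.a i < S.b i := (live_iff.1 hl).2.1
    have hlt' : S.a j < S.b j := (live_iff.1 hl').2.1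
    have : S.a i = S.a j ∧ S.b i = S.b j := by
      split_ifs at hij <;> (have hval := congrArg Fin.val hij; simp only at hval; omega)
    exact live_injective hl hl' this.1 this.2

theorem exists_live_of_cnt_lt {S : Schedule} {w τ τ' : ℕ} (h : S.cnt w τ < S.cnt w τ') :
    ∃ i, τ ≤ i ∧ i < τ' ∧ S.live i ∧ (S.a i = w ∨ S.b i = w) := by
  by_contra! hc
  refine absurd h (not_lt.2 ?_)
  unfold Schedule.cnt
  rcases le_total τ' τ with h' | h'
  · exact Finset.sum_le_sum_of_subset (Finset.range_mono h')
  rw [← Finset.sum_subset (Finset.range_mono h')]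
  intro i hi hi'
  rw [Finset.mem_range] at hi hi'
  split
  · next hl =>
    obtain ⟨h1, h2⟩ := hc i (by omega) hi hl
    rw [if_neg h1, if_neg h2, add_zero]
  · rfl

theorem mem_bag_of_live {w : Fin n} {i : ℕ} (hl : (ofGraph G P q).sched.live i)
    (hw : (ofGraph G P q).sched.a i = w ∨ (ofGraph G P q).sched.b i = w) :
    ∃ h : i / (n * n) < P.len, w ∈ P.bag ⟨i / (n * n), h⟩ := by
  have := (live_iff.1 hl).2.2.2.1
  simp only [both, Bool.and_eq_true] at this
  have h : (ofGraph G P q).bag (i / (n * n)) w = true := by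
    rcases hw with hw | hw
    · rw [← hw]; exact this.1
    · rw [← hw]; exact this.2
  obtain ⟨h1, _, h3⟩ := (bag_ofGraph G P q).1 h
  exact ⟨h1, h3⟩

/-- Only the vertices of the current bag have a nontrivial component, and it takes at most
`d / 2 + 1` values. -/
theorem numStates_le (τ : ℕ) :
    (ofGraph G P q).numStates τ ≤ (G.maxDegree / 2 + 1) ^ (P.width + 1) := by
  set S := (ofGraph G P q).sched with hS
  let s : Finset (Fin n) := if h : τ / (n * n) < P.len then P.bag ⟨τ / (n * n), h⟩ else ∅
  have hs : s.card ≤ P.width + 1 := by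
    simp only [s]
    split
    · next h =>
      have : (P.bag ⟨τ / (n * n), h⟩).card ≤ Finset.univ.sup fun i => (P.bag i).card :=
        Finset.le_sup (f := fun i => (P.bag i).card) (Finset.mem_univ _)
      unfold PathDecomposition.width
      omega
    · simp
  have hcap : ∀ w : Fin n, w ∉ s → S.cap τ w = 0 := by
    intro w hw
    by_contra h0
    have h1 : S.cnt w 0 < S.cnt w τ ∧ S.cnt w τ < S.cnt w S.H := by
      have : S.cnt w 0 = 0 := rfl
      have h' : S.deg w = S.cnt w S.H := rfl
      unfold Schedule.cap at h0
      split at h0 <;> omega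
    obtain ⟨i, -, hi, hl, hiw⟩ := exists_live_of_cnt_lt h1.1
    obtain ⟨j, hj, -, hl', hjw⟩ := exists_live_of_cnt_lt h1.2
    obtain ⟨hi1, hi2⟩ := mem_bag_of_live G P q hl hiw
    obtain ⟨hj1, hj2⟩ := mem_bag_of_live G P q hl' hjw
    have hle : τ / (n * n) ≤ j / (n * n) := Nat.div_le_div_right hj
    refine hw ?_
    simp only [s, dif_pos (hle.trans_lt hj1)]
    exact P.between _ _ _ (Nat.div_le_div_right hi.le) hle w hi2 hj2
  have h2 : (ofGraph G P q).numStates τ = ∏ w : Fin n, (S.cap τ w + 1) :=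
    Finset.prod_range _
  rw [h2]
  calc ∏ w : Fin n, (S.cap τ w + 1)
      ≤ ∏ w : Fin n, if w ∈ s then (G.maxDegree / 2 + 1) else 1 := by
        refine Finset.prod_le_prod' fun w _ => ?_
        split
        · have h3 := S.cap_le_half τ w
          have h4 : S.deg w ≤ G.maxDegree := deg_le_maxDegree G P q w
          have := Nat.div_le_div_right (c := 2) h4
          omega
        · next h => rw [hcap w h]
    _ = (G.maxDegree / 2 + 1) ^ s.card := by
        rw [Finset.prod_ite_mem, Finset.univ_inter, Finset.prod_const]
    _ ≤ _ := Nat.pow_le_pow_right (Nat.succ_pos _) hs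

/-! ### The encoding of the instance -/

/-- The input words of the machine. -/
def inputWords (i : ℕ) : ℤ := ((encodeInstance G P q).getD i 0 : ℕ)

theorem isInput_ofGraph : (ofGraph G P q).IsInput (inputWords G P q) where
  n_eq := rfl
  q_eq := rfl
  len_eq := rfl
  adj_eq u hu v hv := by
    have hu' : u < n := hu
    have hv' : v < n := hv
    have hk : u * n + v < n * n := calc
      u * n + v < (u + 1) * n := by rw [add_mul, one_mul]; omega
      _ ≤ n * n := Nat.mul_le_mul_right _ hu'
    have hn : 0 < n := by omega
    have e1 : (u * n + v) / n = u := by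
      rw [mul_comm, Nat.mul_add_div hn, Nat.div_eq_of_lt hv', add_zero]
    have e2 : (u * n + v) % n = v := by
      rw [mul_comm, Nat.mul_add_mod, Nat.mod_eq_of_lt hv']
    show inputWords G P q (3 + u * n + v) = _
    unfold inputWords encodeInstance
    rw [List.getD_append _ _ _ _ (by simp; omega), List.getD_append_right _ _ _ _ (by simp; omega)]
    have e3 : 3 + u * n + v - [n, q, P.len].length = u * n + v := by simp; omega
    rw [e3, List.getD_eq_getElem _ _ (by simpa using hk), List.getElem_ofFn]
    simp [ofGraph, hu', hv', Fin.divNat, Fin.modNat, e1, e2]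
  bag_eq β hβ v hv := by
    have hβ' : β < P.len := hβ
    have hv' : v < n := hv
    have hk : β * n + v < P.len * n := calc
      β * n + v < (β + 1) * n := by rw [add_mul, one_mul]; omega
      _ ≤ P.len * n := Nat.mul_le_mul_right _ hβ'
    have hn : 0 < n := by omega
    have e1 : (β * n + v) / n = β := by
      rw [mul_comm, Nat.mul_add_div hn, Nat.div_eq_of_lt hv', add_zero]
    have e2 : (β * n + v) % n = v := by
      rw [mul_comm, Nat.mul_add_mod, Nat.mod_eq_of_lt hv']
    show inputWords G P q (3 + n * n + β * n + v) = _
    unfold inputWords encodeInstance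
    rw [List.getD_append_right _ _ _ _ (by simp; omega)]
    have e3 : 3 + n * n + β * n + v - ([n, q, P.len] ++ List.ofFn fun k : Fin (n * n) =>
        if G.Adj k.divNat k.modNat then 1 else 0).length = β * n + v := by simp; omega
    rw [e3, List.getD_eq_getElem _ _ (by simpa using hk), List.getElem_ofFn]
    simp [ofGraph, hβ', hv', Fin.divNat, Fin.modNat, e1, e2]

theorem bitLen_inputWords_le (i : ℕ) :
    bitLen (inputWords G P q i) ≤ inputSize (encodeInstance G P q) := by
  unfold inputWords inputSize
  have hpos : 1 ≤ ((encodeInstance G P q).map fun a => a.size + 1).sum := by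
    simp [encodeInstance]
    omega
  by_cases h : i < (encodeInstance G P q).length
  · rw [List.getD_eq_getElem _ _ h]
    refine List.single_le_sum (fun _ _ => Nat.zero_le _) _ ?_
    exact List.mem_map.2 ⟨_, List.getElem_mem h, by simp [bitLen]⟩
  · rw [List.getD_eq_default _ _ (not_lt.1 h)]
    simpa [bitLen] using hpos

theorem le_inputSize : n * n + P.len * n + 3 ≤ inputSize (encodeInstance G P q) := by
  have : (encodeInstance G P q).length ≤ inputSize (encodeInstance G P q) := by
    unfold inputSize
    generalize encodeInstance G P q = w
    induction w with
    | nil => simp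
    | cons a w ih => simp only [List.length_cons, List.map_cons, List.sum_cons]; omega
  simp [encodeInstance] at this ⊢
  omega

theorem inputSize_le :
    inputSize (encodeInstance G P q) ≤ n + q + P.len + 2 * (n * n + P.len * n) + 3 := by
  have hsum : ∀ (m : ℕ) (p : Fin m → Prop) [DecidablePred p],
      ((List.ofFn fun k : Fin m => if p k then 1 else 0).map fun a : ℕ => a.size + 1).sum
        ≤ 2 * m := by
    intro m p _
    refine (List.sum_le_card_nsmul _ 2 ?_).trans (by simp [mul_comm])
    intro y hy
    obtain ⟨a, ha, rfl⟩ := List.mem_map.1 hy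
    obtain ⟨k, rfl⟩ := List.mem_ofFn.1 ha
    split <;> simp
  have h1 := hsum (n * n) fun k => G.Adj k.divNat k.modNat
  have h2 := hsum (P.len * n) fun k => k.modNat ∈ P.bag k.divNat
  have hsize : ∀ a : ℕ, a.size ≤ a := fun a => Nat.size_le.2 Nat.lt_two_pow_self
  have h3 := hsize n
  have h4 := hsize q
  have h5 := hsize P.len
  unfold inputSize encodeInstance
  rw [List.map_append, List.map_append, List.sum_append, List.sum_append]
  simp only [List.map_cons, List.map_nil, List.sum_cons, List.sum_nil]
  omega

end Graph

/-! ### Sizes of the numbers -/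

theorem bitLen_le_of_abs_le {z : ℤ} {k : ℕ} (h : |z| ≤ 2 ^ k) : bitLen z ≤ k + 2 := by
  rw [bitLen_le_iff]
  have h1 : z.natAbs ≤ 2 ^ k := by zify; exact_mod_cast h
  exact h1.trans_lt (Nat.pow_lt_pow_right (by norm_num) (Nat.lt_succ_self k))

theorem natCast_le_two_pow {a b : ℕ} (h : a ≤ b) : (a : ℤ) ≤ 2 ^ b := by
  have : a ≤ 2 ^ b := h.trans Nat.lt_two_pow_self.le
  exact_mod_cast this

theorem abs_moment_le {q k R : ℕ} {z : ℤ} (hq : q ≤ R) (hk : k ≤ R) (hz : |z| ≤ 2 ^ R) :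
    |moment q z k| ≤ 2 ^ (R + R * R + R * R) := by
  have key : ∀ c ∈ Finset.range q, |z ^ c * (c : ℤ) ^ k| ≤ 2 ^ (R * R) * 2 ^ (R * R) := by
    intro c hc
    have hc' : c ≤ R := (Finset.mem_range.1 hc).le.trans hq
    have hpow : ∀ (a : ℤ) (j : ℕ), 0 ≤ a → a ≤ 2 ^ R → j ≤ R → a ^ j ≤ 2 ^ (R * R) := by
      intro a j ha0 ha hj
      rw [pow_mul]
      exact (pow_le_pow_left₀ ha0 ha j).trans
        (pow_le_pow_right₀ (one_le_pow₀ (by norm_num)) hj)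
    rw [abs_mul, abs_pow, abs_pow]
    exact mul_le_mul (hpow _ _ (abs_nonneg _) hz hc')
      (hpow _ _ (abs_nonneg _) (by rw [Nat.abs_cast]; exact natCast_le_two_pow hc') hk)
      (by positivity) (by positivity)
  refine (Finset.abs_sum_le_sum_abs _ _).trans ((Finset.sum_le_card_nsmul _ _ _ key).trans ?_)
  rw [Finset.card_range, nsmul_eq_mul, pow_add, pow_add, mul_assoc]
  exact mul_le_mul_of_nonneg_right (natCast_le_two_pow hq) (by positivity)

/-- The outcomes of the first `K` coin flips, followed by zeros. -/
def coinBits (K : ℕ) (ω : ℕ → Bool) (j : ℕ) : ℤ := if j < K ∧ ω j then 1 else 0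

namespace ColoringInput

variable (I : ColoringInput)

/-- The value of a state for the random numbers made from the bits `c`. -/
abbrev value (c : ℕ → ℤ) (τ : ℕ) (κ : ℕ → ℕ) : ℤ :=
  I.sched.val (fun w => moment I.q (numberOfBits I.R c w)) τ κ

theorem numberOfBits_coinBits {w : ℕ} (hw : w < I.n) (ω : ℕ → Bool) :
    numberOfBits I.R (coinBits (I.R * I.R) ω) w = randomNumber I.R ω w := by
  refine Finset.sum_congr rfl fun b hb => ?_
  have hb' := Finset.mem_range.1 hb
  have hlt : w * I.R + b < I.R * I.R := calc
    w * I.R + b < (w + 1) * I.R := by rw [add_mul, one_mul]; omega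
    _ ≤ I.R * I.R := Nat.mul_le_mul_right _ (by have := I.n_add_len_le; omega)
  simp [coinBits, hlt]

theorem bitLen_value_le (hq : I.q ≤ I.n) (ω : ℕ → Bool) {τ : ℕ} (hτ : τ ≤ I.sched.H) (s : ℕ) :
    bitLen (I.value (coinBits (I.R * I.R) ω) τ (I.state τ s)) ≤ I.R ^ 4 := by
  have hR := I.n_add_len_le
  have hH := I.two_mul_H_add_two_le
  have h := Schedule.abs_val_le (S := I.sched) (κ := I.state τ s)
    (μ := fun w => moment I.q (numberOfBits I.R (coinBits (I.R * I.R) ω) w)) hτ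
    (fun w _ => I.state_le τ s w) (X := 2 ^ (I.R + I.R * I.R + I.R * I.R))
    (one_le_pow₀ (by norm_num)) (fun w hw k hk => by
      refine abs_moment_le (by omega) (hk.trans ?_) ?_
      · have : I.sched.deg w ≤ 2 * I.sched.H := by
          have : I.sched.deg w ≤ (Finset.range I.sched.H).card • 2 := by
            unfold Schedule.deg Schedule.cnt
            exact Finset.sum_le_card_nsmul _ _ 2 fun i _ => by split_ifs <;> simp
          rw [Finset.card_range, smul_eq_mul] at this
          omega
        omega
      · rw [I.numberOfBits_coinBits hw]
        obtain ⟨h1, h2⟩ := randomNumber_bounds I.R ω w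
        rw [abs_of_nonneg h1]
        exact h2.le)
  rw [← pow_mul, ← pow_add] at h
  refine (bitLen_le_of_abs_le h).trans ?_
  have hn : I.sched.n ≤ I.R := by show I.n ≤ I.R; omega
  calc τ + (I.R + I.R * I.R + I.R * I.R) * I.sched.n + 2
      ≤ I.R + (I.R + I.R * I.R + I.R * I.R) * I.R + 2 := by gcongr; omega
    _ ≤ I.R ^ 4 := by
      obtain ⟨r, hr⟩ : ∃ r, I.R = r + 7 := ⟨I.R - 7, by omega⟩
      rw [hr]
      ring_nf
      omega

theorem bitLen_numStates_le (τ : ℕ) : bitLen (I.numStates τ) ≤ I.R ^ 4 := by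
  have hR := I.n_add_len_le
  have h1 : I.numStates τ ≤ (2 ^ I.R) ^ I.n := by
    unfold ColoringInput.numStates placeValue
    refine (Finset.prod_le_pow_card _ _ (2 ^ I.R) fun w _ => ?_).trans (by simp)
    have := Term.cap_lt_R I τ w
    exact (by omega : I.sched.cap τ w + 1 ≤ I.R).trans Nat.lt_two_pow_self.le
  rw [← pow_mul] at h1
  refine (bitLen_le_of_abs_le (k := I.R * I.n) (by
    rw [Nat.abs_cast]; exact_mod_cast h1)).trans ?_
  calc I.R * I.n + 2 ≤ I.R * I.R + 2 := by gcongr; omega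
    _ ≤ I.R ^ 4 := by
      obtain ⟨r, hr⟩ : ∃ r, I.R = r + 7 := ⟨I.R - 7, by omega⟩
      rw [hr]
      ring_nf
      omega

theorem numStates_pos (τ : ℕ) : 0 < I.numStates τ := by
  unfold ColoringInput.numStates placeValue
  exact Finset.prod_pos fun _ _ => Nat.succ_pos _

end ColoringInput

/-! ### The program -/

theorem tabOf_update (m : ℕ → ℤ) (w : ℕ) (v z : ℤ) :
    tabOf (Function.update m (2 * (w : ℤ) + 1).toNat v) z = if z = w then v else tabOf m z := by
  unfold tabOf
  rw [Function.update_apply]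
  congr 1
  rw [eq_iff_iff]
  omega

theorem scratch_update (m : ℕ → ℤ) (w : ℕ) (v : ℤ) (i : ℕ) :
    Function.update m (2 * (w : ℤ) + 1).toNat v (2 * i) = m (2 * i) :=
  Function.update_of_ne (by omega) _ _

theorem tabAddr_eval (x m : ℕ → ℤ) (e : Expr) :
    (tabAddr e).eval x m = 2 * e.eval x m + 1 := rfl

/-- Writing a scratch register into the table. -/
theorem exists_store_cost_le (e : Expr) (j : ℕ) : ∃ c, ∀ (x : ℕ → ℤ) (ω : ℕ → Bool) (s : MState)
    (Q w : ℕ), 2 ≤ Q → e.Safe x s.mem Q → bitLen (s.mem (2 * j)) ≤ Q → e.eval x s.mem = w →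
    ∃ t s', Exec x ω (.assign (tabAddr e) (scratch j)) s t s' ∧ t ≤ Q ^ c ∧
      (∀ z, tabOf s'.mem z = if z = w then s.mem (2 * j) else tabOf s.mem z) ∧
      ∀ i, s'.mem (2 * i) = s.mem (2 * i) := by
  obtain ⟨c, hc⟩ := exists_assign_cost_le (tabAddr e) (scratch j)
  refine ⟨c, fun x ω s Q w hQ he hj hw => ?_⟩
  obtain ⟨t, h1, h2⟩ := hc x ω s Q hQ ⟨⟨trivial, he⟩, trivial⟩ (scratch_safe.2 hj)
  rw [tabAddr_eval, hw, scratch_eval] at h1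
  exact ⟨t, _, h1, by omega, tabOf_update _ _ _, scratch_update _ _ _⟩

/-- Flip `R ^ 2` coins and write the outcomes into the table. -/
def coinLoop : Prog :=
  .loop (.op .sub (.op .mul (scratch 1) (scratch 1)) (scratch 2))
    (.seq (.flip (tabAddr (.op .mul (.const 2) (scratch 2))))
      (setScratch 2 (.op .add (scratch 2) (.const 1))))

theorem exists_coinLoop_cost_le : ∃ c, ∀ (x : ℕ → ℤ) (ω : ℕ → Bool) (s : MState) (R Q : ℕ),
    2 ≤ Q → R ≤ Q → s.mem 2 = R → s.mem 4 = 0 → s.used = 0 → (∀ z, tabOf s.mem z = 0) →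
    ∃ t s', Exec x ω coinLoop s t s' ∧ t ≤ Q ^ c ∧ s'.mem 2 = R ∧
      (∀ j : ℕ, tabOf s'.mem (2 * j) = coinBits (R * R) ω j) ∧ ∀ z, bitLen (tabOf s'.mem z) ≤ 2 := by
  obtain ⟨c₁, h₁⟩ := (Expr.op .sub (.op .mul (scratch 1) (scratch 1)) (scratch 2)).exists_cost_le
  obtain ⟨c₂, h₂⟩ := (tabAddr (.op .mul (.const 2) (scratch 2))).exists_cost_le
  obtain ⟨c₃, h₃⟩ := exists_setScratch_cost_le 2 (.op .add (scratch 2) (.const 1))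
  refine ⟨2 + (3 * c₂ + 3 * c₃ + 1 + 1 + 1 + 3 * c₁ + 1) + 3 * c₁ + 1,
    fun x ω s R Q hQ hR hs1 hs2 hs3 hs4 => ?_⟩
  have hRQ : R * R ≤ Q ^ 2 := by rw [sq]; exact Nat.mul_le_mul hR hR
  have hQ3 : 2 ≤ Q ^ 3 := hQ.trans (le_self_pow_of_pos hQ (by omega))
  have hk : ∀ k : ℕ, k ≤ R * R → bitLen (k : ℤ) ≤ Q ^ 3 := fun k hk => by
    have h1 := bitLen_natCast_le k
    have h2 : Q ^ 2 + 1 ≤ Q ^ 3 := by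
      rw [pow_succ Q 2]
      have : 1 ≤ Q ^ 2 := Nat.one_le_pow _ _ (by omega)
      nlinarith
    omega
  have hR3 : bitLen (R : ℤ) ≤ Q ^ 3 := hk R (Nat.le_mul_self R)
  let I : ℕ → MState → Prop := fun k s' => s'.mem 2 = R ∧ s'.mem 4 = k ∧ s'.used = k ∧
    (∀ j : ℕ, tabOf s'.mem (2 * j) = coinBits k ω j) ∧ ∀ z, bitLen (tabOf s'.mem z) ≤ 2
  obtain ⟨t, s', d1, d2, d3⟩ := exec_loop (x := x) (ω := ω)
    (e := .op .sub (.op .mul (scratch 1) (scratch 1)) (scratch 2))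
    (p := .seq (.flip (tabAddr (.op .mul (.const 2) (scratch 2))))
      (setScratch 2 (.op .add (scratch 2) (.const 1))))
    I (R * R) (Q ^ (3 * c₂ + 3 * c₃ + 1 + 1 + 1)) (Q ^ (3 * c₁))
    (fun k hkR s' ⟨i1, i2, _⟩ => le_pow_comp <| h₁ x s'.mem (Q ^ 3) hQ3
      ⟨⟨scratch_safe.2 (by rw [show 2 * 1 = 2 from rfl, i1]; exact hR3),
        scratch_safe.2 (by rw [show 2 * 1 = 2 from rfl, i1]; exact hR3)⟩,
        scratch_safe.2 (by rw [show 2 * 2 = 4 from rfl, i2]; exact hk k hkR)⟩)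
    (fun k hkR s' ⟨i1, i2, _⟩ => by
      simp only [Expr.eval, Op.eval, scratch_eval, show 2 * 1 = 2 from rfl,
        show 2 * 2 = 4 from rfl, i1, i2, sub_pos]
      exact_mod_cast Iff.rfl)
    (fun k hkR s' ⟨i1, i2, i3, i4, i5⟩ => by
      have haddr : (tabAddr (.op .mul (.const 2) (scratch 2))).eval x s'.mem
          = 2 * ((2 * k : ℕ) : ℤ) + 1 := by
        rw [tabAddr_eval]
        simp only [Expr.eval, Op.eval, scratch_eval, show 2 * 2 = 4 from rfl, i2]
        push_cast
        rfl
      have hc := le_pow_comp <| h₂ x s'.mem (Q ^ 3) hQ3 ⟨⟨trivial, trivial,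
        scratch_safe.2 (by rw [show 2 * 2 = 4 from rfl, i2]; exact hk k hkR.le)⟩, trivial⟩
      have hf := Exec.flip (x := x) (ω := ω) (tabAddr (.op .mul (.const 2) (scratch 2))) s'
      rw [haddr] at hf hc
      set s₁ : MState := ⟨Function.update s'.mem (2 * ((2 * k : ℕ) : ℤ) + 1).toNat
        (if ω s'.used then 1 else 0), s'.used + 1⟩ with hs₁
      have j0 : ∀ i, s₁.mem (2 * i) = s'.mem (2 * i) := scratch_update _ _ _
      have j1 : s₁.mem 2 = R := (j0 1).trans i1
      have j2 : s₁.mem 4 = k := (j0 2).trans i2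
      have j3 : ∀ z, tabOf s₁.mem z = if z = (2 * k : ℕ) then (if ω s'.used then 1 else 0)
        else tabOf s'.mem z := tabOf_update _ _ _
      obtain ⟨t, s₂, k1, k2, k3, k4, k5⟩ := h₃ x ω s₁ (Q ^ 3) hQ3
        ⟨scratch_safe.2 (by rw [show 2 * 2 = 4 from rfl, j2]; exact hk k hkR.le), trivial⟩
      have hT : tabOf s₂.mem = tabOf s₁.mem := (Frame.of_set k4 k5).tabOf_eq (by omega)
      refine ⟨_, s₂, .seq hf k1, ?_, ?_, ?_, ?_, ?_, ?_⟩
      · have := add_le_pow hQ (add_le_pow hQ hc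
          (le_pow_comp (le_trans (by omega : t ≤ (Q ^ 3) ^ c₃) le_rfl))) (i := 3 * c₂ + 3 * c₃ + 1)
          (Nat.one_le_pow 0 Q (by omega))
        have h4 := pow_le_pow_of_le hQ
          (by omega : 3 * c₂ + 3 * c₃ + 1 + 0 + 1 ≤ 3 * c₂ + 3 * c₃ + 1 + 1 + 1)
        omega
      · rw [k5 _ (by omega), j1]
      · rw [show 4 = 2 * 2 from rfl, k3]
        simp only [Expr.eval, Op.eval, scratch_eval, show 2 * 2 = 4 from rfl, j2]
        push_cast
        rfl
      · rw [k4, hs₁, i3]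
      · intro j
        rw [hT, j3, i3]
        by_cases hj : j = k
        · subst hj
          rw [if_pos (by push_cast; rfl)]
          simp [coinBits]
        · rw [if_neg (by push_cast; omega), i4]
          have : (j < k + 1) ↔ j < k := by omega
          simp [coinBits, this]
      · intro z
        rw [hT, j3]
        split
        · split <;> simp [bitLen]
        · exact i5 z)
    (s := s) ⟨hs1, by simpa using hs2, hs3, fun j => by simp [hs4, coinBits],
      fun z => by simp [hs4, bitLen]⟩
  obtain ⟨i1, -, -, i4, i5⟩ := d3
  refine ⟨t, s', d1, d2.trans ?_, i1, i4, i5⟩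
  exact add_le_pow hQ (mul_le_pow hRQ (add_le_pow hQ le_rfl le_rfl)) le_rfl

/-- The place in the table for the value of the state with index `s` at time `t`. -/
def slotExpr (s t : Expr) : Expr :=
  .op .add (.op .mul (.const 2) (.op .add (.op .mul s (scratch 1)) t)) (.const 1)

/-- Compute the value of the state whose index is in scratch register `3`, at the time after that in
scratch register `2`. -/
def fillState : Prog :=
  .seq (Term.step.compile [3, 2] 5)
    (.seq (.assign (tabAddr (slotExpr (scratch 3) (.op .add (scratch 2) (.const 1)))) (scratch 5))
      (setScratch 3 (.op .add (scratch 3) (.const 1))))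

/-- Compute the values of all states, at the time after that in scratch register `2`. -/
def fillRow : Prog :=
  .seq ((Term.bind (.var 0 + 1) Term.numStates).compile [2] 4)
    (.seq (setScratch 3 (.const 0))
      (.seq (.loop (.op .sub (scratch 4) (scratch 3)) fillState)
        (setScratch 2 (.op .add (scratch 2) (.const 1)))))

/-- The table holds the bits `c`, and the values of all states at time `τ`. -/
structure RowFilled (I : ColoringInput) (c : ℕ → ℤ) (Q τ : ℕ) (s : MState) : Prop where
  param : s.mem 2 = I.R
  time : s.mem 4 = τ
  bits : ∀ j : ℕ, tabOf s.mem (2 * j) = c j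
  value : ∀ k < I.numStates τ,
    tabOf s.mem (2 * ((k * I.R + τ : ℕ) : ℤ) + 1) = I.value c τ (I.state τ k)
  bitLen_le : ∀ z, bitLen (tabOf s.mem z) ≤ Q

/-- The assumptions under which the program is run: the words `x` describe the instance, and all
numbers that occur have at most `Q` bits. -/
structure Setting (I : ColoringInput) (x : ℕ → ℤ) (c : ℕ → ℤ) (Q : ℕ) : Prop where
  isInput : I.IsInput x
  q_le : I.q ≤ I.n
  two_le : 2 ≤ Q
  R_lt : I.R < Q
  inp : ∀ i, bitLen (x i) ≤ Q
  value : ∀ τ ≤ I.sched.H, ∀ k, bitLen (I.value c τ (I.state τ k)) ≤ Q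
  numStates : ∀ τ, bitLen (I.numStates τ) ≤ Q

theorem RowFilled.frame {I : ColoringInput} {c : ℕ → ℤ} {Q τ sp : ℕ} {s s' : MState}
    (h : RowFilled I c Q τ s) (hf : Frame sp s s') (hsp : 3 ≤ sp) : RowFilled I c Q τ s' where
  param := (hf.scratch_eq (j := 1) (by omega)).trans h.param
  time := (hf.scratch_eq (j := 2) (by omega)).trans h.time
  bits := by rw [hf.tabOf_eq (by omega)]; exact h.bits
  value := by rw [hf.tabOf_eq (by omega)]; exact h.value
  bitLen_le := by rw [hf.tabOf_eq (by omega)]; exact h.bitLen_le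

theorem Setting.bitLen_le {I : ColoringInput} {x c : ℕ → ℤ} {Q : ℕ} (h : Setting I x c Q) {k : ℕ}
    (hk : k ≤ I.R) : bitLen (k : ℤ) ≤ Q := by
  have := bitLen_natCast_le k
  have := h.R_lt
  omega

theorem RowFilled.ready {I : ColoringInput} {x c : ℕ → ℤ} {Q τ : ℕ} {s : MState}
    (h : RowFilled I c Q τ s) (hS : Setting I x c Q) : Ready x I.R Q [] s where
  two_le := hS.two_le
  le := hS.R_lt.le
  param := h.param
  var := by simp
  inp := hS.inp
  tab := h.bitLen_le

theorem slot_injective {R k s τ σ : ℕ} (hτ : τ < R) (hσ : σ < R) (h : k * R + τ = s * R + σ) :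
    k = s ∧ τ = σ := by
  have h1 : (k * R + τ) % R = τ := by rw [Nat.mul_add_mod', Nat.mod_eq_of_lt hτ]
  have h2 : (s * R + σ) % R = σ := by rw [Nat.mul_add_mod', Nat.mod_eq_of_lt hσ]
  have h3 : τ = σ := by rw [← h1, ← h2, h]
  subst h3
  exact ⟨Nat.eq_of_mul_eq_mul_right (by omega : 0 < R) (by omega), rfl⟩

theorem exists_fillState_cost_le : ∃ d, ∀ (I : ColoringInput) (x c : ℕ → ℤ) (Q : ℕ)
    (ω : ℕ → Bool) (τ k : ℕ) (s : MState), Setting I x c Q → τ < I.sched.H →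
    k < I.numStates (τ + 1) → RowFilled I c Q τ s → s.mem 6 = k →
    ∃ t s', Exec x ω fillState s t s' ∧ t ≤ Q ^ d ∧ RowFilled I c Q τ s' ∧ s'.mem 6 = (k + 1 : ℕ) ∧
      s'.mem 8 = s.mem 8 ∧
      ∀ z, tabOf s'.mem z = if z = 2 * ((k * I.R + (τ + 1) : ℕ) : ℤ) + 1 then
        I.value c (τ + 1) (I.state (τ + 1) k) else tabOf s.mem z := by
  obtain ⟨c₁, h₁⟩ := Term.step.compile_spec [3, 2] 5 (by omega) (by simp)
  obtain ⟨c₂, h₂⟩ := exists_store_cost_le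
    (slotExpr (scratch 3) (.op .add (scratch 2) (.const 1))) 5
  obtain ⟨c₃, h₃⟩ := exists_setScratch_cost_le 3 (.op .add (scratch 3) (.const 1))
  refine ⟨c₁ + c₂ + 1 + c₃ + 1, fun I x c Q ω τ k s hS hτ hk hs h6 => ?_⟩
  have hQ := hS.two_le
  have hH := I.two_mul_H_add_two_le
  have hkQ : bitLen (k : ℤ) ≤ Q :=
    (bitLen_mono (by simpa using hk.le)).trans (hS.numStates (τ + 1))
  have hτQ : bitLen (τ : ℤ) ≤ Q := hS.bitLen_le (by omega)
  have hRQ : bitLen (I.R : ℤ) ≤ Q := hS.bitLen_le le_rfl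
  obtain ⟨t₁, s₁, a1, a2, a3, a4⟩ := h₁ x ω I.R Q s (((hs.ready hS).cons (r := 2) (by
    rw [show 2 * 2 = 4 from rfl, hs.time]; exact hτQ)).cons (r := 3) (by
    rw [show 2 * 3 = 6 from rfl, h6]; exact hkQ))
  have hr₁ := hs.frame a4 (by omega)
  have hv : s₁.mem (2 * 5) = I.value c (τ + 1) (I.state (τ + 1) k) := by
    rw [a3]
    simp only [List.map_cons, List.map_nil, show 2 * 2 = 4 from rfl, show 2 * 3 = 6 from rfl, h6,
      hs.time]
    exact Term.eval_step hS.isInput hS.q_le hs.bits hτ hs.value hk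
  have b6 : s₁.mem (2 * 3) = k := (a4.scratch_eq (by omega)).trans h6
  have b8 : s₁.mem 8 = s.mem 8 := a4.scratch_eq (j := 4) (by omega)
  have hR1 : s₁.mem (2 * 1) = I.R := hr₁.param
  have hτ1 : s₁.mem (2 * 2) = τ := hr₁.time
  obtain ⟨t₂, s₂, d1, d2, d3, d4⟩ := h₂ x ω s₁ Q (2 * (k * I.R + (τ + 1)) + 1) hQ
    ⟨⟨trivial, ⟨scratch_safe.2 (by rw [b6]; exact hkQ), scratch_safe.2 (by rw [hR1]; exact hRQ)⟩,
      scratch_safe.2 (by rw [hτ1]; exact hτQ), trivial⟩, trivial⟩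
    (by rw [hv]; exact hS.value _ hτ _)
    (by
      simp only [slotExpr, Expr.eval, Op.eval, scratch_eval, b6, hR1, hτ1]
      push_cast
      rfl)
  obtain ⟨t₃, s₃, e1, e2, e3, e4, e5⟩ := h₃ x ω s₂ Q hQ
    ⟨scratch_safe.2 (by rw [d4, b6]; exact hkQ), trivial⟩
  have hT : ∀ z, tabOf s₃.mem z = if z = 2 * ((k * I.R + (τ + 1) : ℕ) : ℤ) + 1 then
        I.value c (τ + 1) (I.state (τ + 1) k) else tabOf s.mem z := by
    intro z
    rw [(Frame.of_set e4 e5).tabOf_eq (by omega), d3, hv, a4.tabOf_eq (by omega)]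
    push_cast
    rfl
  refine ⟨_, s₃, .seq a1 (.seq d1 e1), ?_, ⟨?_, ?_, ?_, ?_, ?_⟩, ?_, ?_, hT⟩
  · have := add_le_pow hQ (add_le_pow hQ (le_trans (by omega : t₁ ≤ Q ^ c₁) le_rfl) d2)
      (le_trans (by omega : t₃ ≤ Q ^ c₃) le_rfl)
    omega
  · rw [e5 _ (by omega)]
    exact (d4 1).trans hR1
  · rw [e5 _ (by omega)]
    exact (d4 2).trans hτ1
  · intro j
    rw [hT, if_neg (by omega), hs.bits]
  · intro i hi
    rw [hT, if_neg, hs.value i hi]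
    intro h
    have h' : i * I.R + τ = k * I.R + (τ + 1) := by omega
    have := slot_injective (by omega) (by omega) h'
    omega
  · intro z
    rw [hT]
    split
    · exact hS.value _ hτ _
    · exact hs.bitLen_le z
  · rw [show 6 = 2 * 3 from rfl, e3]
    simp only [Expr.eval, Op.eval, scratch_eval, d4, b6]
    push_cast
    rfl
  · rw [e5 _ (by omega), show 8 = 2 * 4 from rfl, d4]
    exact b8

theorem exists_fillRow_cost_le : ∃ d, ∀ (I : ColoringInput) (x c : ℕ → ℤ) (Q M : ℕ)
    (ω : ℕ → Bool) (τ : ℕ) (s : MState), Setting I x c Q → τ < I.sched.H →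
    I.numStates (τ + 1) ≤ M → RowFilled I c Q τ s →
    ∃ t s', Exec x ω fillRow s t s' ∧ t ≤ M * Q ^ d ∧ RowFilled I c Q (τ + 1) s' := by
  obtain ⟨c₁, h₁⟩ := (Term.bind (.var 0 + 1) Term.numStates).compile_spec [2] 4 (by omega) (by simp)
  obtain ⟨c₂, h₂⟩ := exists_setScratch_cost_le 3 (.const 0)
  obtain ⟨c₃, h₃⟩ := exists_fillState_cost_le
  obtain ⟨c₄, h₄⟩ := (Expr.op .sub (scratch 4) (scratch 3)).exists_cost_le
  obtain ⟨c₅, h₅⟩ := exists_setScratch_cost_le 2 (.op .add (scratch 2) (.const 1))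
  refine ⟨c₃ + c₄ + 1 + (c₁ + c₂ + 1 + (c₄ + c₅ + 1) + 1) + 1,
    fun I x c Q M ω τ s hS hτ hM hs => ?_⟩
  have hQ := hS.two_le
  have hH := I.two_mul_H_add_two_le
  have hτQ : bitLen (τ : ℤ) ≤ Q := hS.bitLen_le (by omega)
  have hkQ : ∀ k ≤ I.numStates (τ + 1), bitLen (k : ℤ) ≤ Q := fun k hk =>
    (bitLen_mono (by simpa using hk)).trans (hS.numStates (τ + 1))
  obtain ⟨t₁, s₁, a1, a2, a3, a4⟩ := h₁ x ω I.R Q s ((hs.ready hS).cons (r := 2) (by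
    rw [show 2 * 2 = 4 from rfl, hs.time]; exact hτQ))
  have hr₁ := hs.frame a4 (by omega)
  have hv : s₁.mem (2 * 4) = I.numStates (τ + 1) := by
    rw [a3]
    simp only [List.map_cons, List.map_nil, show 2 * 2 = 4 from rfl, hs.time, Term.eval_bind,
      Term.eval_add, Term.eval_var_zero, Term.eval_one]
    exact Term.eval_numStates (τ := τ + 1) hS.isInput hτ
  obtain ⟨t₂, s₂, b1, b2, b3, b4, b5⟩ := h₂ x ω s₁ Q hQ trivial
  have hr₂ := hr₁.frame (Frame.of_set b4 b5) le_rfl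
  let J : ℕ → MState → Prop := fun k s' => RowFilled I c Q τ s' ∧ s'.mem 6 = k ∧
    s'.mem 8 = I.numStates (τ + 1) ∧ ∀ j < k,
      tabOf s'.mem (2 * ((j * I.R + (τ + 1) : ℕ) : ℤ) + 1) = I.value c (τ + 1) (I.state (τ + 1) j)
  obtain ⟨t₃, s₃, d1, d2, d3, d4, d5, d6⟩ := exec_loop (x := x) (ω := ω)
    (e := .op .sub (scratch 4) (scratch 3)) (p := fillState) J (I.numStates (τ + 1)) (Q ^ c₃)
    (Q ^ c₄)
    (fun k hk s' ⟨i1, i2, i3, i4⟩ => h₄ x s'.mem Q hQ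
      ⟨scratch_safe.2 (by rw [show 2 * 4 = 8 from rfl, i3]; exact hkQ _ le_rfl),
        scratch_safe.2 (by rw [show 2 * 3 = 6 from rfl, i2]; exact hkQ _ hk)⟩)
    (fun k hk s' ⟨i1, i2, i3, i4⟩ => by
      simp only [Expr.eval, Op.eval, scratch_eval, show 2 * 4 = 8 from rfl,
        show 2 * 3 = 6 from rfl, i2, i3]
      omega)
    (fun k hk s' ⟨i1, i2, i3, i4⟩ => by
      obtain ⟨t, s'', e1, e2, e3, e4, e5, e6⟩ := h₃ I x c Q ω τ k s' hS hτ hk i1 i2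
      refine ⟨t, s'', e1, e2, e3, e4, e5.trans i3, fun j hj => ?_⟩
      rw [e6]
      by_cases hjk : j = k
      · rw [hjk, if_pos rfl]
      · rw [if_neg, i4 j (by omega)]
        intro h
        have h' : j * I.R + (τ + 1) = k * I.R + (τ + 1) := by omega
        exact hjk (slot_injective (by omega) (by omega) h').1)
    (s := s₂) ⟨hr₂, by rw [show 6 = 2 * 3 from rfl, b3]; rfl,
      by rw [b5 _ (by omega)]; exact hv, fun j hj => absurd hj (Nat.not_lt_zero j)⟩
  obtain ⟨t₄, s₄, f1, f2, f3, f4, f5⟩ := h₅ x ω s₃ Q hQ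
    ⟨scratch_safe.2 (by rw [show 2 * 2 = 4 from rfl, d3.time]; exact hτQ), trivial⟩
  have hT : tabOf s₄.mem = tabOf s₃.mem := (Frame.of_set f4 f5).tabOf_eq (by omega)
  refine ⟨_, s₄, .seq a1 (.seq b1 (.seq d1 f1)), ?_, ?_, ?_, ?_, ?_, ?_⟩
  · have hMpos : 1 ≤ M := (I.numStates_pos (τ + 1)).trans_le hM
    have g1 := add_le_pow hQ (add_le_pow hQ (le_trans (by omega : t₁ ≤ Q ^ c₁) le_rfl)
      (le_trans (by omega : t₂ ≤ Q ^ c₂) le_rfl))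
      (add_le_pow hQ (le_refl (Q ^ c₄)) (le_trans (by omega : t₄ ≤ Q ^ c₅) le_rfl))
    have g2 := add_le_pow hQ (add_le_pow hQ (le_refl (Q ^ c₃)) (le_refl (Q ^ c₄))) g1
    have g3 : I.numStates (τ + 1) * (Q ^ c₃ + Q ^ c₄) ≤ M * (Q ^ c₃ + Q ^ c₄) :=
      Nat.mul_le_mul_right _ hM
    refine le_trans ?_ (Nat.mul_le_mul_left M g2)
    have g4 : 1 * (t₁ + t₂ + (Q ^ c₄ + t₄)) ≤ M * (t₁ + t₂ + (Q ^ c₄ + t₄)) :=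
      Nat.mul_le_mul_right _ hMpos
    rw [Nat.mul_add M]
    omega
  · rw [f5 _ (by omega)]
    exact d3.param
  · rw [show 4 = 2 * 2 from rfl, f3]
    simp only [Expr.eval, Op.eval, scratch_eval, show 2 * 2 = 4 from rfl, d3.time]
    push_cast
    rfl
  · rw [hT]
    exact d3.bits
  · rw [hT]
    exact d6
  · rw [hT]
    exact d3.bitLen_le

/-- The number of time steps. -/
def horizonExpr : Expr := .op .mul (.inp (.const 2)) (.op .mul (.inp (.const 0)) (.inp (.const 0)))

/-- The sum of the numbers of vertices and of bags, plus seven. -/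
def sizeExpr : Expr := .op .add (.op .add (.inp (.const 0)) (.inp (.const 2))) (.const 7)

/-- The program for instances with fewer colors than vertices. -/
def mainProg : Prog :=
  .seq (setScratch 1 (.op .mul (.op .mul sizeExpr sizeExpr) sizeExpr))
    (.seq coinLoop
      (.seq (Term.start.compile [] 2)
        (.seq (.assign (tabAddr (.const 1)) (scratch 2))
          (.seq (setScratch 2 (.const 0))
            (.seq (.loop (.op .sub horizonExpr (scratch 2)) fillRow)
              (.seq (Term.answer.compile [] 2) (setScratch 0 (scratch 2))))))))

/-- The program: if there are at least as many colors as vertices, the answer is yes. -/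
def coloringProg : Prog :=
  .ite (.op .sub (.op .add (.inp (.const 1)) (.const 1)) (.inp (.const 0)))
    (setScratch 0 (.const 1)) mainProg

theorem exists_mainProg_cost_le : ∃ d, ∀ (I : ColoringInput) (x : ℕ → ℤ) (ω : ℕ → Bool) (M : ℕ),
    I.IsInput x → I.q ≤ I.n → (∀ i, bitLen (x i) ≤ I.R) → (∀ τ, I.numStates τ ≤ M) →
    ∃ t s', Exec x ω mainProg MState.init t s' ∧ t ≤ M * (I.R ^ 4) ^ d ∧
      s'.mem 0 = if I.value (coinBits (I.R * I.R) ω) I.sched.H 0 ≠ 0 then 1 else 0 := by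
  obtain ⟨c₁, h₁⟩ := exists_setScratch_cost_le 1 (.op .mul (.op .mul sizeExpr sizeExpr) sizeExpr)
  obtain ⟨c₂, h₂⟩ := exists_coinLoop_cost_le
  obtain ⟨c₃, h₃⟩ := Term.start.compile_spec [] 2 (by omega) (by simp)
  obtain ⟨c₄, h₄⟩ := exists_store_cost_le (.const 1) 2
  obtain ⟨c₅, h₅⟩ := exists_setScratch_cost_le 2 (.const 0)
  obtain ⟨c₆, h₆⟩ := exists_fillRow_cost_le
  obtain ⟨c₇, h₇⟩ := (Expr.op .sub horizonExpr (scratch 2)).exists_cost_le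
  obtain ⟨c₈, h₈⟩ := Term.answer.compile_spec [] 2 (by omega) (by simp)
  obtain ⟨c₉, h₉⟩ := exists_setScratch_cost_le 0 (scratch 2)
  refine ⟨1 + (c₆ + c₇ + 1) + (c₁ + c₂ + 1 + (c₃ + c₄ + 1) + 1 + (c₅ + c₇ + 1 + (c₈ + (c₈ + 1) * c₉ +
    1) + 1) + 1) + 1, fun I x ω M hx hq hbits hM => ?_⟩
  have hR := I.n_add_len_le
  have hH := I.two_mul_H_add_two_le
  set Q := I.R ^ 4 with hQdef
  have hRQ : I.R < Q := by
    rw [hQdef]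
    nth_rewrite 1 [← pow_one I.R]
    exact Nat.pow_lt_pow_right (by omega) (by norm_num)
  have hQ : 2 ≤ Q := by omega
  set c := coinBits (I.R * I.R) ω with hc
  have hS : Setting I x c Q := ⟨hx, hq, hQ, hRQ, fun i => (hbits i).trans hRQ.le,
    fun τ hτ k => I.bitLen_value_le hq ω hτ k, I.bitLen_numStates_le⟩
  have hsize : sizeExpr.Safe x MState.init.mem Q :=
    ⟨⟨⟨trivial, hS.inp _⟩, trivial, hS.inp _⟩, trivial⟩
  obtain ⟨t₁, s₁, a1, a2, a3, a4, a5⟩ := h₁ x ω MState.init Q hQ ⟨⟨hsize, hsize⟩, hsize⟩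
  have hs1 : s₁.mem 2 = I.R := by
    rw [show 2 = 2 * 1 from rfl, a3]
    simp only [sizeExpr, Expr.eval, Op.eval, Int.toNat_zero, show (2 : ℤ).toNat = 2 from rfl,
      hx.n_eq, hx.len_eq,
      ColoringInput.R]
    push_cast
    rfl
  have hT1 : ∀ z, tabOf s₁.mem z = 0 := fun z => by
    rw [(Frame.of_set a4 a5).tabOf_eq le_rfl]
    rfl
  obtain ⟨t₂, s₂, b1, b2, b3, b4, b5⟩ := h₂ x ω s₁ I.R Q hQ hRQ.le hs1
    (by rw [a5 _ (by omega)]; rfl) (by rw [a4]; rfl) hT1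
  obtain ⟨t₃, s₃, d1, d2, d3, d4⟩ := h₃ x ω I.R Q s₂
    ⟨hQ, hRQ.le, b3, by simp, hS.inp, fun z => (b5 z).trans hQ⟩
  rw [Term.eval_start hx hq b4] at d3
  have hT3 := d4.tabOf_eq (by omega : 1 ≤ 2)
  obtain ⟨t₄, s₄, e1, e2, e3, e4⟩ := h₄ x ω s₃ Q 1 hQ trivial
    (by rw [d3]; exact hS.value 0 (Nat.zero_le _) 0) (by simp [Expr.eval])
  obtain ⟨t₅, s₅, f1, f2, f3, f4, f5⟩ := h₅ x ω s₄ Q hQ trivial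
  have hT5 : ∀ z, tabOf s₅.mem z = if z = 1 then I.value c 0 (I.state 0 0)
      else tabOf s₂.mem z := by
    intro z
    rw [(Frame.of_set f4 f5).tabOf_eq (by omega), e3, d3, hT3]
    rfl
  have hrow : RowFilled I c Q 0 s₅ := by
    refine ⟨?_, ?_, ?_, ?_, ?_⟩
    · rw [f5 _ (by omega)]
      exact ((e4 1).trans (d4.scratch_eq (by omega))).trans b3
    · rw [show 4 = 2 * 2 from rfl, f3]
      rfl
    · intro j
      rw [hT5, if_neg (by omega), b4]
    · intro k hk
      have hk0 : k = 0 := by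
        have : I.numStates 0 = 1 := by
          unfold ColoringInput.numStates placeValue
          refine Finset.prod_eq_one fun w _ => ?_
          have : I.sched.cnt w 0 = 0 := rfl
          simp only [Schedule.cap, this]
          split <;> omega
        omega
      subst hk0
      rw [hT5, if_pos (by simp)]
    · intro z
      rw [hT5]
      split
      · exact hS.value 0 (Nat.zero_le _) 0
      · exact (b5 z).trans hQ
  have hhor : ∀ m, horizonExpr.eval x m = I.sched.H := by
    intro m
    simp only [horizonExpr, Expr.eval, Op.eval, Int.toNat_zero, show (2 : ℤ).toNat = 2 from rfl,
      hx.n_eq, hx.len_eq, ColoringInput.sched]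
    push_cast
    rfl
  obtain ⟨t₆, s₆, g1, g2, g3⟩ := exec_loop (x := x) (ω := ω)
    (e := .op .sub horizonExpr (scratch 2)) (p := fillRow) (fun τ s => RowFilled I c Q τ s)
    I.sched.H (M * Q ^ c₆) (Q ^ c₇)
    (fun τ hτ s hs => h₇ x s.mem Q hQ ⟨⟨⟨trivial, hS.inp _⟩, ⟨trivial, hS.inp _⟩, trivial,
      hS.inp _⟩, scratch_safe.2 (by
        rw [show 2 * 2 = 4 from rfl, hs.time]; exact hS.bitLen_le (by omega))⟩)
    (fun τ hτ s hs => by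
      rw [Expr.eval, hhor, scratch_eval, show 2 * 2 = 4 from rfl, hs.time, Op.eval]
      omega)
    (fun τ hτ s hs => h₆ I x c Q M ω τ s hS hτ (hM _) hs) hrow
  obtain ⟨t₇, s₇, i1, i2, i3, i4⟩ := h₈ x ω I.R Q s₆ (g3.ready hS)
  have hQ8 : Q ^ c₈ ≤ Q ^ (c₈ + 1) := pow_le_pow_of_le hQ (by omega)
  obtain ⟨t₈, s₈, j1, j2, j3, -, -⟩ := h₉ x ω s₇ (Q ^ (c₈ + 1))
    (hQ.trans (le_self_pow_of_pos hQ (by omega))) (scratch_safe.2 (by omega))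
  refine ⟨_, s₈, .seq a1 (.seq b1 (.seq d1 (.seq e1 (.seq f1 (.seq g1 (.seq i1 j1)))))), ?_, ?_⟩
  · have hMpos : 1 ≤ M := (I.numStates_pos 0).trans_le (hM 0)
    have k1 := mul_le_pow (hRQ.le.trans self_le_pow)
      (add_le_pow hQ (le_refl (Q ^ c₆)) (le_refl (Q ^ c₇)))
    have k2 := add_le_pow hQ (add_le_pow hQ
      (add_le_pow hQ (le_trans (by omega : t₁ ≤ Q ^ c₁) le_rfl) b2)
      (add_le_pow hQ (le_trans (by omega : t₃ ≤ Q ^ c₃) le_rfl) e2))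
      (add_le_pow hQ (add_le_pow hQ (le_trans (by omega : t₅ ≤ Q ^ c₅) le_rfl)
        (le_refl (Q ^ c₇)))
        (add_le_pow hQ (le_trans (by omega : t₇ ≤ Q ^ c₈) le_rfl)
        (le_pow_comp (le_trans (by omega : t₈ ≤ (Q ^ (c₈ + 1)) ^ c₉) le_rfl))))
    have k3 : I.sched.H * (M * Q ^ c₆ + Q ^ c₇) ≤ M * (I.R * (Q ^ c₆ + Q ^ c₇)) := calc
      I.sched.H * (M * Q ^ c₆ + Q ^ c₇) ≤ I.R * (M * Q ^ c₆ + M * Q ^ c₇) := by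
        gcongr
        · omega
        · exact Nat.le_mul_of_pos_left _ hMpos
      _ = M * (I.R * (Q ^ c₆ + Q ^ c₇)) := by ring
    refine le_trans ?_ (Nat.mul_le_mul_left M (add_le_pow hQ k1 k2))
    rw [Nat.mul_add M]
    have k4 := Nat.mul_le_mul_right (t₁ + t₂ + (t₃ + t₄) + (t₅ + Q ^ c₇ + (t₇ + t₈))) hMpos
    rw [one_mul] at k4
    omega
  · rw [show 0 = 2 * 0 from rfl, j3, scratch_eval, i3]
    rw [Term.eval_answer hx, g3.value 0 (I.numStates_pos _)]
    have : I.state I.sched.H 0 = 0 := by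
      funext w
      simp [ColoringInput.state, mixedDigit]
    rw [this]

/-! ### Correctness of the answer -/

theorem colorable_iff_exists {n : ℕ} (G : SimpleGraph (Fin n)) (q : ℕ) : G.Colorable q ↔
    ∃ x ∈ Fintype.piFinset fun _ : Fin n => Finset.range q, ∀ u v, G.Adj u v → x u ≠ x v := by
  constructor
  · rintro ⟨C⟩
    exact ⟨fun v => C v, Fintype.mem_piFinset.2 fun v => Finset.mem_range.2 (C v).2,
      fun u v h hx => C.valid h (Fin.ext hx)⟩
  · rintro ⟨x, hx, h⟩
    have hx' : ∀ v, x v < q := fun v => Finset.mem_range.1 (Fintype.mem_piFinset.1 hx v)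
    exact ⟨SimpleGraph.Coloring.mk (fun v => ⟨x v, hx' v⟩) fun {u v} hadj he =>
      h u v hadj (congrArg Fin.val he)⟩

section Graph

variable {n : ℕ} (G : SimpleGraph (Fin n)) [DecidableRel G.Adj] (P : PathDecomposition G) (q : ℕ)

open ColoringInput

/-- The final value of the dynamic program when the random numbers are made from `ω`. -/
def finalValue (ω : ℕ → Bool) : ℤ :=
  (ofGraph G P q).value (coinBits ((ofGraph G P q).R * (ofGraph G P q).R) ω)
    (ofGraph G P q).sched.H 0

/-- The value computed by the program: a sum over all assignments of colors, in which only proper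
colorings have nonzero coefficients. -/
theorem finalValue_eq (ω : ℕ → Bool) : finalValue G P q ω
      = ∑ x ∈ Fintype.piFinset fun _ : Fin n => Finset.range q,
        (∏ i ∈ Finset.range (ofGraph G P q).sched.H, if (ofGraph G P q).sched.live i then
          extendColoring x ((ofGraph G P q).sched.a i)
            - extendColoring x ((ofGraph G P q).sched.b i) else 1)
        * ∏ w : Fin n, randomNumber (ofGraph G P q).R ω w ^ x w := by
  refine (Schedule.val_final (S := (ofGraph G P q).sched) q _).trans ?_
  refine Finset.sum_congr rfl fun x _ => congrArg _ ?_
  refine Finset.prod_congr rfl fun w _ => ?_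
  rw [numberOfBits_coinBits _ (w := w) w.2]

theorem colorable_of_finalValue_ne_zero (ω : ℕ → Bool)
    (h : finalValue G P q ω ≠ 0) : G.Colorable q := by
  rw [finalValue_eq] at h
  obtain ⟨x, hx, hne⟩ := Finset.exists_ne_zero_of_sum_ne_zero h
  exact (colorable_iff_exists G q).2
    ⟨x, hx, (graphPolynomial_ne_zero_iff G P q x).1 (left_ne_zero_of_mul hne)⟩

theorem inputSize_mul_le (hq : q < n) :
    inputSize (encodeInstance G P q) ≤ (ofGraph G P q).R ∧
      n * q * inputSize (encodeInstance G P q) ≤ 2 ^ (ofGraph G P q).R := by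
  have hN := inputSize_le G P q
  have hR : (ofGraph G P q).R = (n + P.len + 7) * (n + P.len + 7) * (n + P.len + 7) := rfl
  rw [hR]
  generalize inputSize (encodeInstance G P q) = N at *
  generalize P.len = l at *
  have hNm : N ≤ 2 * ((n + l + 7) * (n + l + 7)) := by
    have : 2 * ((n + l + 7) * (n + l + 7)) = 2 * (n * n + l * n) + (2 * (l * l + l * n) + 28 * n
      + 28 * l + 98) := by ring
    omega
  have hnm : n * q ≤ (n + l + 7) * (n + l + 7) := Nat.mul_le_mul (by omega) (by omega)
  have hm : 7 ≤ n + l + 7 := by omega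
  generalize n + l + 7 = m at *
  have h7 : 7 * (m * m) ≤ m * m * m := by
    rw [mul_comm (m * m)]
    exact Nat.mul_le_mul_right _ hm
  refine ⟨by omega, (Nat.mul_le_mul hnm hNm).trans ?_⟩
  have h2 : m ≤ 2 ^ m := Nat.lt_two_pow_self.le
  calc m * m * (2 * (m * m)) ≤ 2 ^ m * 2 ^ m * (2 * (2 ^ m * 2 ^ m)) := by gcongr
    _ = 2 ^ (4 * m + 1) := by ring
    _ ≤ 2 ^ (m * m * m) := Nat.pow_le_pow_right (by norm_num) (by nlinarith)

theorem measure_finalValue_eq_zero_le (hq : q < n) (hG : G.Colorable q) :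
    coinMeasure {ω | finalValue G P q ω = 0} ≤ (inputSize (encodeInstance G P q) : ENNReal)⁻¹ := by
  obtain ⟨x, hx, hproper⟩ := (colorable_iff_exists G q).1 hG
  simp only [finalValue_eq]
  refine (coinMeasure_sum_eq_zero_le _
    ⟨x, hx, (graphPolynomial_ne_zero_iff G P q x).2 hproper⟩).trans ?_
  have hN := le_inputSize G P q
  rw [ENNReal.le_inv_iff_mul_le, mul_right_comm, ← ENNReal.inv_pow, ← div_eq_mul_inv]
  refine ENNReal.div_le_of_le_mul ?_
  rw [one_mul]
  exact_mod_cast (inputSize_mul_le G P q hq).2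

theorem R_le_inputSize_pow (hn : 0 < n) :
    (ofGraph G P q).R ≤ inputSize (encodeInstance G P q) ^ 6 := by
  have hN := le_inputSize G P q
  have hR : (ofGraph G P q).R = (n + P.len + 7) * (n + P.len + 7) * (n + P.len + 7) := rfl
  have h1 : n ≤ n * n := Nat.le_mul_self n
  have h2 : P.len ≤ P.len * n := Nat.le_mul_of_pos_right _ hn
  rw [hR]
  generalize inputSize (encodeInstance G P q) = N at *
  have h3 : n + P.len + 7 ≤ N ^ 2 := by nlinarith
  calc _ ≤ N ^ 2 * N ^ 2 * N ^ 2 := by gcongr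
    _ = N ^ 6 := by ring

end Graph

theorem theorem3 :
    ∃ (p : Prog) (C c : ℕ), ∀ (n : ℕ) (G : SimpleGraph (Fin n)) [DecidableRel G.Adj]
      (P : PathDecomposition G) (q : ℕ),
      -- every run halts with an answer in the claimed time
      (∀ ω : ℕ → Bool, ∃ (t : ℕ) (b : Bool), Outputs p (encodeInstance G P q) ω t b ∧
        t ≤ C * (G.maxDegree / 2 + 1) ^ P.width * inputSize (encodeInstance G P q) ^ c) ∧
      -- no false positives
      (¬ G.Colorable q → ∀ ω : ℕ → Bool, ∃ t : ℕ,
        Outputs p (encodeInstance G P q) ω t false) ∧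
      -- high probability of the correct answer if there is a proper coloring
      (G.Colorable q →
        coinMeasure {ω | ¬ ∃ t : ℕ, Outputs p (encodeInstance G P q) ω t true} ≤
          ((inputSize (encodeInstance G P q) : ENNReal))⁻¹) := by
  obtain ⟨c₁, h₁⟩ := (Expr.op .sub (.op .add (.inp (.const 1)) (.const 1))
    (.inp (.const 0))).exists_cost_le
  obtain ⟨c₂, h₂⟩ := exists_setScratch_cost_le 0 (.const 1)
  obtain ⟨c₃, h₃⟩ := exists_mainProg_cost_le
  refine ⟨coloringProg, 1, c₁ + (c₂ + (1 + 24 * c₃) + 1) + 1, fun n G _ P q => ?_⟩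
  have hin := isInput_ofGraph G P q
  have hbits := bitLen_inputWords_le G P q
  have hN := le_inputSize G P q
  have hDpos : 1 ≤ (G.maxDegree / 2 + 1) ^ P.width := Nat.one_le_pow _ _ (Nat.succ_pos _)
  set N := inputSize (encodeInstance G P q) with hNdef
  set D := G.maxDegree / 2 + 1 with hD
  have hN2 : 2 ≤ N := by omega
  have hcond : ∀ m, (Expr.op .sub (.op .add (.inp (.const 1)) (.const 1))
      (.inp (.const 0))).eval (inputWords G P q) m = (q : ℤ) + 1 - n := fun _ => rfl
  have hcost := h₁ (inputWords G P q) MState.init.mem N hN2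
    ⟨⟨⟨trivial, hbits _⟩, trivial⟩, trivial, hbits _⟩
  -- the run of the program, and what its answer is
  have hrun : ∀ ω, ∃ (t : ℕ) (b : Bool), Outputs coloringProg (encodeInstance G P q) ω t b ∧
      t ≤ 1 * D ^ P.width * N ^ (c₁ + (c₂ + (1 + 24 * c₃) + 1) + 1) ∧
      (b = true ↔ n ≤ q ∨ finalValue G P q ω ≠ 0) := by
    intro ω
    by_cases hq : n ≤ q
    · obtain ⟨t, s, a1, a2, a3, -, -⟩ := h₂ (inputWords G P q) ω MState.init N hN2 trivial
      have hc : 0 < (Expr.op .sub (.op .add (.inp (.const 1)) (.const 1))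
          (.inp (.const 0))).eval (inputWords G P q) MState.init.mem := by rw [hcond]; omega
      refine ⟨_, true, ⟨s, .ite_pos hc a1, a3⟩, ?_, by simp [hq]⟩
      have h4 : t ≤ N ^ (c₂ + (1 + 24 * c₃) + 1) :=
        (by omega : t ≤ N ^ c₂).trans (pow_le_pow_of_le hN2 (by omega))
      rw [one_mul]
      exact (add_le_pow hN2 hcost h4).trans (Nat.le_mul_of_pos_left _ hDpos)
    · obtain ⟨hNR, -⟩ := inputSize_mul_le G P q (not_le.1 hq)
      have hRN := R_le_inputSize_pow G P q (by omega)
      obtain ⟨t, s, a1, a2, a3⟩ := h₃ (ColoringInput.ofGraph G P q) (inputWords G P q) ω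
        (D ^ (P.width + 1)) hin
        (not_le.1 hq).le (fun i => (hbits i).trans hNR) (numStates_le G P q)
      have hc : ¬ 0 < (Expr.op .sub (.op .add (.inp (.const 1)) (.const 1))
          (.inp (.const 0))).eval (inputWords G P q) MState.init.mem := by rw [hcond]; omega
      refine ⟨_, decide (finalValue G P q ω ≠ 0), ⟨s, .ite_neg hc a1, ?_⟩, ?_, by simp [hq]⟩
      · rw [a3]
        simp only [decide_eq_true_eq]
        rfl
      · -- bags have one vertex more than the width says; the extra factor `D` is polynomial
        have hDN : D ≤ N := by
          have h5 : G.maxDegree ≤ n := by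
            have : Nonempty (Fin n) := ⟨⟨0, by omega⟩⟩
            have := G.maxDegree_lt_card_verts
            simpa using this.le
          have h6 : n ≤ n * n := Nat.le_mul_self n
          omega
        have h7 : ((ColoringInput.ofGraph G P q).R ^ 4) ^ c₃ ≤ N ^ (24 * c₃) := by
          rw [show 24 * c₃ = 6 * (4 * c₃) by ring, pow_mul, ← pow_mul]
          exact Nat.pow_le_pow_left hRN _
        have h8 : t ≤ D ^ P.width * N ^ (1 + 24 * c₃) := by
          rw [pow_succ, mul_assoc] at a2
          exact a2.trans (Nat.mul_le_mul_left _ (mul_le_pow (hDN.trans self_le_pow) h7))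
        have h9 := add_le_pow hN2 hcost (pow_le_pow_of_le hN2
          (by omega : 1 + 24 * c₃ ≤ c₂ + (1 + 24 * c₃) + 1))
        rw [one_mul]
        refine le_trans ?_ (Nat.mul_le_mul_left _ h9)
        rw [Nat.mul_add]
        exact Nat.add_le_add (Nat.le_mul_of_pos_left _ hDpos) h8
  have hlarge : n ≤ q → G.Colorable q := fun h => by
    have := G.colorable_of_fintype
    rw [Fintype.card_fin] at this
    exact this.mono h
  refine ⟨fun ω => ?_, fun hG ω => ?_, fun hG => ?_⟩
  · obtain ⟨t, b, h, ht, -⟩ := hrun ω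
    exact ⟨t, b, h, ht⟩
  · obtain ⟨t, b, h, -, hb⟩ := hrun ω
    have : b = false := by
      rw [← Bool.not_eq_true, hb]
      rintro (h | h)
      · exact hG (hlarge h)
      · exact hG (colorable_of_finalValue_ne_zero G P q ω h)
    exact ⟨t, this ▸ h⟩
  · have key : ∀ ω, (¬ ∃ t, Outputs coloringProg (encodeInstance G P q) ω t true) →
        ¬ n ≤ q ∧ finalValue G P q ω = 0 := by
      intro ω hω
      obtain ⟨t, b, h, -, hb⟩ := hrun ω
      rw [← not_ne_iff (b := (0 : ℤ)), ← not_or, ← hb]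
      rintro rfl
      exact hω ⟨t, h⟩
    by_cases hq : n ≤ q
    · have : {ω | ¬ ∃ t, Outputs coloringProg (encodeInstance G P q) ω t true} = ∅ :=
        Set.eq_empty_of_forall_notMem fun ω hω => (key ω hω).1 hq
      rw [this, measure_empty]
      exact zero_le
    · exact (measure_mono fun ω hω => (key ω hω).2).trans
        (measure_finalValue_eq_zero_le G P q (not_le.1 hq) hG)
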